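/- In the problem Exact Cover by Arithmetic Progressions (XCAP), the input is a finite set $X$ of $n$ integers together with an integer $k\ge 0$, and the task is to find $k$ pairwise disjoint arithmetic progressions $s_1,\dots,s_k$ whose union is exactly $X$, or to report correctly that no such progressions exist; here an arithmetic progression is the set of terms of a sequence $a, a+d, a+2d,\dots,a+xd$ with integers $a,d$ and an integer $x\ge 0$. Theorem. XCAP can be solved by a deterministic algorithm running in time $2^{O(k^3)}\cdot \mathrm{poly}(n)$. More precisely, there are a program for the word RAM (unit-cost addition, subtraction, multiplication, integer division with remainder, comparison and memory access), a constant $C$ and a polynomial $p$ such that on every input $(X,k)$, with the elements of $X$ listed in any order, the program halts after at most $2^{Ck^3}\,p(n)$ steps with a correct answer, and uses only machine words of $O(\log(n+k+M+2))$ bits, where $M=\max_{x\in X}|x|$ (and $M=0$ if $X=\emptyset$). -/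

import Mathlib

/-! ### Arithmetic progressions and exact covers -/

/-- The set of elements of the arithmetic progression `a, a + d, a + 2d, …, a + x d`. -/
def apSet (a d : ℤ) (x : ℕ) : Set ℤ :=
  {z | ∃ i : ℕ, i ≤ x ∧ z = a + i * d}

/-- A set of integers is an arithmetic progression (AP) if it consists of the terms
`a, a + d, …, a + x d` for some start value `a`, difference `d` and `x ≥ 0`. -/
def IsAP (S : Set ℤ) : Prop :=
  ∃ (a d : ℤ) (x : ℕ), S = apSet a d x

/-- `s 0, …, s (k - 1)` is a solution of the instance `(X, k)` of Exact Cover by Arithmetic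
Progressions: the `s j` are APs, they are pairwise disjoint, and their union is exactly `X`. -/
def IsXCAPSolution (X : Finset ℤ) (k : ℕ) (s : Fin k → Set ℤ) : Prop :=
  (∀ j, IsAP (s j)) ∧ (∀ i j, i ≠ j → Disjoint (s i) (s j)) ∧ (⋃ j, s j) = (X : Set ℤ)

/-! ### The word RAM

A machine has registers `0, 1, 2, …` (a program names finitely many of them) and a random access
memory, all holding integers. Programs are goto-free; every operation takes one unit of time.
Machine words are bounded: if a computed value exceeds the bound, there is no run. -/

namespace WordRAM

/-- Contents of the registers and of the memory. -/
structure State where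
  reg : ℕ → ℤ
  mem : ℤ → ℤ

/-- The unit-cost binary operations: arithmetic, integer division with remainder, comparisons. -/
inductive BinOp where
  | add | sub | mul | div | mod | lt | eq

/-- The result of an operation. Comparisons return `1` (true) or `0` (false). -/
def BinOp.apply : BinOp → ℤ → ℤ → ℤ
  | .add, a, b => a + b
  | .sub, a, b => a - b
  | .mul, a, b => a * b
  | .div, a, b => a / b
  | .mod, a, b => a % b
  | .lt, a, b => if a < b then 1 else 0
  | .eq, a, b => if a = b then 1 else 0

/-- Expressions: literals, registers, the memory cell at a computed address, operations. -/
inductive Expr where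
  | lit (z : ℤ)
  | reg (r : ℕ)
  | load (addr : Expr)
  | bin (o : BinOp) (e₁ e₂ : Expr)

namespace Expr

/-- The value of an expression in a state. -/
def eval (s : State) : Expr → ℤ
  | lit z => z
  | reg r => s.reg r
  | load e => s.mem (e.eval s)
  | bin o e₁ e₂ => o.apply (e₁.eval s) (e₂.eval s)

/-- The time to evaluate an expression: one unit for each literal, register access, memory
access and operation in it. -/
def cost : Expr → ℕ
  | lit _ => 1
  | reg _ => 1
  | load e => e.cost + 1
  | bin _ e₁ e₂ => e₁.cost + e₂.cost + 1

/-- Every value that occurs in the evaluation (so also every address that is accessed) is at most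
`B` in absolute value. -/
def Fits (B : ℕ) (s : State) : Expr → Prop
  | lit z => z.natAbs ≤ B
  | reg r => (s.reg r).natAbs ≤ B
  | load e => e.Fits B s ∧ (s.mem (e.eval s)).natAbs ≤ B
  | bin o e₁ e₂ =>
      e₁.Fits B s ∧ e₂.Fits B s ∧ (o.apply (e₁.eval s) (e₂.eval s)).natAbs ≤ B

end Expr

/-- Programs. -/
inductive Prog where
  /-- do nothing -/
  | skip
  /-- write the value of `e` to register `r` -/
  | assign (r : ℕ) (e : Expr)
  /-- write the value of `e` to the memory cell whose address is the value of `addr` -/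
  | store (addr e : Expr)
  /-- run `p`, then `q` -/
  | seq (p q : Prog)
  /-- run `p` if the value of `e` is nonzero, otherwise `q` -/
  | ite (e : Expr) (p q : Prog)
  /-- as long as the value of `e` is nonzero, run `p` -/
  | loop (e : Expr) (p : Prog)

/-- `Exec B p s s' t`: on a machine whose words hold the integers of absolute value at most `B`,
the program `p` started in the state `s` halts in the state `s'` after `t` units of time. -/
inductive Exec (B : ℕ) : Prog → State → State → ℕ → Prop where
  | skip (s : State) : Exec B .skip s s 1
  | assign (s : State) (r : ℕ) (e : Expr) (he : e.Fits B s) :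
      Exec B (.assign r e) s ⟨Function.update s.reg r (e.eval s), s.mem⟩ (e.cost + 1)
  | store (s : State) (a e : Expr) (ha : a.Fits B s) (he : e.Fits B s) :
      Exec B (.store a e) s ⟨s.reg, Function.update s.mem (a.eval s) (e.eval s)⟩
        (a.cost + e.cost + 1)
  | seq {p q : Prog} {s₀ s₁ s₂ : State} {t₁ t₂ : ℕ}
      (hp : Exec B p s₀ s₁ t₁) (hq : Exec B q s₁ s₂ t₂) :
      Exec B (.seq p q) s₀ s₂ (t₁ + t₂)
  | ite_true {e : Expr} {p q : Prog} {s s' : State} {t : ℕ}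
      (he : e.Fits B s) (h : e.eval s ≠ 0) (hp : Exec B p s s' t) :
      Exec B (.ite e p q) s s' (e.cost + 1 + t)
  | ite_false {e : Expr} {p q : Prog} {s s' : State} {t : ℕ}
      (he : e.Fits B s) (h : e.eval s = 0) (hq : Exec B q s s' t) :
      Exec B (.ite e p q) s s' (e.cost + 1 + t)
  | loop_done {e : Expr} {p : Prog} {s : State}
      (he : e.Fits B s) (h : e.eval s = 0) :
      Exec B (.loop e p) s s (e.cost + 1)
  | loop_step {e : Expr} {p : Prog} {s₀ s₁ s₂ : State} {t₁ t₂ : ℕ}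
      (he : e.Fits B s₀) (h : e.eval s₀ ≠ 0)
      (hp : Exec B p s₀ s₁ t₁) (hl : Exec B (.loop e p) s₁ s₂ t₂) :
      Exec B (.loop e p) s₀ s₂ (e.cost + 1 + t₁ + t₂)

end WordRAM

/-! ### Input and output of an algorithm for XCAP -/

/-- The initial state on the set listed (in any order) by `xs` and the integer `k`: register `0`
holds `n = |xs|`, register `1` holds `k`, memory cells `0, …, n - 1` hold the elements, and
everything else is `0`. -/
def xcapInput (xs : List ℤ) (k : ℕ) : WordRAM.State where
  reg r := if r = 0 then (xs.length : ℤ) else if r = 1 then (k : ℤ) else 0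
  mem a := if 0 ≤ a then xs.getD a.toNat 0 else 0

/-- The largest absolute value of an element of the list (`0` for the empty list). -/
def maxAbs (xs : List ℤ) : ℕ :=
  xs.toFinset.sup Int.natAbs

/-- `s` is a final state that answers the instance `(X, k)` correctly. Either register `0` holds
`1`, and for each `j < k` the memory cells `3j, 3j + 1, 3j + 2` hold start value `a`, difference
`d` and number of steps `x` of an AP `a, a + d, …, a + x d`, where these `k` APs are a solution;
or register `0` holds `0`, and there is no solution. -/
def XCAPAnswer (X : Finset ℤ) (k : ℕ) (s : WordRAM.State) : Prop :=
  (s.reg 0 = 1 ∧ ∃ (a d : Fin k → ℤ) (x : Fin k → ℕ),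
      (∀ j : Fin k, s.mem (3 * (j : ℤ)) = a j ∧ s.mem (3 * (j : ℤ) + 1) = d j ∧
        s.mem (3 * (j : ℤ) + 2) = (x j : ℤ)) ∧
      IsXCAPSolution X k (fun j => apSet (a j) (d j) (x j))) ∨
  (s.reg 0 = 0 ∧ ¬ ∃ S : Fin k → Set ℤ, IsXCAPSolution X k S)

/-!
# Exact Cover by Arithmetic Progressions in time `2 ^ O(k³) · poly(n)`

If `k > n`, there is no solution, since the progressions are nonempty and disjoint. Otherwise the
algorithm runs a nondeterministic left-to-right sweep (`Sweep.step`) with each of the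
`2 ^ tapeBits k` words of guessed bits, where `tapeBits k = 2 (k + 1)² (k + 4)`.

The sweep gives each element to one of `k` progressions. It learns their differences one by one,
and after each difference it starts again from the left. A progression with known difference is
active while the sweep is within its span; an element claimed by exactly one active progression is
given to it. At every other element, a *problem point*, the sweep guesses the set of active
progressions (`k` bits), which then has to leave a single claim. A progression with unknown
difference only takes its first element `z`; when it is to take a second element `x`, its
difference is guessed as `c * D / q`, where `D` is `x - z` or a known difference.

*Soundness* (`Sweep.Valid.step`): at each moment the progressions partition the elements treated so
far. After success, empty progressions are filled by splitting off first elements of longer ones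
(`Sweep.Valid.split`), which is possible since `k ≤ n`.

*Completeness* (`Sweep.exists_success`): let an exact cover be given and let the guesses follow it.
Between two problem points a progression with known difference starts or ends, or else an unknown
one takes its first element (`Sweep.Guided.weight_lt`), so at most `2 k` problem points occur
between two restarts, and there are at most `k` restarts. When the difference `δ` of a progression
`S` is guessed from `z` and `x`, there are two cases. If `x - z` is a small multiple of `δ`, then
`D = x - z` works. Otherwise some block of `k + 1` consecutive elements of `S` between them contains
neither problem points nor ends of progressions of the cover (`exists_block_avoiding`). The sweep
gave all these elements to progressions with known differences, so two of them to the same one, with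
difference `d`, say (`Sweep.Guided.exists_ratio`). Between neighbouring common elements of `S` and
this progression, its terms are covered by at most `k` other progressions that span the whole
range. By the theorem of Crittenden and Vanden Eynden (`covers_of_covers_consecutive`), if these
covered `2 ^ k` consecutive terms, they would also cover the common element before them, against
disjointness. Hence `c * d = q * δ` with `c ≤ 2 ^ k` and `q ≤ k`, so `O(k)` bits suffice for the
guess (`ExactCover.exists_ratio_of_two_hits`).

The program `WordRAM.solve` carries this out; `WordRAM.Rep` relates the states of the machine to the
states of the sweep. All registers and cells stay below `G = (n + k + M + 2) ^ 7`, and every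
expression of the program has cost at most `128`, so the words stay below `G ^ 128`
(`WordRAM.Expr.fits_pow`).
-/

/-! ### Arithmetic progressions covering consecutive terms -/

/-- An exponential sum with `N` terms that vanishes at `1, …, N` vanishes at `0`. -/
theorem expSum_zero_eq_zero (l : List (ℂ × ℂ)) (hne : ∀ p ∈ l, p.2 ≠ 0)
    (h : ∀ t : ℕ, 1 ≤ t → t ≤ l.length → (l.map fun p => p.1 * p.2 ^ t).sum = 0) :
    (l.map fun p => p.1).sum = 0 := by
  induction hN : l.length generalizing l with
  | zero => simp [List.length_eq_zero_iff.1 hN]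
  | succ N ih =>
    obtain ⟨⟨c, ω⟩, l', rfl⟩ := List.exists_cons_of_length_eq_add_one hN
    have hω : ω ≠ 0 := hne (c, ω) (by simp)
    -- If `g` is the sum over the whole list, `g (t + 1) - ω * g t` has one term less.
    have key : ∀ t : ℕ, ((l'.map fun p => (p.1 * (p.2 - ω), p.2)).map
        fun p => p.1 * p.2 ^ t).sum
        = (l'.map fun p => p.1 * p.2 ^ (t + 1)).sum - ω * (l'.map fun p => p.1 * p.2 ^ t).sum := by
      intro t
      rw [← List.sum_map_mul_left, List.map_map, ← Multiset.sum_coe, ← Multiset.sum_coe,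
        ← Multiset.sum_coe, ← Multiset.map_coe, ← Multiset.map_coe, ← Multiset.map_coe,
        ← Multiset.sum_map_sub]
      congr 1
      refine Multiset.map_congr rfl fun p _ => ?_
      simp only [Function.comp]
      ring
    have hlen : l'.length = N := by simpa using hN
    have h0 := ih (l'.map fun p => (p.1 * (p.2 - ω), p.2))
      (by
        intro p hp
        obtain ⟨p', hp', rfl⟩ := List.mem_map.1 hp
        exact hne p' (by simp [hp']))
      (by
        intro t ht1 ht2
        rw [List.length_map] at ht2
        rw [key t]
        have e1 := h t ht1 (by simp; omega)
        have e2 := h (t + 1) (by omega) (by simp; omega)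
        simp only [List.map_cons, List.sum_cons] at e1 e2
        linear_combination e2 - ω * e1)
      (by simpa using hlen)
    have hk := key 0
    simp only [pow_zero, mul_one, zero_add, pow_one] at hk
    rw [h0] at hk
    have e1 := h 1 le_rfl (by simp)
    simp only [List.map_cons, List.sum_cons, pow_one] at e1 ⊢
    have : ω * (c + (l'.map fun p => p.1).sum) = 0 := by linear_combination e1 + hk
    exact (mul_eq_zero.1 this).resolve_left hω

/-- A product of `N` factors `1 - u v ^ t` is an exponential sum with `2 ^ N` terms. -/
theorem exists_expSum_prod {ι : Type*} (s : Finset ι) (u v : ι → ℂ) (hv : ∀ i, v i ≠ 0) :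
    ∃ l : List (ℂ × ℂ), l.length = 2 ^ s.card ∧ (∀ p ∈ l, p.2 ≠ 0) ∧
      ∀ t : ℕ, (l.map fun p => p.1 * p.2 ^ t).sum = ∏ i ∈ s, (1 - u i * v i ^ t) := by
  classical
  induction s using Finset.induction_on with
  | empty => exact ⟨[(1, 1)], by simp⟩
  | insert a s ha ih =>
    obtain ⟨l, hl, hne, hsum⟩ := ih
    refine ⟨l ++ l.map fun p => (-(p.1 * u a), p.2 * v a), ?_, ?_, ?_⟩
    · simp [hl, Finset.card_insert_of_notMem ha, pow_succ]; ring
    · intro p hp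
      rcases List.mem_append.1 hp with hp | hp
      · exact hne p hp
      · obtain ⟨p', hp', rfl⟩ := List.mem_map.1 hp
        exact mul_ne_zero (hne p' hp') (hv a)
    · intro t
      rw [Finset.prod_insert ha, ← hsum t, List.map_append, List.sum_append, List.map_map]
      have : (List.map ((fun p : ℂ × ℂ => p.1 * p.2 ^ t) ∘
          fun p => (-(p.1 * u a), p.2 * v a)) l).sum
          = -(u a * v a ^ t) * (l.map fun p => p.1 * p.2 ^ t).sum := by
        rw [← List.sum_map_mul_left]
        congr 1
        refine List.map_congr_left fun p _ => ?_
        simp only [Function.comp]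
        ring
      rw [this]
      ring

/-- The theorem of Crittenden and Vanden Eynden: if `N` residue classes cover `2 ^ N` consecutive
terms of the progression `α, α + β, …`, they also cover the term before these. -/
theorem covers_of_covers_consecutive {ι : Type*} (s : Finset ι) (a : ι → ℤ) (d : ι → ℕ)
    (hd : ∀ i, 0 < d i) (α β : ℤ)
    (h : ∀ t : ℕ, 1 ≤ t → t ≤ 2 ^ s.card → ∃ i ∈ s, (d i : ℤ) ∣ α + t * β - a i) :
    ∃ i ∈ s, (d i : ℤ) ∣ α - a i := by
  have hζ : ∀ i, IsPrimitiveRoot (Complex.exp (2 * Real.pi * Complex.I / d i)) (d i) :=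
    fun i => Complex.isPrimitiveRoot_exp _ (hd i).ne'
  set ζ : ι → ℂ := fun i => Complex.exp (2 * Real.pi * Complex.I / d i)
  have hζ0 : ∀ i, ζ i ≠ 0 := fun i => Complex.exp_ne_zero _
  have hval : ∀ i (t : ℕ), ζ i ^ (α - a i) * (ζ i ^ β) ^ t = ζ i ^ (α + t * β - a i) := by
    intro i t
    rw [← zpow_natCast, ← zpow_mul, ← zpow_add₀ (hζ0 i)]
    congr 1
    ring
  obtain ⟨l, hl, hne, hsum⟩ := exists_expSum_prod s (fun i => ζ i ^ (α - a i))
    (fun i => ζ i ^ β) (fun i => zpow_ne_zero _ (hζ0 i))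
  have h0 := expSum_zero_eq_zero l hne (by
    intro t h1 h2
    obtain ⟨i, hi, hdvd⟩ := h t h1 (hl ▸ h2)
    rw [hsum t]
    refine Finset.prod_eq_zero hi ?_
    rw [hval, ((hζ i).zpow_eq_one_iff_dvd _).2 hdvd, sub_self])
  have h1 := hsum 0
  simp only [pow_zero, mul_one] at h1
  rw [h0] at h1
  obtain ⟨i, hi, hz⟩ := Finset.prod_eq_zero_iff.1 h1.symm
  exact ⟨i, hi, ((hζ i).zpow_eq_one_iff_dvd _).1 (sub_eq_zero.1 hz).symm⟩

/-! ### The lazy sweep -/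

/-- The state of a left-to-right sweep over a finite set of integers that distributes its elements
over progressions `0, 1, …`. `status` is `0` while the sweep runs, `1` after success and `2` after
failure; `cur` is the last element treated; `tp` is the number of guessed bits used so far.
Progression `j` consists so far of the `cnt j` elements `fst j, fst j + dif j, …`; its difference
is known if `dif j ≠ 0`, and it takes part in the distribution while `act j` is true. -/
structure Sweep where
  status : ℕ
  cur : ℤ
  tp : ℕ
  act : ℕ → Bool
  cnt : ℕ → ℕ
  fst : ℕ → ℤ
  dif : ℕ → ℕ

namespace Sweep

/-- Progression `j` claims `x`: it is active, and either its difference is still unknown, or it is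
still empty and `x` is on its line, or `x` is its next element. The entry `fst j` of an empty
progression with known difference is a point of its line. -/
def Hits (σ : Sweep) (x : ℤ) (j : ℕ) : Prop :=
  σ.act j = true ∧ (σ.dif j = 0 ∨ (σ.cnt j = 0 ∧ (σ.dif j : ℤ) ∣ x - σ.fst j) ∨
    (σ.cnt j ≠ 0 ∧ x = σ.fst j + σ.cnt j * σ.dif j))

instance (σ : Sweep) (x : ℤ) (j : ℕ) : Decidable (σ.Hits x j) := by
  unfold Hits; infer_instance

/-- The progressions that claim `x`. -/
def hitSet (k : ℕ) (σ : Sweep) (x : ℤ) : Finset ℕ :=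
  (Finset.range k).filter (σ.Hits x)

/-- Replace the set of active progressions by a guessed one. -/
def readAct (k : ℕ) (τ : ℕ → Bool) (σ : Sweep) : Sweep :=
  { σ with act := fun j => decide (j < k) && τ (σ.tp + j), tp := σ.tp + k }

/-- The last known difference selected by the guessed bits, or `D` if none is selected. -/
def chosenDif (τ : ℕ → Bool) (σ : Sweep) (D : ℕ) : ℕ → ℕ
  | 0 => D
  | i + 1 => if τ (σ.tp + i) = true ∧ σ.dif i ≠ 0 then σ.dif i else chosenDif τ σ D i

/-- The number with the binary digits `τ p, τ (p + 1), …`, modulo `n + 1`. -/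
def readNum (τ : ℕ → Bool) (n p : ℕ) : ℕ → ℕ
  | 0 => 0
  | i + 1 => (2 * readNum τ n p i + (τ (p + i)).toNat) % (n + 1)

/-- The number of binary digits of a guessed number. -/
def digits (k : ℕ) : ℕ := 4 * k + 4

/-- The difference guessed for progression `j` from its elements `fst j` and `x`: a rational
multiple of their distance or of a known difference. -/
def guessedDif (n k : ℕ) (τ : ℕ → Bool) (σ : Sweep) (x : ℤ) (j : ℕ) : ℕ :=
  readNum τ n (σ.tp + k) (digits k) * chosenDif τ σ (x - σ.fst j).toNat k /
    readNum τ n (σ.tp + k + digits k) (digits k) % ((x - σ.fst j).toNat + 1)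

/-- Guess the difference of progression `j` and start the sweep again. -/
def learn (n k : ℕ) (lo : ℤ) (τ : ℕ → Bool) (σ : Sweep) (x : ℤ) (j : ℕ) : Sweep where
  status := if guessedDif n k τ σ x j = 0 then 2 else 0
  cur := lo
  tp := σ.tp + k + 2 * digits k
  act := fun _ => false
  cnt := fun _ => 0
  fst := σ.fst
  dif := Function.update σ.dif j (guessedDif n k τ σ x j)

/-- Append `x` to progression `j`. A progression with unknown difference becomes inactive. -/
def take (σ : Sweep) (x : ℤ) (j : ℕ) : Sweep :=
  { σ with
    cur := x
    act := Function.update σ.act j (decide (σ.dif j ≠ 0))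
    cnt := Function.update σ.cnt j (σ.cnt j + 1)
    fst := if σ.cnt j = 0 then Function.update σ.fst j x else σ.fst }

/-- Give `x` to progression `j`; the second element of a progression with unknown difference
serves to guess this difference. -/
def place (n k : ℕ) (lo : ℤ) (τ : ℕ → Bool) (σ : Sweep) (x : ℤ) (j : ℕ) : Sweep :=
  if σ.dif j = 0 ∧ σ.cnt j ≠ 0 then σ.learn n k lo τ x j else σ.take x j

/-- Give `x` to the only progression that claims it; fail if there is no such progression. -/
def settle (n k : ℕ) (lo : ℤ) (τ : ℕ → Bool) (σ : Sweep) (x : ℤ) : Sweep :=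
  if (hitSet k σ x).card = 1 then σ.place n k lo τ x ((hitSet k σ x).sum id)
  else { σ with status := 2 }

/-- Guess a new set of active progressions unless exactly one progression claims `x`. -/
def refresh (k : ℕ) (τ : ℕ → Bool) (σ : Sweep) (x : ℤ) : Sweep :=
  if (hitSet k σ x).card = 1 then σ else σ.readAct k τ

/-- Treat the next element of `X`, or report success if there is none. -/
def step (X : Finset ℤ) (k : ℕ) (lo : ℤ) (τ : ℕ → Bool) (σ : Sweep) : Sweep :=
  if σ.status ≠ 0 then σ
  else if h : (X.filter (σ.cur < ·)).Nonempty then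
    (σ.refresh k τ ((X.filter (σ.cur < ·)).min' h)).settle X.card k lo τ
      ((X.filter (σ.cur < ·)).min' h)
  else { σ with status := 1 }

/-- The state before the sweep. -/
def init (lo : ℤ) : Sweep where
  status := 0
  cur := lo
  tp := 0
  act := fun _ => false
  cnt := fun _ => 0
  fst := fun _ => 0
  dif := fun _ => 0

/-- The sweep with the tape `τ` ends in the state `σ`. -/
def Final (X : Finset ℤ) (k : ℕ) (lo : ℤ) (τ : ℕ → Bool) (σ : Sweep) : Prop :=
  σ.status ≠ 0 ∧ ∃ m, σ = (step X k lo τ)^[m] (init lo)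

/-- `y` belongs to progression `j`. -/
def Elem (σ : Sweep) (j : ℕ) (y : ℤ) : Prop :=
  ∃ i : ℕ, i < σ.cnt j ∧ y = σ.fst j + i * σ.dif j

/-- The invariant of the sweep: the progressions `j < k` partition the elements treated so far. -/
structure Valid (X : Finset ℤ) (k : ℕ) (lo : ℤ) (σ : Sweep) : Prop where
  lo_le : lo ≤ σ.cur
  cover : ∀ y, (∃ j < k, σ.Elem j y) ↔ y ∈ X ∧ y ≤ σ.cur
  disj : ∀ y j j', j < k → j' < k → σ.Elem j y → σ.Elem j' y → j = j'
  single : ∀ j < k, σ.dif j = 0 → σ.cnt j ≤ 1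
  done : σ.status = 1 → ∀ y ∈ X, y ≤ σ.cur

theorem Valid.init {X : Finset ℤ} {k : ℕ} {lo : ℤ} (hlo : ∀ y ∈ X, lo < y) :
    Valid X k lo (init lo) where
  lo_le := le_rfl
  cover y := by
    simp only [Elem, Sweep.init, not_lt_zero, false_and, exists_false, and_false, false_iff,
      not_and, not_le]
    exact hlo y
  disj y j j' _ _ h := by simp [Elem, Sweep.init] at h
  single j _ _ := by simp [Sweep.init]
  done h := by simp [Sweep.init] at h

theorem Valid.fst_mem {X : Finset ℤ} {k : ℕ} {lo : ℤ} {σ : Sweep} (h : Valid X k lo σ) {j : ℕ}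
    (hj : j < k) (hc : σ.cnt j ≠ 0) : σ.fst j ∈ X ∧ σ.fst j ≤ σ.cur :=
  (h.cover _).1 ⟨j, hj, 0, Nat.pos_of_ne_zero hc, by simp⟩

theorem Valid.cnt_le {X : Finset ℤ} {k : ℕ} {lo : ℤ} {σ : Sweep} (h : Valid X k lo σ) {j : ℕ}
    (hj : j < k) : σ.cnt j ≤ (X.filter (· ≤ σ.cur)).card := by
  rcases Nat.eq_zero_or_pos (σ.dif j) with hd | hd
  · rcases Nat.eq_zero_or_pos (σ.cnt j) with hc | hc
    · omega
    · have := h.single j hj hd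
      have h1 : 0 < (X.filter (· ≤ σ.cur)).card :=
        Finset.card_pos.2 ⟨σ.fst j, Finset.mem_filter.2 (h.fst_mem hj hc.ne')⟩
      omega
  · rw [← Finset.card_range (σ.cnt j)]
    refine Finset.card_le_card_of_injOn (fun i : ℕ => σ.fst j + i * (σ.dif j : ℤ)) ?_ ?_
    · intro i hi
      exact Finset.mem_filter.2 ((h.cover _).1 ⟨j, hj, i, by simpa using hi, rfl⟩)
    · intro i _ i' _ hii
      have hd' : (σ.dif j : ℤ) ≠ 0 := by exact_mod_cast hd.ne'
      have : (i : ℤ) * σ.dif j = i' * σ.dif j := by simpa using hii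
      exact_mod_cast mul_right_cancel₀ hd' this

theorem take_elem {σ : Sweep} {x : ℤ} {j : ℕ}
    (hx : σ.cnt j ≠ 0 → x = σ.fst j + σ.cnt j * σ.dif j) (j' : ℕ) (y : ℤ) :
    (σ.take x j).Elem j' y ↔ σ.Elem j' y ∨ (j' = j ∧ y = x) := by
  by_cases hj : j' = j
  · subst hj
    by_cases hc : σ.cnt j' = 0
    · simp [Elem, take, hc]
    · simp only [Elem, take, hc, Function.update_self, if_false, true_and]
      constructor
      · rintro ⟨i, hi, rfl⟩
        rcases Nat.lt_succ_iff_lt_or_eq.1 hi with hi | rfl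
        · exact Or.inl ⟨i, hi, rfl⟩
        · exact Or.inr (hx hc).symm
      · rintro (⟨i, hi, rfl⟩ | rfl)
        · exact ⟨i, by omega, rfl⟩
        · exact ⟨σ.cnt j', by omega, hx hc⟩
  · by_cases hc : σ.cnt j = 0 <;> simp [Elem, take, hc, hj]

theorem Valid.take {X : Finset ℤ} {k : ℕ} {lo : ℤ} {σ : Sweep} (h : Valid X k lo σ) {x : ℤ} {j : ℕ}
    (hj : j < k) (hxX : x ∈ X) (hxc : σ.cur < x) (hnext : ∀ y ∈ X, σ.cur < y → x ≤ y)
    (hs : σ.status = 0) (hunk : σ.dif j = 0 → σ.cnt j = 0)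
    (hx : σ.cnt j ≠ 0 → x = σ.fst j + σ.cnt j * σ.dif j) : Valid X k lo (σ.take x j) where
  lo_le := h.lo_le.trans hxc.le
  cover y := by
    have e : ∀ y, y ∈ X ∧ y ≤ x ↔ (y ∈ X ∧ y ≤ σ.cur) ∨ y = x := by
      intro y
      constructor
      · rintro ⟨h1, h2⟩
        by_cases h3 : y ≤ σ.cur
        · exact Or.inl ⟨h1, h3⟩
        · exact Or.inr (le_antisymm h2 (hnext y h1 (not_le.1 h3)))
      · rintro (⟨h1, h2⟩ | rfl)
        · exact ⟨h1, h2.trans hxc.le⟩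
        · exact ⟨hxX, le_rfl⟩
    change _ ↔ y ∈ X ∧ y ≤ x
    rw [e, ← h.cover]
    simp only [take_elem hx]
    constructor
    · rintro ⟨j', hj', h1 | ⟨_, h1⟩⟩
      · exact Or.inl ⟨j', hj', h1⟩
      · exact Or.inr h1
    · rintro (⟨j', hj', h1⟩ | h1)
      · exact ⟨j', hj', Or.inl h1⟩
      · exact ⟨j, hj, Or.inr ⟨rfl, h1⟩⟩
  disj y j₁ j₂ h1 h2 e1 e2 := by
    have hno : ∀ j' < k, ¬ σ.Elem j' x := fun j' hj' he =>
      absurd ((h.cover x).1 ⟨j', hj', he⟩).2 (not_le.2 hxc)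
    rw [take_elem hx] at e1 e2
    rcases e1 with e1 | ⟨rfl, rfl⟩ <;> rcases e2 with e2 | ⟨rfl, he⟩
    · exact h.disj y j₁ j₂ h1 h2 e1 e2
    · exact absurd (he ▸ e1) (hno _ h1)
    · exact absurd e2 (hno _ h2)
    · rfl
  single j' hj' hd := by
    by_cases hjj : j' = j
    · subst hjj
      have := hunk hd
      simp [Sweep.take, this]
    · simpa [Sweep.take, hjj] using h.single j' hj' hd
  done h1 := by
    change σ.status = 1 at h1
    omega

theorem Valid.reset {X : Finset ℤ} {k : ℕ} {lo : ℤ} (hlo : ∀ y ∈ X, lo < y) {σ : Sweep}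
    (hcur : σ.cur = lo) (hcnt : ∀ j, σ.cnt j = 0) (hs : σ.status ≠ 1) : Valid X k lo σ where
  lo_le := hcur.ge
  cover y := by
    simp only [Elem, hcnt, not_lt_zero, false_and, exists_false, and_false, false_iff, not_and,
      not_le, hcur]
    exact hlo y
  disj y j j' _ _ h := by simp [Elem, hcnt] at h
  single j _ _ := by simp [hcnt]
  done h := absurd h hs

/-- The validity of a state depends only on some of its components. -/
theorem Valid.congr {X : Finset ℤ} {k : ℕ} {lo : ℤ} {σ σ' : Sweep} (h : Valid X k lo σ)
    (hcur : σ'.cur = σ.cur) (hcnt : σ'.cnt = σ.cnt) (hfst : σ'.fst = σ.fst) (hdif : σ'.dif = σ.dif)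
    (hs : σ'.status = 1 → ∀ y ∈ X, y ≤ σ.cur) : Valid X k lo σ' where
  lo_le := hcur ▸ h.lo_le
  cover y := by simpa only [Elem, hcur, hcnt, hfst, hdif] using h.cover y
  disj y j j' := by simpa only [Elem, hcnt, hfst, hdif] using h.disj y j j'
  single j := by simpa only [hcnt, hdif] using h.single j
  done h1 := by simpa only [hcur] using hs h1

theorem hitSet_card_eq_one {k : ℕ} {σ : Sweep} {x : ℤ} (h : (hitSet k σ x).card = 1) :
    (hitSet k σ x).sum id < k ∧ σ.Hits x ((hitSet k σ x).sum id) := by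
  obtain ⟨j, hj⟩ := Finset.card_eq_one.1 h
  have : j ∈ hitSet k σ x := by simp [hj]
  rw [hj, Finset.sum_singleton, id]
  simpa [hitSet] using this

theorem Valid.refresh {X : Finset ℤ} {k : ℕ} {lo : ℤ} {σ : Sweep} (h : Valid X k lo σ)
    (τ : ℕ → Bool) (x : ℤ) : Valid X k lo (σ.refresh k τ x) := by
  unfold Sweep.refresh
  split_ifs
  · exact h
  · exact h.congr rfl rfl rfl rfl h.done

theorem Valid.settle {X : Finset ℤ} {k : ℕ} {lo : ℤ} (hlo : ∀ y ∈ X, lo < y) {σ : Sweep}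
    (h : Valid X k lo σ) {n : ℕ} (τ : ℕ → Bool) {x : ℤ} (hxX : x ∈ X) (hxc : σ.cur < x)
    (hnext : ∀ y ∈ X, σ.cur < y → x ≤ y) (hs : σ.status = 0) :
    Valid X k lo (σ.settle n k lo τ x) := by
  unfold Sweep.settle
  split_ifs with h1
  · obtain ⟨hj, hhit⟩ := hitSet_card_eq_one h1
    unfold place
    split_ifs with h2
    · refine Valid.reset hlo rfl (fun _ => rfl) ?_
      simp only [learn]
      split_ifs <;> simp
    · refine h.take hj hxX hxc hnext hs (by tauto) fun hc => ?_
      rcases hhit.2 with h3 | h3 | h3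
      · exact absurd ⟨h3, hc⟩ h2
      · exact absurd h3.1 hc
      · exact h3.2
  · exact h.congr rfl rfl rfl rfl (by simp)

theorem refresh_cur (k : ℕ) (τ : ℕ → Bool) (σ : Sweep) (x : ℤ) :
    (σ.refresh k τ x).cur = σ.cur := by
  unfold refresh; split_ifs <;> rfl

theorem refresh_status (k : ℕ) (τ : ℕ → Bool) (σ : Sweep) (x : ℤ) :
    (σ.refresh k τ x).status = σ.status := by
  unfold refresh; split_ifs <;> rfl

theorem refresh_dif (k : ℕ) (τ : ℕ → Bool) (σ : Sweep) (x : ℤ) :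
    (σ.refresh k τ x).dif = σ.dif := by
  unfold refresh; split_ifs <;> rfl

theorem refresh_tp_le (k : ℕ) (τ : ℕ → Bool) (σ : Sweep) (x : ℤ) :
    (σ.refresh k τ x).tp ≤ σ.tp + k := by
  unfold refresh; split_ifs
  · omega
  · exact le_rfl

/-- The step of a running sweep whose next element is `x`. -/
theorem step_eq_settle {X : Finset ℤ} {k : ℕ} {lo : ℤ} {τ : ℕ → Bool} {σ : Sweep} {x : ℤ}
    (hs : σ.status = 0) (hxX : x ∈ X) (hxc : σ.cur < x) (hnext : ∀ y ∈ X, σ.cur < y → x ≤ y) :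
    step X k lo τ σ = (σ.refresh k τ x).settle X.card k lo τ x := by
  have hne : (X.filter (σ.cur < ·)).Nonempty := ⟨x, Finset.mem_filter.2 ⟨hxX, hxc⟩⟩
  have hmin : (X.filter (σ.cur < ·)).min' hne = x := by
    refine le_antisymm (Finset.min'_le _ _ (Finset.mem_filter.2 ⟨hxX, hxc⟩)) ?_
    refine Finset.le_min' _ _ _ fun y hy => ?_
    exact hnext y (Finset.mem_filter.1 hy).1 (Finset.mem_filter.1 hy).2
  unfold step
  rw [if_neg (by simp [hs]), dif_pos hne, hmin]

theorem step_eq_done {X : Finset ℤ} {k : ℕ} {lo : ℤ} {τ : ℕ → Bool} {σ : Sweep}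
    (hs : σ.status = 0) (hall : ∀ y ∈ X, y ≤ σ.cur) :
    step X k lo τ σ = { σ with status := 1 } := by
  unfold step
  rw [if_neg (by simp [hs]), dif_neg]
  rintro ⟨y, hy⟩
  exact absurd (hall y (Finset.mem_filter.1 hy).1) (not_le.2 (Finset.mem_filter.1 hy).2)

theorem step_eq_self {X : Finset ℤ} {k : ℕ} {lo : ℤ} {τ : ℕ → Bool} {σ : Sweep}
    (hs : σ.status ≠ 0) : step X k lo τ σ = σ := if_pos hs

/-- Either all elements have been treated or there is a next one. -/
theorem exists_next (X : Finset ℤ) (c : ℤ) :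
    (∀ y ∈ X, y ≤ c) ∨ ∃ x ∈ X, c < x ∧ ∀ y ∈ X, c < y → x ≤ y := by
  by_cases h : (X.filter (c < ·)).Nonempty
  · right
    have := Finset.mem_filter.1 (Finset.min'_mem _ h)
    exact ⟨_, this.1, this.2, fun y hy hc => Finset.min'_le _ _ (Finset.mem_filter.2 ⟨hy, hc⟩)⟩
  · left
    intro y hy
    by_contra hc
    exact h ⟨y, Finset.mem_filter.2 ⟨hy, not_le.1 hc⟩⟩

theorem Valid.step {X : Finset ℤ} {k : ℕ} {lo : ℤ} (hlo : ∀ y ∈ X, lo < y) {σ : Sweep}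
    (h : Valid X k lo σ) (τ : ℕ → Bool) : Valid X k lo (σ.step X k lo τ) := by
  by_cases hs : σ.status = 0
  · rcases exists_next X σ.cur with hall | ⟨x, hxX, hxc, hnext⟩
    · rw [step_eq_done hs hall]
      exact h.congr rfl rfl rfl rfl fun _ => hall
    · rw [step_eq_settle hs hxX hxc hnext]
      refine (h.refresh τ x).settle hlo τ hxX ?_ ?_ ?_
      · rwa [refresh_cur]
      · rwa [refresh_cur]
      · rwa [refresh_status]
  · rwa [step_eq_self hs]

/-! ### Termination of the sweep -/

/-- A bound for the number of remaining steps of a running sweep. -/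
def remaining (X : Finset ℤ) (k : ℕ) (σ : Sweep) : ℕ :=
  ((Finset.range k).filter (σ.dif · = 0)).card * (X.card + 1) + (X.filter (σ.cur < ·)).card

theorem remaining_le (X : Finset ℤ) (k : ℕ) (σ : Sweep) :
    remaining X k σ ≤ k * (X.card + 1) + X.card := by
  have h1 := Finset.card_filter_le (Finset.range k) (σ.dif · = 0)
  have h2 := Finset.card_filter_le X (σ.cur < ·)
  rw [Finset.card_range] at h1
  exact Nat.add_le_add (Nat.mul_le_mul_right _ h1) h2

theorem card_filter_lt_of_next {X : Finset ℤ} {c x : ℤ} (hxX : x ∈ X) (hxc : c < x) :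
    (X.filter (x < ·)).card < (X.filter (c < ·)).card := by
  refine Finset.card_lt_card (Finset.ssubset_iff_of_subset ?_ |>.2
    ⟨x, Finset.mem_filter.2 ⟨hxX, hxc⟩, by simp⟩)
  intro y hy
  rw [Finset.mem_filter] at hy ⊢
  exact ⟨hy.1, hxc.trans hy.2⟩

theorem unknown_learn_lt {k j n : ℕ} {lo x : ℤ} {τ : ℕ → Bool} {σ : Sweep} (hj : j < k)
    (hd : σ.dif j = 0) (hs : (σ.learn n k lo τ x j).status = 0) :
    ((Finset.range k).filter ((σ.learn n k lo τ x j).dif · = 0)).card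
      < ((Finset.range k).filter (σ.dif · = 0)).card := by
  have hg : guessedDif n k τ σ x j ≠ 0 := by
    intro h0
    simp [learn, h0] at hs
  refine Finset.card_lt_card (Finset.ssubset_iff_of_subset ?_ |>.2
    ⟨j, by simp [hj, hd], by simp [learn, hg]⟩)
  intro i hi
  rw [Finset.mem_filter] at hi ⊢
  refine ⟨hi.1, ?_⟩
  by_cases hij : i = j
  · rw [hij, hd]
  · simpa [learn, hij] using hi.2

theorem step_remaining {X : Finset ℤ} {k : ℕ} {lo : ℤ} {σ : Sweep} (τ : ℕ → Bool)
    (hs : σ.status = 0) (hs' : (σ.step X k lo τ).status = 0) :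
    remaining X k (σ.step X k lo τ) < remaining X k σ := by
  rcases exists_next X σ.cur with hall | ⟨x, hxX, hxc, hnext⟩
  · rw [step_eq_done hs hall] at hs'
    simp at hs'
  · rw [step_eq_settle hs hxX hxc hnext] at hs' ⊢
    unfold settle at hs' ⊢
    split_ifs at hs' ⊢ with h1
    · obtain ⟨hj, hhit⟩ := hitSet_card_eq_one h1
      set σ' := σ.refresh k τ x
      set j := (hitSet k σ' x).sum id
      have hdif : σ'.dif = σ.dif := refresh_dif ..
      unfold place at hs' ⊢
      split_ifs at hs' ⊢ with h2
      · have hlt := unknown_learn_lt hj h2.1 hs'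
        rw [hdif] at hlt
        unfold remaining
        have hc := Finset.card_filter_le X ((σ'.learn X.card k lo τ x j).cur < ·)
        nlinarith
      · have := card_filter_lt_of_next hxX hxc
        unfold remaining
        change _ * _ + (X.filter (x < ·)).card < _
        change (((Finset.range k).filter (σ'.dif · = 0)).card) * _ + _ < _
        rw [hdif]
        omega

theorem step_tp_le (X : Finset ℤ) (k : ℕ) (lo : ℤ) (τ : ℕ → Bool) (σ : Sweep) :
    (σ.step X k lo τ).tp ≤ σ.tp + (2 * k + 2 * digits k) := by
  by_cases hs : σ.status = 0
  · rcases exists_next X σ.cur with hall | ⟨x, hxX, hxc, hnext⟩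
    · rw [step_eq_done hs hall]
      exact Nat.le_add_right _ _
    · rw [step_eq_settle hs hxX hxc hnext]
      have := refresh_tp_le k τ σ x
      unfold settle place
      split_ifs
      · simp only [learn]; omega
      · simp only [take]; omega
      · simp only; omega
  · rw [step_eq_self hs]; omega

end Sweep

/-! ### Exact covers and the relation between their differences -/

/-- An exact cover of `X` by the progressions `j < k` with first element `a j`, difference
`δ j > 0` and last element at most `e j`. -/
structure ExactCover (X : Finset ℤ) (k : ℕ) where
  a : ℕ → ℤ
  e : ℕ → ℤ
  δ : ℕ → ℕ
  pos : ∀ j, 0 < δ j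
  le : ∀ j, a j ≤ e j
  cover : ∀ y, y ∈ X ↔ ∃ j < k, a j ≤ y ∧ y ≤ e j ∧ (δ j : ℤ) ∣ y - a j
  disj : ∀ y j j', j < k → j' < k → (a j ≤ y ∧ y ≤ e j ∧ (δ j : ℤ) ∣ y - a j) →
    (a j' ≤ y ∧ y ≤ e j' ∧ (δ j' : ℤ) ∣ y - a j') → j = j'

namespace ExactCover

variable {X : Finset ℤ} {k : ℕ}

/-- `y` belongs to progression `j`. -/
def Mem (C : ExactCover X k) (j : ℕ) (y : ℤ) : Prop :=
  C.a j ≤ y ∧ y ≤ C.e j ∧ (C.δ j : ℤ) ∣ y - C.a j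

theorem Mem.mem {C : ExactCover X k} {j : ℕ} {y : ℤ} (h : C.Mem j y) (hj : j < k) : y ∈ X :=
  (C.cover y).2 ⟨j, hj, h⟩

theorem a_mem (C : ExactCover X k) {j : ℕ} (hj : j < k) : C.a j ∈ X :=
  Mem.mem (C := C) ⟨le_rfl, C.le j, by simp⟩ hj

theorem card_terms_le {S : Finset ℤ} {y : ℤ} {d N : ℕ} (hd : 0 < d)
    (h : ∀ i < N, y + i * (d : ℤ) ∈ S) : N ≤ S.card := by
  rw [← Finset.card_range N]
  refine Finset.card_le_card_of_injOn (fun i : ℕ => y + i * (d : ℤ))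
    (fun i hi => h i (by simpa using hi)) ?_
  intro i _ i' _ hii
  have hd' : (d : ℤ) ≠ 0 := by exact_mod_cast hd.ne'
  have : (i : ℤ) * d = i' * d := by simpa using hii
  exact_mod_cast mul_right_cancel₀ hd' this

/-- If a progression `y, y + d, …` inside `X` meets progression `j` in two elements that are at
most `k` terms of progression `j` apart, and if no progression of the cover starts or ends between
these, then `d` and `δ j` have a small ratio: the terms strictly between two neighbouring common
elements are covered by the other progressions, so they are fewer than `2 ^ k`. -/
theorem exists_ratio_of_two_hits (C : ExactCover X k) {j : ℕ} (hj : j < k) {y₀ y₁ : ℤ} {d r : ℕ}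
    (hd : 0 < d) (hy₀ : C.Mem j y₀) (hy₁ : C.Mem j y₁) (hr0 : 0 < r) (hrk : r ≤ k)
    (hyr : y₁ = y₀ + r * (C.δ j : ℤ)) (hdvd : (d : ℤ) ∣ y₁ - y₀)
    (hsub : ∀ w, y₀ ≤ w → w ≤ y₁ → (d : ℤ) ∣ w - y₀ → w ∈ X)
    (hev : ∀ i < k, ¬ (y₀ ≤ C.a i ∧ C.a i ≤ y₁) ∧ ¬ (y₀ ≤ C.e i ∧ C.e i ≤ y₁)) :
    ∃ c q : ℕ, c * d = q * C.δ j ∧ 0 < q ∧ q ≤ k ∧ c ≤ 2 ^ k ∧ c ≤ X.card ∧ q ≤ X.card := by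
  set δ := C.δ j with hδ
  have hδ0 : 0 < δ := C.pos j
  set g := Nat.gcd d δ with hg
  have hg0 : 0 < g := Nat.gcd_pos_of_pos_left _ hd
  obtain ⟨q, hq⟩ : g ∣ d := Nat.gcd_dvd_left _ _
  obtain ⟨c, hc⟩ : g ∣ δ := Nat.gcd_dvd_right _ _
  have hcop : Nat.Coprime q c := by
    have h1 : g * Nat.gcd q c = g * 1 := by
      rw [← Nat.gcd_mul_left, ← hq, ← hc, ← hg, mul_one]
    exact Nat.eq_of_mul_eq_mul_left hg0 h1
  have hq0 : 0 < q := Nat.pos_of_ne_zero (by rintro rfl; omega)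
  have hc0 : 0 < c := Nat.pos_of_ne_zero (by rintro rfl; omega)
  have hcd : c * d = q * δ := by rw [hq, hc]; ring
  have hqr : q ∣ r := by
    have h1 : (d : ℤ) ∣ (r * δ : ℕ) := by
      have : y₁ - y₀ = ((r * δ : ℕ) : ℤ) := by push_cast; rw [hyr]; ring
      rwa [this] at hdvd
    have h2 : d ∣ r * δ := by exact_mod_cast h1
    rw [hq, hc] at h2
    have h3 : g * q ∣ g * (r * c) := by convert h2 using 1; ring
    exact hcop.dvd_of_dvd_mul_right (Nat.dvd_of_mul_dvd_mul_left hg0 h3)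
  have hqr' : q ≤ r := Nat.le_of_dvd hr0 hqr
  have hend : y₀ + (c : ℤ) * d ≤ y₁ := by
    rw [hyr]
    have : (c : ℤ) * d = q * δ := by exact_mod_cast hcd
    rw [this]
    have h1 : (q : ℤ) ≤ r := by exact_mod_cast hqr'
    have h2 : (0 : ℤ) ≤ δ := by positivity
    nlinarith
  have hterm : ∀ i : ℕ, i ≤ c → y₀ + i * (d : ℤ) ≤ y₁ := by
    intro i hi
    have h1 : (i : ℤ) ≤ c := by exact_mod_cast hi
    have h2 : (0 : ℤ) ≤ d := by positivity
    nlinarith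
  have htermX : ∀ i : ℕ, i ≤ c → y₀ + i * (d : ℤ) ∈ X := by
    intro i hi
    refine hsub _ ?_ (hterm i hi) ⟨i, by ring⟩
    have : (0 : ℤ) ≤ i * (d : ℤ) := by positivity
    omega
  refine ⟨c, q, hcd, hq0, hqr'.trans hrk, ?_, card_terms_le hd fun i hi => htermX i hi.le,
    card_terms_le (y := y₀) hδ0 fun i hi => ?_⟩
  · by_contra hlarge
    push Not at hlarge
    classical
    set Q := (Finset.range k).filter fun i => i ≠ j ∧ C.a i < y₀ ∧ y₁ < C.e i with hQ
    have hQk : Q.card ≤ k := by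
      simpa using Finset.card_filter_le (Finset.range k) fun i => i ≠ j ∧ C.a i < y₀ ∧ y₁ < C.e i
    obtain ⟨i, hiQ, hi⟩ := covers_of_covers_consecutive Q C.a C.δ C.pos y₀ d (by
      intro t ht1 ht2
      have htc : t < c := lt_of_le_of_lt (ht2.trans (Nat.pow_le_pow_right (by norm_num) hQk)) hlarge
      obtain ⟨i, hik, h1, h2, h3⟩ := (C.cover _).1 (htermX t htc.le)
      refine ⟨i, ?_, h3⟩
      have hw0 : y₀ ≤ y₀ + t * (d : ℤ) := by
        have : (0 : ℤ) ≤ t * (d : ℤ) := by positivity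
        omega
      have hw1 := hterm t htc.le
      rw [hQ, Finset.mem_filter, Finset.mem_range]
      refine ⟨hik, ?_, ?_, ?_⟩
      · rintro rfl
        -- a common element strictly between two neighbouring common elements
        have h4 : (δ : ℤ) ∣ t * (d : ℤ) := by
          have := dvd_sub h3 hy₀.2.2
          rwa [show y₀ + (t : ℤ) * d - C.a i - (y₀ - C.a i) = t * d by ring] at this
        have h5 : δ ∣ t * d := by exact_mod_cast h4
        rw [hq, hc] at h5
        have h6 : g * c ∣ g * (t * q) := by convert h5 using 1; ring
        have h7 := hcop.symm.dvd_of_dvd_mul_right (Nat.dvd_of_mul_dvd_mul_left hg0 h6)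
        exact absurd (Nat.le_of_dvd ht1 h7) (not_le.2 htc)
      · by_contra h
        exact (hev i hik).1 ⟨not_lt.1 h, h1.trans hw1⟩
      · by_contra h
        exact (hev i hik).2 ⟨hw0.trans h2, not_lt.1 h⟩)
    rw [hQ, Finset.mem_filter, Finset.mem_range] at hiQ
    obtain ⟨hik, hij, ha, he⟩ := hiQ
    refine hij (C.disj y₀ i j hik hj ⟨ha.le, ?_, hi⟩ hy₀)
    have : (0 : ℤ) ≤ r * (δ : ℤ) := by positivity
    omega
  · have h1 : (i : ℤ) ≤ r := by exact_mod_cast hi.le.trans hqr'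
    have h2 : (0 : ℤ) ≤ δ := by positivity
    refine Mem.mem (C := C) (j := j) ⟨?_, ?_, ?_⟩ hj
    · have := hy₀.1
      have : (0 : ℤ) ≤ i * (δ : ℤ) := by positivity
      omega
    · have := hy₁.2.1
      rw [hyr] at this
      nlinarith
    · rw [show y₀ + (i : ℤ) * δ - C.a j = (y₀ - C.a j) + i * δ by ring]
      exact dvd_add hy₀.2.2 ⟨i, by rw [hδ]; ring⟩

end ExactCover

/-- Among `N + 1` consecutive blocks of terms of a progression, one avoids a set of `N` numbers. -/
theorem exists_block_avoiding (P : Finset ℤ) (z : ℤ) {d N K : ℕ} (hd : 0 < d) (hP : P.card ≤ N) :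
    ∃ b ≤ N, ∀ w ∈ P, ¬ (z + ((1 + b * (K + 1) : ℕ) : ℤ) * d ≤ w ∧
      w ≤ z + ((1 + b * (K + 1) + K : ℕ) : ℤ) * d) := by
  by_contra hcon
  push Not at hcon
  choose! f hfP hf1 hf2 using hcon
  obtain ⟨b, hb, b', hb', hne, heq⟩ := Finset.exists_ne_map_eq_of_card_lt_of_maps_to
    (s := Finset.range (N + 1)) (t := P) (f := f) (by simpa using Nat.lt_succ_of_le hP)
    (fun b hb => hfP b (by simpa [Nat.lt_succ_iff] using hb))
  simp only [Finset.mem_range, Nat.lt_succ_iff] at hb hb'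
  have hd' : (0 : ℤ) < d := by exact_mod_cast hd
  have key : ∀ b b', b ≤ N → b' ≤ N → f b = f b' → ¬ b < b' := by
    intro b b' hb hb' heq hlt
    have h1 := hf2 b hb
    have h2 := hf1 b' hb'
    rw [← heq] at h2
    have h3 := h2.trans h1
    have h4 : 1 + b * (K + 1) + K < 1 + b' * (K + 1) := by nlinarith
    have h5 : ((1 + b * (K + 1) + K : ℕ) : ℤ) < ((1 + b' * (K + 1) : ℕ) : ℤ) := by
      exact_mod_cast h4
    nlinarith
  rcases lt_or_gt_of_ne hne with h | h
  · exact key b b' hb hb' heq h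
  · exact key b' b hb' hb heq.symm h

/-! ### Guided sweeps -/

namespace Sweep

variable {X : Finset ℤ} {k : ℕ}

/-- The number of starts and ends of progressions with known difference before `p`, plus the number
of elements given to the other progressions. -/
def weight (C : ExactCover X k) (p : ℤ) (σ : Sweep) : ℕ :=
  ∑ j ∈ Finset.range k, if σ.dif j ≠ 0 then
    (if C.a j ≤ p then 1 else 0) + (if C.e j < p then 1 else 0) else σ.cnt j

/-- A running sweep that follows the exact cover `C` lazily. `P` is the set of the problem points
since the last restart, that is of the elements at which the active progressions were guessed, `p`
is the last of them, and `t₀` is the number of bits used before the last restart. The active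
progressions are those with known difference that contain `p` in their span. -/
structure Guided (C : ExactCover X k) (lo : ℤ) (P : Finset ℤ) (p : ℤ) (t₀ : ℕ) (σ : Sweep) :
    Prop where
  valid : Valid X k lo σ
  running : σ.status = 0
  le_cur : p ≤ σ.cur
  le_last : ∀ y ∈ P, y ≤ p
  act : ∀ j < k, σ.act j = true ↔ σ.dif j ≠ 0 ∧ C.a j ≤ p ∧ p ≤ C.e j
  dif : ∀ j < k, σ.dif j ≠ 0 → σ.dif j = C.δ j ∧ (C.δ j : ℤ) ∣ σ.fst j - C.a j
  ext : ∀ j < k, σ.dif j ≠ 0 → σ.cnt j ≠ 0 → C.a j ≤ σ.fst j ∧ C.a j ≤ p ∧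
    (σ.cur < σ.fst j + σ.cnt j * C.δ j ∨ C.e j < σ.fst j + σ.cnt j * C.δ j)
  unknown : ∀ j < k, σ.dif j = 0 → σ.cnt j ≠ 0 → C.Mem j (σ.fst j)
  covered : ∀ y ∈ X, y ≤ σ.cur → y ∈ P ∨ ∃ m < k, σ.dif m ≠ 0 ∧ σ.Elem m y
  card_le : P.card ≤ weight C p σ
  tp_le : σ.tp ≤ t₀ + k * P.card

theorem weight_le {C : ExactCover X k} {lo : ℤ} (p : ℤ) {σ : Sweep} (h : Valid X k lo σ) :
    weight C p σ ≤ 2 * k := by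
  have : weight C p σ ≤ ∑ _j ∈ Finset.range k, 2 := by
    refine Finset.sum_le_sum fun j hj => ?_
    have := h.single j (Finset.mem_range.1 hj)
    split_ifs with h1 <;> omega
  simpa [mul_comm] using this

theorem Elem.dvd_sub {σ : Sweep} {i : ℕ} {y y' : ℤ} (h : σ.Elem i y) (h' : σ.Elem i y') :
    (σ.dif i : ℤ) ∣ y' - y := by
  obtain ⟨u, -, rfl⟩ := h
  obtain ⟨u', -, rfl⟩ := h'
  exact ⟨u' - u, by ring⟩

theorem Elem.convex {σ : Sweep} {i : ℕ} {y y' w : ℤ} (h : σ.Elem i y) (hd : σ.dif i ≠ 0)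
    (h' : σ.Elem i y') (h1 : y ≤ w) (h2 : w ≤ y') (h3 : (σ.dif i : ℤ) ∣ w - y) : σ.Elem i w := by
  obtain ⟨u, -, rfl⟩ := h
  obtain ⟨u', hu', rfl⟩ := h'
  obtain ⟨v, hv⟩ := h3
  have hd0 : (0 : ℤ) < σ.dif i := by exact_mod_cast Nat.pos_of_ne_zero hd
  have hv0 : 0 ≤ v := by
    have : 0 ≤ (σ.dif i : ℤ) * v := by omega
    exact nonneg_of_mul_nonneg_right this hd0
  obtain ⟨v', rfl⟩ := Int.eq_ofNat_of_zero_le hv0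
  have hw : w = σ.fst i + ((u + v' : ℕ) : ℤ) * σ.dif i := by push_cast; linarith
  refine ⟨u + v', ?_, hw⟩
  have h4 : ((u + v' : ℕ) : ℤ) * σ.dif i ≤ u' * σ.dif i := by omega
  have h5 : u + v' ≤ u' := by exact_mod_cast le_of_mul_le_mul_right h4 hd0
  omega

/-- The second element of a progression with unknown difference: either it is close to the first
one, or the difference has a small ratio to a known one. In between, the sweep gives the elements
of this progression to progressions with known difference except at few problem points, so two
elements of it that are close to each other lie on the same known line. -/
theorem Guided.exists_ratio {C : ExactCover X k} {lo : ℤ} {P : Finset ℤ} {p : ℤ} {t₀ : ℕ}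
    {σ : Sweep} (h : Guided C lo P p t₀ σ) {x : ℤ}
    (hnext : ∀ y ∈ X, σ.cur < y → x ≤ y) {j : ℕ} (hj : j < k) (hdj : σ.dif j = 0)
    (hcj : σ.cnt j ≠ 0) (hjx : C.Mem j x) {m : ℕ} (hm : x = σ.fst j + m * (C.δ j : ℤ))
    (hlarge : (4 * k + 1) * (k + 1) < m) :
    ∃ i < k, σ.dif i ≠ 0 ∧ ∃ c q : ℕ, c * C.δ i = q * C.δ j ∧ 0 < q ∧ q ≤ k ∧ c ≤ 2 ^ k ∧
      c ≤ X.card ∧ q ≤ X.card := by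
  classical
  have hz := h.unknown j hj hdj hcj
  set z := σ.fst j
  set δ := C.δ j with hδ
  have hδ0 : (0 : ℤ) < δ := by exact_mod_cast C.pos j
  set cut := P ∪ ((Finset.range k).image C.a ∪ (Finset.range k).image C.e) with hcut
  have hcard : cut.card ≤ 4 * k := by
    have h1 := Finset.card_union_le P ((Finset.range k).image C.a ∪ (Finset.range k).image C.e)
    have h2 := Finset.card_union_le ((Finset.range k).image C.a) ((Finset.range k).image C.e)
    have h3 := Finset.card_image_le (s := Finset.range k) (f := C.a)
    have h4 := Finset.card_image_le (s := Finset.range k) (f := C.e)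
    have h5 := h.card_le.trans (weight_le p h.valid)
    rw [Finset.card_range] at h3 h4
    rw [hcut]
    omega
  obtain ⟨b, hb, havoid⟩ := exists_block_avoiding cut z (d := δ) (K := k) (C.pos j) hcard
  set s := 1 + b * (k + 1) with hs
  have hsm : s + k < m := by
    have : b * (k + 1) ≤ 4 * k * (k + 1) := Nat.mul_le_mul_right _ hb
    nlinarith
  have hmem : ∀ r ≤ k, C.Mem j (z + ((s + r : ℕ) : ℤ) * δ) := by
    intro r hr
    have h1 : ((s + r : ℕ) : ℤ) ≤ m := by exact_mod_cast (by omega : s + r ≤ m)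
    refine ⟨?_, ?_, ?_⟩
    · have := hz.1
      have : (0 : ℤ) ≤ ((s + r : ℕ) : ℤ) * δ := by positivity
      omega
    · have := hjx.2.1
      rw [hm] at this
      nlinarith
    · rw [show z + ((s + r : ℕ) : ℤ) * δ - C.a j = (z - C.a j) + ((s + r : ℕ) : ℤ) * δ by ring]
      exact dvd_add hz.2.2 ⟨_, mul_comm _ _⟩
  have hlow : ∀ r, z + (s : ℤ) * δ ≤ z + ((s + r : ℕ) : ℤ) * δ := by
    intro r
    push_cast
    have : (0 : ℤ) ≤ (r : ℤ) * δ := by positivity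
    linarith
  have hupp : ∀ r ≤ k, z + ((s + r : ℕ) : ℤ) * δ ≤ z + ((s + k : ℕ) : ℤ) * δ := by
    intro r hr
    have : ((s + r : ℕ) : ℤ) ≤ ((s + k : ℕ) : ℤ) := by exact_mod_cast (by omega)
    nlinarith
  have hex : ∀ r ≤ k, ∃ i < k, σ.dif i ≠ 0 ∧ σ.Elem i (z + ((s + r : ℕ) : ℤ) * δ) := by
    intro r hr
    have hX := (hmem r hr).mem hj
    have hlt : z + ((s + r : ℕ) : ℤ) * δ < x := by
      rw [hm]
      have : ((s + r : ℕ) : ℤ) < m := by exact_mod_cast (by omega : s + r < m)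
      nlinarith
    have hcur : z + ((s + r : ℕ) : ℤ) * δ ≤ σ.cur := by
      by_contra hc
      exact absurd (hnext _ hX (not_le.1 hc)) (not_le.2 hlt)
    refine (h.covered _ hX hcur).resolve_left fun hP => ?_
    exact havoid _ (Finset.mem_union_left _ hP) ⟨hlow r, hupp r hr⟩
  choose! f hfk hfd hfe using hex
  obtain ⟨r, hr, r', hr', hne, heq⟩ := Finset.exists_ne_map_eq_of_card_lt_of_maps_to
    (s := Finset.range (k + 1)) (t := Finset.range k) (f := f) (by simp)
    (fun r hr => Finset.mem_coe.2 (Finset.mem_range.2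
      (hfk r (Nat.lt_succ_iff.1 (Finset.mem_range.1 hr)))))
  simp only [Finset.mem_range, Nat.lt_succ_iff] at hr hr'
  -- it suffices to treat two indices in increasing order
  have main : ∀ r r', r < r' → r ≤ k → r' ≤ k → f r = f r' → ∃ i < k, σ.dif i ≠ 0 ∧
      ∃ c q : ℕ, c * C.δ i = q * C.δ j ∧ 0 < q ∧ q ≤ k ∧ c ≤ 2 ^ k ∧ c ≤ X.card ∧ q ≤ X.card := by
    intro r r' hlt hr hr' heq
    have hdi := (h.dif (f r) (hfk r hr) (hfd r hr)).1
    have hel := hfe r hr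
    have hel' := hfe r' hr'
    rw [← heq] at hel'
    refine ⟨f r, hfk r hr, hfd r hr, ?_⟩
    rw [← hdi]
    refine C.exists_ratio_of_two_hits hj (r := r' - r) (Nat.pos_of_ne_zero (hfd r hr)) (hmem r hr)
      (hmem r' hr') (by omega) (by omega) ?_ ?_ ?_ ?_
    · push_cast [Nat.cast_sub hlt.le]
      ring
    · exact hel.dvd_sub hel'
    · intro w hw1 hw2 hw3
      exact ((h.valid.cover w).1 ⟨f r, hfk r hr, hel.convex (hfd r hr) hel' hw1 hw2 hw3⟩).1
    · intro i hi
      constructor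
      · rintro ⟨h1, h2⟩
        exact havoid _ (Finset.mem_union_right _ (Finset.mem_union_left _
          (Finset.mem_image_of_mem _ (Finset.mem_range.2 hi))))
          ⟨(hlow r).trans h1, h2.trans (hupp r' hr')⟩
      · rintro ⟨h1, h2⟩
        exact havoid _ (Finset.mem_union_right _ (Finset.mem_union_right _
          (Finset.mem_image_of_mem _ (Finset.mem_range.2 hi))))
          ⟨(hlow r).trans h1, h2.trans (hupp r' hr')⟩
  rcases lt_or_gt_of_ne hne with hlt | hlt
  · exact main r r' hlt hr hr' heq
  · exact main r' r hlt hr' hr heq.symm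

/-! ### Guessing the difference -/

theorem readNum_le (τ : ℕ → Bool) (n p i : ℕ) : readNum τ n p i ≤ n := by
  cases i with
  | zero => exact Nat.zero_le _
  | succ i => exact Nat.le_of_lt_succ (Nat.mod_lt _ (Nat.succ_pos n))

theorem readNum_eq {τ : ℕ → Bool} {n p T v : ℕ} (hvT : v < 2 ^ T) (hvn : v ≤ n)
    (hτ : ∀ i < T, τ (p + i) = v.testBit (T - 1 - i)) : readNum τ n p T = v := by
  have key : ∀ i ≤ T, readNum τ n p i = v / 2 ^ (T - i) := by
    intro i
    induction i with
    | zero => intro _; simp [readNum, Nat.div_eq_of_lt hvT]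
    | succ i ih =>
      intro hi
      have h1 : T - i = T - (i + 1) + 1 := by omega
      have h2 : T - 1 - i = T - (i + 1) := by omega
      have h3 : (v.testBit (T - (i + 1))).toNat = v / 2 ^ (T - (i + 1)) % 2 := by
        rw [Nat.toNat_testBit]
      rw [readNum, ih (by omega), hτ i (by omega), h2, h3, h1, pow_succ, ← Nat.div_div_eq_div_mul,
        Nat.div_add_mod, Nat.mod_eq_of_lt]
      exact Nat.lt_succ_of_le ((Nat.div_le_self _ _).trans hvn)
  simpa using key T le_rfl

theorem chosenDif_default {τ : ℕ → Bool} {σ : Sweep} {D : ℕ} (N : ℕ)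
    (hτ : ∀ i < N, τ (σ.tp + i) = false) : chosenDif τ σ D N = D := by
  induction N with
  | zero => rfl
  | succ N ih =>
    rw [chosenDif, if_neg (by simp [hτ N (by omega)]), ih fun i hi => hτ i (by omega)]

theorem chosenDif_eq {τ : ℕ → Bool} {σ : Sweep} {D N m : ℕ} (hm : m < N) (hd : σ.dif m ≠ 0)
    (hτ : ∀ i < N, τ (σ.tp + i) = decide (i = m)) : chosenDif τ σ D N = σ.dif m := by
  induction N with
  | zero => omega
  | succ N ih =>
    rw [chosenDif, hτ N (by omega)]
    by_cases h : N = m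
    · subst h; simp [hd]
    · rw [if_neg (by simp [h]), ih (by omega) fun i hi => hτ i (by omega)]

theorem lt_two_pow_digits (k : ℕ) :
    (4 * k + 1) * (k + 1) < 2 ^ digits k ∧ 2 ^ k < 2 ^ digits k ∧ k < 2 ^ digits k := by
  have h1 : k < 2 ^ k := Nat.lt_two_pow_self
  have h2 : 2 ^ digits k = 16 * (2 ^ k * 2 ^ k) * (2 ^ k * 2 ^ k) := by
    rw [digits]; ring
  refine ⟨?_, Nat.pow_lt_pow_right (by norm_num) (by unfold digits; omega), ?_⟩
  · rw [h2]
    have h3 : 1 ≤ 2 ^ k * 2 ^ k := Nat.one_le_iff_ne_zero.2 (by positivity)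
    have h4 : (k + 1) * (k + 1) ≤ 2 ^ k * 2 ^ k := Nat.mul_le_mul h1 h1
    nlinarith
  · exact h1.trans (Nat.pow_lt_pow_right (by norm_num) (by unfold digits; omega))

/-- Some guess of the numerator, the denominator and the base yields the difference of the
progression that contains both `fst j` and `x`. -/
theorem Guided.exists_guess {C : ExactCover X k} {lo : ℤ} {P : Finset ℤ} {p : ℤ} {t₀ : ℕ}
    {σ : Sweep} (h : Guided C lo P p t₀ σ) {x : ℤ} (hxc : σ.cur < x)
    (hnext : ∀ y ∈ X, σ.cur < y → x ≤ y) {j : ℕ} (hj : j < k) (hdj : σ.dif j = 0)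
    (hcj : σ.cnt j ≠ 0) (hjx : C.Mem j x) :
    ∃ τ₀ : ℕ → Bool, ∀ (τ : ℕ → Bool) (σ' : Sweep), σ'.dif = σ.dif → σ'.fst = σ.fst →
      (∀ i < k + 2 * digits k, τ (σ'.tp + i) = τ₀ i) →
      guessedDif X.card k τ σ' x j = C.δ j := by
  have hz := h.unknown j hj hdj hcj
  have hzx : σ.fst j < x := (h.valid.fst_mem hj hcj).2.trans_lt hxc
  have hδ0 : (0 : ℤ) < C.δ j := by exact_mod_cast C.pos j
  obtain ⟨m', hm'⟩ : (C.δ j : ℤ) ∣ x - σ.fst j := by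
    have := dvd_sub hjx.2.2 hz.2.2
    rwa [show x - C.a j - (σ.fst j - C.a j) = x - σ.fst j by ring] at this
  have hm0 : 0 < m' := by
    have : 0 < (C.δ j : ℤ) * m' := by omega
    exact (pos_iff_pos_of_mul_pos this).1 hδ0
  obtain ⟨m, rfl⟩ := Int.eq_ofNat_of_zero_le hm0.le
  have hm1 : 0 < m := by exact_mod_cast hm0
  have hx : x = σ.fst j + m * (C.δ j : ℤ) := by linarith
  have hD0 : (x - σ.fst j).toNat = m * C.δ j := by
    rw [hx, add_sub_cancel_left]
    exact_mod_cast Int.toNat_natCast (m * C.δ j)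
  have hT := lt_two_pow_digits k
  -- a word that consists of a selection and of two numbers
  have word : ∀ (s : ℕ → Bool) (c q D : ℕ), c < 2 ^ digits k → c ≤ X.card → q < 2 ^ digits k →
      q ≤ X.card → c * D = q * C.δ j → 0 < q →
      (∀ (τ : ℕ → Bool) (σ' : Sweep), σ'.dif = σ.dif → (∀ i < k, τ (σ'.tp + i) = s i) →
        chosenDif τ σ' (x - σ.fst j).toNat k = D) →
      ∃ τ₀ : ℕ → Bool, ∀ (τ : ℕ → Bool) (σ' : Sweep), σ'.dif = σ.dif → σ'.fst = σ.fst →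
        (∀ i < k + 2 * digits k, τ (σ'.tp + i) = τ₀ i) →
        guessedDif X.card k τ σ' x j = C.δ j := by
    intro s c q D hcT hcn hqT hqn hcq hq hs
    refine ⟨fun i => if i < k then s i else if i < k + digits k then
      c.testBit (digits k - 1 - (i - k)) else q.testBit (digits k - 1 - (i - (k + digits k))), ?_⟩
    intro τ σ' hdif hfst hτ
    beta_reduce at hτ
    have e1 : readNum τ X.card (σ'.tp + k) (digits k) = c := by
      refine readNum_eq hcT hcn fun i hi => ?_
      rw [show σ'.tp + k + i = σ'.tp + (k + i) by omega, hτ (k + i) (by omega),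
        if_neg (by omega), if_pos (by omega), show k + i - k = i by omega]
    have e2 : readNum τ X.card (σ'.tp + k + digits k) (digits k) = q := by
      refine readNum_eq hqT hqn fun i hi => ?_
      rw [show σ'.tp + k + digits k + i = σ'.tp + (k + digits k + i) by omega,
        hτ (k + digits k + i) (by omega), if_neg (by omega), if_neg (by omega),
        show k + digits k + i - (k + digits k) = i by omega]
    have e3 : chosenDif τ σ' (x - σ'.fst j).toNat k = D := by
      rw [hfst]
      refine hs τ σ' hdif fun i hi => ?_
      rw [hτ i (by omega), if_pos hi]
    rw [guessedDif, e1, e2, e3, hcq, Nat.mul_div_cancel_left _ hq, hfst, hD0, Nat.mod_eq_of_lt]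
    have := Nat.le_mul_of_pos_left (C.δ j) hm1
    omega
  by_cases hsmall : m ≤ (4 * k + 1) * (k + 1)
  · have hterm : ∀ i ≤ m, σ.fst j + i * (C.δ j : ℤ) ∈ X := by
      intro i hi
      have h1 : (i : ℤ) ≤ m := by exact_mod_cast hi
      have h2 : (0 : ℤ) ≤ i * (C.δ j : ℤ) := by positivity
      have h3 := hz.1
      have h4 := hjx.2.1
      rw [hx] at h4
      refine ExactCover.Mem.mem (C := C) (j := j) ⟨by omega, by nlinarith, ?_⟩ hj
      rw [show σ.fst j + (i : ℤ) * C.δ j - C.a j = (σ.fst j - C.a j) + i * C.δ j by ring]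
      exact dvd_add hz.2.2 ⟨i, by ring⟩
    have hmn := ExactCover.card_terms_le (C.pos j) fun i hi => hterm i hi.le
    exact word (fun _ => false) 1 m (m * C.δ j) (by omega) (by omega) (by omega) hmn
      (one_mul _) hm1 fun τ σ' _ hs => by rw [chosenDif_default k hs, hD0]
  · obtain ⟨i, hi, hdi, c, q, hcq, hq0, hqk, hck, hcn, hqn⟩ :=
      h.exists_ratio hnext hj hdj hcj hjx hx (by omega)
    exact word (fun i' => decide (i' = i)) c q (C.δ i) (by omega) hcn (by omega) hqn hcq hq0
      fun τ σ' hd hs => by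
        rw [chosenDif_eq hi (by rwa [hd]) hs, hd, (h.dif i hi hdi).1]

/-! ### A guided sweep succeeds -/

theorem Guided.dvd_of_hits {C : ExactCover X k} {lo : ℤ} {P : Finset ℤ} {p : ℤ} {t₀ : ℕ}
    {σ σ' : Sweep} (h : Guided C lo P p t₀ σ) (hcnt : σ'.cnt = σ.cnt) (hfst : σ'.fst = σ.fst)
    (hdif : σ'.dif = σ.dif) {x : ℤ} {i : ℕ} (hi : i < k) (hd : σ.dif i ≠ 0) (hx : σ'.Hits x i) :
    (C.δ i : ℤ) ∣ x - C.a i := by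
  obtain ⟨e1, e2⟩ := h.dif i hi hd
  have hh := hx.2
  rw [hcnt, hfst, hdif] at hh
  rcases hh with h1 | ⟨-, h1⟩ | ⟨-, h1⟩
  · exact absurd h1 hd
  · rw [e1] at h1
    have := dvd_add h1 e2
    rwa [show x - σ.fst i + (σ.fst i - C.a i) = x - C.a i by ring] at this
  · rw [h1, e1, show σ.fst i + (σ.cnt i : ℤ) * C.δ i - C.a i
      = (σ.fst i - C.a i) + σ.cnt i * C.δ i by ring]
    exact dvd_add e2 ⟨_, mul_comm _ _⟩

/-- A nonempty progression with known difference is never behind the cover. -/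
theorem Guided.next_eq {C : ExactCover X k} {lo : ℤ} {P : Finset ℤ} {p : ℤ} {t₀ : ℕ}
    {σ : Sweep} (h : Guided C lo P p t₀ σ) {x : ℤ}
    (hnext : ∀ y ∈ X, σ.cur < y → x ≤ y) {i : ℕ} (hi : i < k) (hd : σ.dif i ≠ 0)
    (hc : σ.cnt i ≠ 0) : (x < σ.fst i + σ.cnt i * C.δ i ∨ C.e i < σ.fst i + σ.cnt i * C.δ i) ∨
      (x = σ.fst i + σ.cnt i * C.δ i ∧ C.Mem i x) := by
  by_contra hcon
  push Not at hcon
  obtain ⟨⟨h1, h2⟩, h3⟩ := hcon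
  obtain ⟨ha, -, hcur⟩ := h.ext i hi hd hc
  have hcur' := hcur.resolve_right (not_lt.2 h2)
  have hmem : C.Mem i (σ.fst i + σ.cnt i * C.δ i) := by
    refine ⟨?_, h2, ?_⟩
    · have : (0 : ℤ) ≤ σ.cnt i * (C.δ i : ℤ) := by positivity
      omega
    · rw [show σ.fst i + (σ.cnt i : ℤ) * C.δ i - C.a i
        = (σ.fst i - C.a i) + σ.cnt i * C.δ i by ring]
      exact dvd_add (h.dif i hi hd).2 ⟨_, mul_comm _ _⟩
  have hx := le_antisymm (hnext _ (hmem.mem hi) hcur') h1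
  exact h3 hx (hx ▸ hmem)

theorem Guided.hits_of_mem {C : ExactCover X k} {lo : ℤ} {P : Finset ℤ} {p : ℤ} {t₀ : ℕ}
    {σ σ' : Sweep} (h : Guided C lo P p t₀ σ) (hcnt : σ'.cnt = σ.cnt) (hfst : σ'.fst = σ.fst)
    (hdif : σ'.dif = σ.dif) {x : ℤ} (hxc : σ.cur < x)
    (hnext : ∀ y ∈ X, σ.cur < y → x ≤ y) {i : ℕ} (hi : i < k) (hd : σ.dif i ≠ 0)
    (hx : C.Mem i x) (hact : σ'.act i = true) : σ'.Hits x i := by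
  obtain ⟨e1, e2⟩ := h.dif i hi hd
  refine ⟨hact, Or.inr ?_⟩
  rw [hcnt, hfst, hdif, e1]
  by_cases hc : σ.cnt i = 0
  · refine Or.inl ⟨hc, ?_⟩
    have := dvd_sub hx.2.2 e2
    rwa [show x - C.a i - (σ.fst i - C.a i) = x - σ.fst i by ring] at this
  · refine Or.inr ⟨hc, ?_⟩
    -- `x` is a term of the line after the last element of the progression
    have hlast : σ.fst i + ((σ.cnt i - 1 : ℕ) : ℤ) * C.δ i ≤ σ.cur := by
      refine ((h.valid.cover _).1 ⟨i, hi, σ.cnt i - 1, by omega, ?_⟩).2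
      rw [e1]
    rw [Nat.cast_sub (by omega), Nat.cast_one] at hlast
    obtain ⟨u, hu⟩ : (C.δ i : ℤ) ∣ x - σ.fst i := by
      have := dvd_sub hx.2.2 e2
      rwa [show x - C.a i - (σ.fst i - C.a i) = x - σ.fst i by ring] at this
    have hδ : (0 : ℤ) < C.δ i := by exact_mod_cast C.pos i
    have h2 : (C.δ i : ℤ) * (σ.cnt i - 1) < C.δ i * u := by linarith
    have h3 := lt_of_mul_lt_mul_left h2 hδ.le
    have h4 : (C.δ i : ℤ) * σ.cnt i ≤ C.δ i * u := mul_le_mul_of_nonneg_left (by omega) hδ.le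
    rcases h.next_eq hnext hi hd hc with h1 | h1
    · have hxe := hx.2.1
      have : σ.fst i + σ.cnt i * (C.δ i : ℤ) ≤ x := by linarith
      omega
    · exact h1.1

/-- The guidance survives when an element is appended to a progression. -/
theorem Guided.take {C : ExactCover X k} {lo : ℤ} {P P' : Finset ℤ} {p p' : ℤ} {t₀ : ℕ}
    {σ σ' : Sweep} (h : Guided C lo P p t₀ σ) (hcnt : σ'.cnt = σ.cnt) (hfst : σ'.fst = σ.fst)
    (hdif : σ'.dif = σ.dif) (hs : σ'.status = σ.status) {x : ℤ} (hxX : x ∈ X) (hxc : σ.cur < x)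
    (hnext : ∀ y ∈ X, σ.cur < y → x ≤ y) {m : ℕ} (hm : m < k) (hhit : σ'.Hits x m)
    (hvalid : Valid X k lo (σ'.take x m))
    (hp : p ≤ p') (hpx : p' ≤ x) (hPP : P ⊆ P') (hP' : ∀ y ∈ P', y ≤ p')
    (hx : x ∈ P' ∨ σ.dif m ≠ 0)
    (huniq : ∀ i < k, i ≠ m → σ.dif i ≠ 0 → σ.cnt i ≠ 0 → ¬ C.Mem i x)
    (hunk : σ.dif m = 0 → σ.cnt m = 0 ∧ C.Mem m x)
    (hact : ∀ i < k, i ≠ m → (σ'.act i = true ↔ σ.dif i ≠ 0 ∧ C.a i ≤ p' ∧ p' ≤ C.e i))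
    (hactm : σ.dif m ≠ 0 → C.a m ≤ p' ∧ p' ≤ C.e m)
    (hcard : P'.card ≤ weight C p' (σ'.take x m)) (htp : σ'.tp ≤ t₀ + k * P'.card) :
    Guided C lo P' p' t₀ (σ'.take x m) := by
  have hhit' := hhit.2
  rw [hcnt, hfst, hdif] at hhit'
  have helem := Sweep.take_elem (σ := σ') (x := x) (j := m) (by
    intro hc
    rw [hcnt] at hc
    rcases hhit.2 with h1 | h1 | h1
    · exact absurd (hunk (hdif ▸ h1)).1 hc
    · exact absurd (hcnt ▸ h1.1) hc
    · exact h1.2)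
  have helem' : ∀ i y, σ'.Elem i y ↔ σ.Elem i y := by
    intro i y; simp only [Elem, hcnt, hfst, hdif]
  refine ⟨hvalid, hs.trans h.running, hpx, hP', ?_, ?_, ?_, ?_, ?_, hcard, htp⟩
  · intro i hi
    by_cases him : i = m
    · subst him
      simp only [Sweep.take, Function.update_self, hdif, decide_eq_true_eq]
      exact ⟨fun h1 => ⟨h1, hactm h1⟩, fun h1 => h1.1⟩
    · simpa only [Sweep.take, Function.update_of_ne him, hdif] using hact i hi him
  · intro i hi hd
    change σ'.dif i ≠ 0 at hd
    rw [hdif] at hd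
    have h1 := h.dif i hi hd
    refine ⟨by simpa only [Sweep.take, hdif] using h1.1, ?_⟩
    by_cases hc : σ.cnt m = 0
    · by_cases him : i = m
      · subst him
        simpa [Sweep.take, hcnt, hc] using h.dvd_of_hits hcnt hfst hdif hi hd hhit
      · simpa [Sweep.take, hcnt, hc, him, hfst] using h1.2
    · simpa [Sweep.take, hcnt, hc, hfst] using h1.2
  · intro i hi hd hc
    change σ'.dif i ≠ 0 at hd
    rw [hdif] at hd
    change _ ∧ _ ∧ (x < _ ∨ _)
    by_cases him : i = m
    · subst him
      have hδ : (0 : ℤ) < C.δ i := by exact_mod_cast C.pos i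
      obtain ⟨ha, he⟩ := hactm hd
      by_cases hc0 : σ.cnt i = 0
      · simp only [Sweep.take, hcnt, hc0, if_true, Function.update_self, hfst]
        exact ⟨ha.trans hpx, ha, Or.inl (by push_cast; linarith)⟩
      · have hx' : x = σ.fst i + σ.cnt i * C.δ i := by
          rw [← (h.dif i hi hd).1]
          tauto
        simp only [Sweep.take, hcnt, hc0, if_false, Function.update_self, hfst]
        refine ⟨(h.ext i hi hd hc0).1, ha, Or.inl ?_⟩
        push_cast
        linarith
    · have hc0 : σ.cnt i ≠ 0 := by
        simpa only [Sweep.take, Function.update_of_ne him, hcnt] using hc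
      have h1 := h.ext i hi hd hc0
      have e1 : (σ'.take x m).fst i = σ.fst i := by
        by_cases hc1 : σ.cnt m = 0 <;> simp [Sweep.take, hcnt, hc1, him, hfst]
      have e2 : (σ'.take x m).cnt i = σ.cnt i := by simp [Sweep.take, him, hcnt]
      rw [e1, e2]
      refine ⟨h1.1, h1.2.1.trans hp, ?_⟩
      exact (h.next_eq hnext hi hd hc0).resolve_right fun h2 => huniq i hi him hd hc0 h2.2
  · intro i hi hd hc
    change σ'.dif i = 0 at hd
    rw [hdif] at hd
    by_cases him : i = m
    · subst him
      obtain ⟨h1, h2⟩ := hunk hd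
      simpa [Sweep.take, hcnt, h1] using h2
    · have hc0 : σ.cnt i ≠ 0 := by
        simpa only [Sweep.take, Function.update_of_ne him, hcnt] using hc
      have e1 : (σ'.take x m).fst i = σ.fst i := by
        by_cases hc1 : σ.cnt m = 0 <;> simp [Sweep.take, hcnt, hc1, him, hfst]
      rw [e1]
      exact h.unknown i hi hd hc0
  · intro y hy hyx
    change y ≤ x at hyx
    by_cases hyc : y ≤ σ.cur
    · rcases h.covered y hy hyc with h1 | ⟨i, hi, hd, he⟩
      · exact Or.inl (hPP h1)
      · refine Or.inr ⟨i, hi, ?_, (helem i y).2 (Or.inl ((helem' i y).2 he))⟩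
        simpa only [Sweep.take, hdif] using hd
    · have hxy := le_antisymm hyx (hnext y hy (not_le.1 hyc))
      subst hxy
      refine hx.imp id fun hd => ⟨m, hm, ?_, (helem m y).2 (Or.inr ⟨rfl, rfl⟩)⟩
      simpa only [Sweep.take, hdif] using hd

theorem hitSet_eq_singleton {σ : Sweep} {x : ℤ} {j : ℕ} (hj : j < k) (h : σ.Hits x j)
    (huniq : ∀ i < k, σ.Hits x i → i = j) : hitSet k σ x = {j} := by
  ext i
  simp only [hitSet, Finset.mem_filter, Finset.mem_range, Finset.mem_singleton]
  exact ⟨fun hi => huniq i hi.1 hi.2, fun hi => hi ▸ ⟨hj, h⟩⟩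

/-- The number of bits that are used between two restarts. -/
def phaseBits (k : ℕ) : ℕ := k * (2 * k + 1) + k + 2 * digits k

/-- The number of bits that are used by a guided sweep. -/
def tapeBits (k : ℕ) : ℕ := (k + 1) * phaseBits k

theorem tapeBits_eq (k : ℕ) : tapeBits k = 2 * ((k + 1) * (k + 1) * (k + 4)) := by
  simp only [tapeBits, phaseBits, digits]
  ring

/-- An element claimed by exactly one progression: no guess is needed. -/
theorem Guided.step_regular {C : ExactCover X k} {lo : ℤ} {P : Finset ℤ} {p : ℤ} {t₀ : ℕ}
    {σ : Sweep} (h : Guided C lo P p t₀ σ) (hlo : ∀ y ∈ X, lo < y) {x : ℤ} (hxX : x ∈ X)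
    (hxc : σ.cur < x) (hnext : ∀ y ∈ X, σ.cur < y → x ≤ y) (hreg : (hitSet k σ x).card = 1) :
    ∃ σ', (∀ τ, step X k lo τ σ = σ') ∧ σ'.tp = σ.tp ∧ Guided C lo P p t₀ σ' ∧ σ'.dif = σ.dif := by
  obtain ⟨hm, hhit⟩ := hitSet_card_eq_one hreg
  set m := (hitSet k σ x).sum id
  obtain ⟨hd, ham, hem⟩ := (h.act m hm).1 hhit.1
  have hstep : ∀ τ, step X k lo τ σ = σ.take x m := by
    intro τ
    rw [step_eq_settle h.running hxX hxc hnext, refresh, if_pos hreg, settle, if_pos hreg, place,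
      if_neg fun h1 => hd h1.1]
  refine ⟨_, hstep, rfl, ?_, rfl⟩
  have hvalid := h.valid.step hlo fun _ => false
  rw [hstep] at hvalid
  refine h.take rfl rfl rfl rfl hxX hxc hnext hm hhit hvalid le_rfl (h.le_cur.trans hxc.le)
    subset_rfl h.le_last (Or.inr hd) ?_ (fun h1 => absurd h1 hd) (fun i hi _ => h.act i hi)
    (fun _ => ⟨ham, hem⟩) ?_ h.tp_le
  · intro i hi him hdi hci hmem
    have hact : σ.act i = true := (h.act i hi).2
      ⟨hdi, (h.ext i hi hdi hci).2.1, h.le_cur.trans (hxc.le.trans hmem.2.1)⟩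
    have hit := h.hits_of_mem rfl rfl rfl hxc hnext hi hdi hmem hact
    obtain ⟨j', hj'⟩ := Finset.card_eq_one.1 hreg
    have h1 : i ∈ hitSet k σ x := Finset.mem_filter.2 ⟨Finset.mem_range.2 hi, hit⟩
    have h2 : m ∈ hitSet k σ x := Finset.mem_filter.2 ⟨Finset.mem_range.2 hm, hhit⟩
    rw [hj', Finset.mem_singleton] at h1 h2
    exact him (h1.trans h2.symm)
  · refine h.card_le.trans (le_of_eq (Finset.sum_congr rfl fun i _ => ?_))
    by_cases him : i = m
    · subst him
      simp [Sweep.take, hd]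
    · simp [Sweep.take, him]

/-- A problem point is the first element of a progression with unknown difference, or a progression
with known difference has started or ended since the last problem point. -/
theorem Guided.weight_lt {C : ExactCover X k} {lo : ℤ} {P : Finset ℤ} {p : ℤ} {t₀ : ℕ}
    {σ : Sweep} (h : Guided C lo P p t₀ σ) {x : ℤ}
    (hxc : σ.cur < x) (hnext : ∀ y ∈ X, σ.cur < y → x ≤ y) (hprob : (hitSet k σ x).card ≠ 1)
    {j : ℕ} (hj : j < k) (hjx : C.Mem j x) {σ' : Sweep} (hdif : σ'.dif = σ.dif)
    (hcnt : ∀ i < k, σ.dif i = 0 → σ.cnt i ≤ σ'.cnt i ∧ (i = j → σ.cnt i < σ'.cnt i)) :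
    weight C p σ < weight C x σ' := by
  have hpx : p < x := h.le_cur.trans_lt hxc
  refine Finset.sum_lt_sum (fun i hi => ?_) ?_
  · rw [hdif]
    have := hcnt i (Finset.mem_range.1 hi)
    split_ifs <;> omega
  · by_cases hdj : σ.dif j = 0
    · exact ⟨j, Finset.mem_range.2 hj, by
        simpa [hdif, hdj] using (hcnt j hj hdj).2 rfl⟩
    by_cases hjhit : σ.Hits x j
    · -- another progression that claims `x` has ended
      have hex : ∃ i < k, σ.Hits x i ∧ i ≠ j := by
        by_contra hcon
        push Not at hcon
        refine hprob ?_
        rw [hitSet_eq_singleton hj hjhit hcon, Finset.card_singleton]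
      obtain ⟨i, hi, hihit, hij⟩ := hex
      obtain ⟨hdi, hai, hei⟩ := (h.act i hi).1 hihit.1
      have hdvd := h.dvd_of_hits rfl rfl rfl hi hdi hihit
      have hend : C.e i < x := by
        by_contra hc
        exact hij (C.disj x i j hi hj ⟨by omega, not_lt.1 hc, hdvd⟩ hjx)
      refine ⟨i, Finset.mem_range.2 hi, ?_⟩
      rw [hdif, if_pos hdi, if_pos hdi]
      split_ifs <;> omega
    · -- the progression that contains `x` has started
      have hact : ¬ σ.act j = true := fun hact =>
        hjhit (h.hits_of_mem rfl rfl rfl hxc hnext hj hdj hjx hact)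
      rw [h.act j hj] at hact
      have h1 := hjx.1
      have h2 := hjx.2.1
      refine ⟨j, Finset.mem_range.2 hj, ?_⟩
      rw [hdif, if_pos hdj, if_pos hdj]
      have h3 : ¬ C.a j ≤ p := fun h3 => hact ⟨hdj, h3, by omega⟩
      split_ifs <;> omega

/-- At a problem point some guess keeps the sweep guided, possibly after a restart. -/
theorem Guided.step_problem {C : ExactCover X k} {lo : ℤ} {P : Finset ℤ} {p : ℤ} {t₀ : ℕ}
    {σ : Sweep} (h : Guided C lo P p t₀ σ) (hlo : ∀ y ∈ X, lo < y) {x : ℤ} (hxX : x ∈ X)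
    (hxc : σ.cur < x) (hnext : ∀ y ∈ X, σ.cur < y → x ≤ y) (hprob : (hitSet k σ x).card ≠ 1) :
    ∃ (τ₀ : ℕ → Bool) (σ' : Sweep), (∀ τ : ℕ → Bool, (∀ i, σ.tp ≤ i → i < σ'.tp → τ i = τ₀ i) →
      step X k lo τ σ = σ') ∧ σ.tp ≤ σ'.tp ∧
      ((∃ P' p', Guided C lo P' p' t₀ σ' ∧ σ'.dif = σ.dif ∧ σ'.tp ≤ t₀ + k * (2 * k)) ∨
        ∃ j < k, σ.dif j = 0 ∧ (∃ d ≠ 0, σ'.dif = Function.update σ.dif j d) ∧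
          σ'.tp ≤ t₀ + phaseBits k ∧ Guided C lo ∅ lo σ'.tp σ') := by
  classical
  obtain ⟨j, hj, hjx⟩ := (C.cover x).1 hxX
  change C.Mem j x at hjx
  have huniq : ∀ i < k, C.Mem i x → i = j := fun i hi hix => C.disj x i j hi hj hix hjx
  -- the true set of active progressions
  set A : ℕ → Bool := fun i => decide (i < k) &&
    if σ.dif i = 0 then decide (i = j) else decide (C.a i ≤ x ∧ x ≤ C.e i) with hA
  set σ₁ : Sweep := { σ with act := A, tp := σ.tp + k } with hσ₁
  have hact : ∀ i < k, A i = true ↔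
      (σ.dif i = 0 ∧ i = j) ∨ (σ.dif i ≠ 0 ∧ C.a i ≤ x ∧ x ≤ C.e i) := by
    intro i hi
    by_cases hd : σ.dif i = 0 <;> simp [hA, hi, hd]
  have hread : ∀ τ : ℕ → Bool, (∀ i < k, τ (σ.tp + i) = A i) → σ.refresh k τ x = σ₁ := by
    intro τ hτ
    rw [refresh, if_neg hprob, readAct, hσ₁]
    congr 1
    funext i
    by_cases hi : i < k
    · simp [hi, hτ i hi]
    · simp [hA, hi]
  have hhitj : σ₁.Hits x j := by
    by_cases hd : σ.dif j = 0
    · exact ⟨(hact j hj).2 (Or.inl ⟨hd, rfl⟩), Or.inl hd⟩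
    · exact h.hits_of_mem (σ' := σ₁) rfl rfl rfl hxc hnext hj hd hjx
        ((hact j hj).2 (Or.inr ⟨hd, hjx.1, hjx.2.1⟩))
  have hset : hitSet k σ₁ x = {j} := by
    refine hitSet_eq_singleton hj hhitj fun i hi hihit => ?_
    rcases (hact i hi).1 hihit.1 with h1 | ⟨hd, h1, h2⟩
    · exact h1.2
    · exact huniq i hi ⟨h1, h2, h.dvd_of_hits (σ' := σ₁) rfl rfl rfl hi hd hihit⟩
  have hstep : ∀ τ : ℕ → Bool, (∀ i < k, τ (σ.tp + i) = A i) →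
      step X k lo τ σ = σ₁.place X.card k lo τ x j := by
    intro τ hτ
    rw [step_eq_settle h.running hxX hxc hnext, hread τ hτ, settle, hset, Finset.card_singleton,
      if_pos rfl, Finset.sum_singleton, id]
  have hcardP := h.card_le.trans (weight_le p h.valid)
  by_cases hlearn : σ.dif j = 0 ∧ σ.cnt j ≠ 0
  · -- the difference of progression `j` is guessed
    obtain ⟨τ₁, hτ₁⟩ := h.exists_guess hxc hnext hj hlearn.1 hlearn.2 hjx
    have hz := h.unknown j hj hlearn.1 hlearn.2
    refine ⟨fun i => if i < σ.tp + k then A (i - σ.tp) else τ₁ (i - (σ.tp + k)),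
      ⟨0, lo, σ₁.tp + k + 2 * digits k, fun _ => false, fun _ => 0, σ.fst,
        Function.update σ.dif j (C.δ j)⟩, ?_, ?_, Or.inr ⟨j, hj, hlearn.1,
        ⟨C.δ j, (C.pos j).ne', rfl⟩, ?_, ?_⟩⟩
    · intro τ hτ
      beta_reduce at hτ
      simp only [hσ₁] at hτ
      have h1 : ∀ i < k, τ (σ.tp + i) = A i := by
        intro i hi
        rw [hτ (σ.tp + i) (by omega) (by omega), if_pos (by omega), Nat.add_sub_cancel_left]
      have h2 : guessedDif X.card k τ σ₁ x j = C.δ j := by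
        refine hτ₁ τ σ₁ rfl rfl fun i hi => ?_
        change τ (σ.tp + k + i) = _
        rw [hτ (σ.tp + k + i) (by omega) (by omega), if_neg (by omega), Nat.add_sub_cancel_left]
      rw [hstep τ h1, place, if_pos hlearn, learn, h2, if_neg (C.pos j).ne']
    · simp only [hσ₁]; omega
    · have := h.tp_le
      have h1 : k * P.card ≤ k * (2 * k) := Nat.mul_le_mul_left _ hcardP
      simp only [hσ₁, phaseBits]
      nlinarith
    · refine ⟨Valid.reset hlo rfl (fun _ => rfl) (by simp), rfl, le_rfl, by simp, ?_, ?_, ?_, ?_,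
        ?_, by simp, by simp⟩
      · intro i hi
        have := hlo _ (C.a_mem hi)
        simp only [Bool.false_eq_true, false_iff]
        rintro ⟨-, h1, -⟩
        omega
      · intro i hi hd
        by_cases hij : i = j
        · subst hij
          simpa using hz.2.2
        · simp only [Function.update_of_ne hij] at hd ⊢
          exact h.dif i hi hd
      · intro i _ _ hc; simp at hc
      · intro i _ _ hc; simp at hc
      · intro y hy hyc
        exact absurd (hlo y hy) (not_lt.2 hyc)
  · -- progression `j` takes `x`
    have hstep' : ∀ τ : ℕ → Bool, (∀ i < k, τ (σ.tp + i) = A i) →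
        step X k lo τ σ = σ₁.take x j := by
      intro τ hτ
      rw [hstep τ hτ, place, if_neg hlearn]
    have hxP : x ∉ P := fun hxP => absurd (h.le_last x hxP) (not_le.2 (h.le_cur.trans_lt hxc))
    have hvalid := h.valid.step hlo fun i => A (i - σ.tp)
    rw [hstep' _ fun i _ => by rw [Nat.add_sub_cancel_left]] at hvalid
    have hweight : P.card < weight C x (σ₁.take x j) := by
      refine h.card_le.trans_lt (h.weight_lt hxc hnext hprob hj hjx rfl fun i hi _ => ?_)
      by_cases hij : i = j
      · subst hij; simp [Sweep.take, hσ₁]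
      · simp [Sweep.take, hσ₁, hij]
    have hcard' : (insert x P).card ≤ weight C x (σ₁.take x j) := by
      rwa [Finset.card_insert_of_notMem hxP]
    have htp : σ.tp + k ≤ t₀ + k * (insert x P).card := by
      rw [Finset.card_insert_of_notMem hxP]
      have := h.tp_le
      linarith
    refine ⟨fun i => A (i - σ.tp), σ₁.take x j, ?_, ?_, Or.inl ⟨insert x P, x, ?_, rfl, ?_⟩⟩
    · intro τ hτ
      beta_reduce at hτ
      refine hstep' τ fun i hi => ?_
      rw [hτ (σ.tp + i) (by omega) (by simp only [Sweep.take, hσ₁]; omega), Nat.add_sub_cancel_left]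
    · simp only [Sweep.take, hσ₁]; omega
    · refine h.take (σ' := σ₁) rfl rfl rfl rfl hxX hxc hnext hj hhitj hvalid
        (h.le_cur.trans hxc.le) le_rfl (Finset.subset_insert _ _) ?_
        (Or.inl (Finset.mem_insert_self _ _)) (fun i hi hij _ _ hix => hij (huniq i hi hix))
        (fun hd => ⟨by tauto, hjx⟩) ?_ (fun _ => ⟨hjx.1, hjx.2.1⟩) hcard' htp
      · intro y hy
        rcases Finset.mem_insert.1 hy with rfl | hy
        · exact le_rfl
        · exact (h.le_last y hy).trans (h.le_cur.trans hxc.le)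
      · intro i hi hij
        change A i = true ↔ _
        rw [hact i hi]
        tauto
    · have := hcard'.trans (weight_le x hvalid)
      have h1 : k * (insert x P).card ≤ k * (2 * k) := Nat.mul_le_mul_left _ this
      simp only [Sweep.take, hσ₁]
      omega

/-- A guided sweep succeeds with a suitable continuation of the guessed bits. The bits used after
a restart are paid for by the progression whose difference has become known. -/
theorem Guided.exists_success {C : ExactCover X k} {lo : ℤ} (hlo : ∀ y ∈ X, lo < y) (N : ℕ) :
    ∀ {P : Finset ℤ} {p : ℤ} {t₀ : ℕ} {σ : Sweep}, Guided C lo P p t₀ σ → remaining X k σ = N →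
      t₀ + ((Finset.range k).filter (σ.dif · = 0)).card * phaseBits k ≤ k * phaseBits k →
      ∃ τ₀ : ℕ → Bool, ∀ τ : ℕ → Bool, (∀ i, σ.tp ≤ i → i < tapeBits k → τ i = τ₀ i) →
        ∃ M, ((step X k lo τ)^[M] σ).status = 1 := by
  induction N using Nat.strong_induction_on with
  | _ N ih =>
  intro P p t₀ σ h hN hbudget
  rcases exists_next X σ.cur with hall | ⟨x, hxX, hxc, hnext⟩
  · refine ⟨fun _ => false, fun τ _ => ⟨1, ?_⟩⟩
    rw [Function.iterate_one, step_eq_done h.running hall]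
  -- combine a step with the continuation
  have combine : ∀ (τ₁ : ℕ → Bool) (σ' : Sweep),
      (∀ τ : ℕ → Bool, (∀ i, σ.tp ≤ i → i < σ'.tp → τ i = τ₁ i) → step X k lo τ σ = σ') →
      σ.tp ≤ σ'.tp → σ'.tp ≤ tapeBits k →
      (∃ P' p' t', Guided C lo P' p' t' σ' ∧
        t' + ((Finset.range k).filter (σ'.dif · = 0)).card * phaseBits k ≤ k * phaseBits k) →
      ∃ τ₀ : ℕ → Bool, ∀ τ : ℕ → Bool, (∀ i, σ.tp ≤ i → i < tapeBits k → τ i = τ₀ i) →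
        ∃ M, ((step X k lo τ)^[M] σ).status = 1 := by
    rintro τ₁ σ' hstep htp htp' ⟨P', p', t', hG, hb⟩
    have hlt : remaining X k σ' < N := by
      rw [← hN]
      have h1 := hstep τ₁ fun _ _ _ => rfl
      have := step_remaining (X := X) (k := k) (lo := lo) τ₁ h.running (by rw [h1, hG.running])
      rwa [h1] at this
    obtain ⟨τ₂, hτ₂⟩ := ih _ hlt hG rfl hb
    refine ⟨fun i => if i < σ'.tp then τ₁ i else τ₂ i, fun τ hτ => ?_⟩
    beta_reduce at hτ
    have h1 : step X k lo τ σ = σ' := by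
      refine hstep τ fun i hi hi' => ?_
      rw [hτ i hi (by omega), if_pos hi']
    obtain ⟨M, hM⟩ := hτ₂ τ fun i hi hi' => by
      rw [hτ i (by omega) hi', if_neg (by omega)]
    exact ⟨M + 1, by rw [Function.iterate_succ_apply, h1]; exact hM⟩
  have htape : t₀ + k * (2 * k) ≤ tapeBits k ∧ σ.tp ≤ tapeBits k := by
    have h1 := h.tp_le
    have h2 : k * P.card ≤ k * (2 * k) :=
      Nat.mul_le_mul_left _ (h.card_le.trans (weight_le p h.valid))
    have h3 : t₀ ≤ k * phaseBits k := by omega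
    have h4 : k * (2 * k) ≤ phaseBits k := by unfold phaseBits; nlinarith
    unfold tapeBits
    constructor <;> nlinarith
  by_cases hreg : (hitSet k σ x).card = 1
  · obtain ⟨σ', hstep, htp, hG, hd⟩ := h.step_regular hlo hxX hxc hnext hreg
    exact combine (fun _ => false) σ' (fun τ _ => hstep τ) htp.ge (htp ▸ htape.2)
      ⟨P, p, t₀, hG, by rwa [hd]⟩
  · obtain ⟨τ₁, σ', hstep, htp, ⟨P', p', hG, hd, htp'⟩ | ⟨j, hj, hdj, ⟨d, hd0, hd⟩, htp', hG⟩⟩ :=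
      h.step_problem hlo hxX hxc hnext hreg
    · exact combine τ₁ σ' hstep htp (htp'.trans htape.1) ⟨P', p', t₀, hG, by rwa [hd]⟩
    · have hcard : ((Finset.range k).filter (σ'.dif · = 0)).card + 1
          ≤ ((Finset.range k).filter (σ.dif · = 0)).card := by
        refine Finset.card_lt_card (Finset.ssubset_iff_of_subset ?_ |>.2
          ⟨j, by simp [hj, hdj], by simp [hd, hd0]⟩)
        intro i hi
        rw [Finset.mem_filter] at hi ⊢
        refine ⟨hi.1, ?_⟩
        by_cases hij : i = j
        · rw [hij, hdj]
        · simpa [hd, hij] using hi.2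
      have hb : σ'.tp + ((Finset.range k).filter (σ'.dif · = 0)).card * phaseBits k
          ≤ k * phaseBits k := by
        have := Nat.mul_le_mul_right (phaseBits k) hcard
        rw [add_mul, one_mul] at this
        omega
      refine combine τ₁ σ' hstep htp ?_ ⟨∅, lo, σ'.tp, hG, hb⟩
      unfold tapeBits
      nlinarith [Nat.zero_le (((Finset.range k).filter (σ'.dif · = 0)).card * phaseBits k)]

/-- If there is an exact cover, then some word of `tapeBits k` bits leads the sweep to success. -/
theorem exists_success (C : ExactCover X k) {lo : ℤ} (hlo : ∀ y ∈ X, lo < y) :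
    ∃ τ₀ : ℕ → Bool, ∀ τ : ℕ → Bool, (∀ i < tapeBits k, τ i = τ₀ i) →
      ∃ M, ((step X k lo τ)^[M] (init lo)).status = 1 := by
  have hG : Guided C lo ∅ lo 0 (init lo) := by
    refine ⟨Valid.init hlo, rfl, le_rfl, by simp, ?_, ?_, ?_, ?_, ?_, by simp, by simp [init]⟩
    · intro i _; simp [init]
    · intro i _ hd; simp [init] at hd
    · intro i _ hd; simp [init] at hd
    · intro i _ _ hc; simp [init] at hc
    · intro y hy hyc
      exact absurd (hlo y hy) (not_lt.2 hyc)
  obtain ⟨τ₀, hτ₀⟩ := Guided.exists_success hlo _ hG rfl (by simp [init])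
  exact ⟨τ₀, fun τ hτ => hτ₀ τ fun i _ hi => hτ i hi⟩

end Sweep

/-! ### Reasoning about programs -/

namespace WordRAM

/-- The largest absolute value of a literal in an expression. -/
def Expr.litMax : Expr → ℕ
  | .lit z => z.natAbs
  | .reg _ => 0
  | .load e => e.litMax
  | .bin _ e₁ e₂ => max e₁.litMax e₂.litMax

/-- All registers and memory cells hold integers of absolute value at most `G`. -/
def State.Bdd (G : ℕ) (s : State) : Prop :=
  (∀ r, (s.reg r).natAbs ≤ G) ∧ ∀ a, (s.mem a).natAbs ≤ G

theorem BinOp.natAbs_apply_le (o : BinOp) (a b : ℤ) {A B : ℕ} (hA : 1 ≤ A) (hB : 1 ≤ B)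
    (ha : a.natAbs ≤ A) (hb : b.natAbs ≤ B) : (o.apply a b).natAbs ≤ 2 * (A * B) := by
  have hAB : A ≤ A * B := Nat.le_mul_of_pos_right _ hB
  have hBA : B ≤ A * B := Nat.le_mul_of_pos_left _ hA
  cases o with
  | add => exact (Int.natAbs_add_le a b).trans (by omega)
  | sub => exact (Int.natAbs_sub_le a b).trans (by omega)
  | mul =>
    rw [BinOp.apply, Int.natAbs_mul]
    have := Nat.mul_le_mul ha hb
    omega
  | div =>
    have : (a / b).natAbs ≤ a.natAbs := Int.natAbs_ediv_le_natAbs a b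
    rw [BinOp.apply]
    omega
  | mod =>
    rw [BinOp.apply]
    rcases eq_or_ne b 0 with rfl | h
    · rw [Int.emod_zero]; omega
    · have h1 := Int.emod_nonneg a h
      have h2 := Int.emod_lt a h
      omega
  | lt =>
    have := Nat.mul_le_mul hA hB
    rw [BinOp.apply]
    split_ifs
    · rw [Int.natAbs_one]; omega
    · simp
  | eq =>
    have := Nat.mul_le_mul hA hB
    rw [BinOp.apply]
    split_ifs
    · rw [Int.natAbs_one]; omega
    · simp

theorem Expr.natAbs_eval_le {G : ℕ} (hG : 2 ≤ G) {s : State} (hs : s.Bdd G) (e : Expr)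
    (he : e.litMax ≤ G) : (e.eval s).natAbs ≤ G ^ e.cost := by
  induction e with
  | lit z => simpa [Expr.eval, Expr.cost, Expr.litMax] using he
  | reg r => simpa [Expr.eval, Expr.cost] using hs.1 r
  | load e _ =>
    refine (hs.2 _).trans ?_
    rw [Expr.cost]
    exact Nat.le_self_pow (by omega) G
  | bin o e₁ e₂ ih₁ ih₂ =>
    rw [Expr.litMax] at he
    have h1 := ih₁ (by omega)
    have h2 := ih₂ (by omega)
    have hp : ∀ n, 1 ≤ G ^ n := fun n => Nat.one_le_pow _ _ (by omega)
    refine (BinOp.natAbs_apply_le o _ _ (hp _) (hp _) h1 h2).trans ?_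
    rw [Expr.cost, pow_succ, pow_add, mul_comm]
    exact Nat.mul_le_mul_left _ hG

/-- On a state whose registers and cells are bounded by `G`, an expression of cost at most `N` can
be evaluated with words bounded by `G ^ N`. -/
theorem Expr.fits_pow {G : ℕ} (hG : 2 ≤ G) {s : State} (hs : s.Bdd G) (e : Expr)
    (he : e.litMax ≤ G) {N : ℕ} (hN : e.cost ≤ N) : e.Fits (G ^ N) s := by
  have key : ∀ e : Expr, e.litMax ≤ G → e.cost ≤ N → (e.eval s).natAbs ≤ G ^ N := fun e h1 h2 =>
    (e.natAbs_eval_le hG hs h1).trans (Nat.pow_le_pow_right (by omega) h2)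
  induction e with
  | lit z => exact key _ he hN
  | reg r => exact key _ he hN
  | load e ih =>
    refine ⟨ih he ?_, key _ he hN⟩
    rw [Expr.cost] at hN; omega
  | bin o e₁ e₂ ih₁ ih₂ =>
    have hN' := hN
    have he' := he
    rw [Expr.cost] at hN'
    rw [Expr.litMax] at he'
    exact ⟨ih₁ (by omega) (by omega), ih₂ (by omega) (by omega), key _ he hN⟩

/-- From the state `s`, the program `P` halts within time `T` on a machine with words bounded by
`G ^ 128`, in a state that satisfies `Q` and whose registers and cells are bounded by `G`. -/
def Runs (G : ℕ) (P : Prog) (s : State) (T : ℕ) (Q : State → Prop) : Prop :=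
  ∃ s' t, Exec (G ^ 128) P s s' t ∧ t ≤ T ∧ s'.Bdd G ∧ Q s'

/-- An expression that is small enough for the rules below. -/
def Expr.Small (e : Expr) : Prop := e.cost ≤ 128 ∧ e.litMax ≤ 8

instance (e : Expr) : Decidable e.Small := by unfold Expr.Small; infer_instance

theorem State.Bdd.update_reg {G : ℕ} {s : State} (hs : s.Bdd G) {r : ℕ} {v : ℤ}
    (hv : v.natAbs ≤ G) : State.Bdd G ⟨Function.update s.reg r v, s.mem⟩ := by
  refine ⟨fun r' => ?_, hs.2⟩
  by_cases h : r' = r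
  · subst h; simpa using hv
  · simpa [h] using hs.1 r'

theorem State.Bdd.update_mem {G : ℕ} {s : State} (hs : s.Bdd G) {a v : ℤ}
    (hv : v.natAbs ≤ G) : State.Bdd G ⟨s.reg, Function.update s.mem a v⟩ := by
  refine ⟨hs.1, fun a' => ?_⟩
  by_cases h : a' = a
  · subst h; simpa using hv
  · simpa [h] using hs.2 a'

namespace Runs

variable {G T : ℕ} {s : State} {Q : State → Prop}

theorem mono {P : Prog} {T' : ℕ} {Q' : State → Prop} (h : Runs G P s T' Q') (hT : T' ≤ T)
    (hQ : ∀ s, s.Bdd G → Q' s → Q s) : Runs G P s T Q := by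
  obtain ⟨s', t, h1, h2, h3, h4⟩ := h
  exact ⟨s', t, h1, h2.trans hT, h3, hQ s' h3 h4⟩

theorem skip (hs : s.Bdd G) (hT : 1 ≤ T) (hQ : Q s) : Runs G .skip s T Q :=
  ⟨s, 1, .skip s, hT, hs, hQ⟩

theorem assign {r : ℕ} {e : Expr} (hG : 8 ≤ G) (hs : s.Bdd G) (he : e.Small) (v : ℤ)
    (hev : e.eval s = v) (hv : v.natAbs ≤ G) (hT : 129 ≤ T)
    (hQ : Q ⟨Function.update s.reg r v, s.mem⟩) : Runs G (.assign r e) s T Q := by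
  subst hev
  exact ⟨_, _, .assign s r e (e.fits_pow (by omega) hs (he.2.trans hG) he.1),
    (Nat.succ_le_succ he.1).trans hT, hs.update_reg hv, hQ⟩

theorem store {a e : Expr} (hG : 8 ≤ G) (hs : s.Bdd G) (ha : a.Small) (he : e.Small) (i v : ℤ)
    (hai : a.eval s = i) (hev : e.eval s = v) (hv : v.natAbs ≤ G) (hT : 257 ≤ T)
    (hQ : Q ⟨s.reg, Function.update s.mem i v⟩) : Runs G (.store a e) s T Q := by
  subst hai hev
  refine ⟨_, _, .store s a e (a.fits_pow (by omega) hs (ha.2.trans hG) ha.1)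
    (e.fits_pow (by omega) hs (he.2.trans hG) he.1), ?_, hs.update_mem hv, hQ⟩
  have := ha.1
  have := he.1
  omega

theorem seq {P P' : Prog} {T₁ T₂ : ℕ} (h : Runs G P s T₁ fun s' => Runs G P' s' T₂ Q)
    (hT : T₁ + T₂ ≤ T) : Runs G (.seq P P') s T Q := by
  obtain ⟨s₁, t₁, h1, h2, -, s₂, t₂, h4, h5, h6, h7⟩ := h
  exact ⟨s₂, _, .seq h1 h4, by omega, h6, h7⟩

theorem andThen {P P' : Prog} {T₁ : ℕ} {R : State → Prop} (h : Runs G P s T₁ R) (hT : T₁ ≤ T)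
    (hR : ∀ s', s'.Bdd G → R s' → Runs G P' s' (T - T₁) Q) : Runs G (.seq P P') s T Q :=
  seq (h.mono le_rfl hR) (by omega)

theorem assignThen {r : ℕ} {e : Expr} {P : Prog} (hG : 8 ≤ G) (hs : s.Bdd G) (he : e.Small) (v : ℤ)
    (hev : e.eval s = v) (hv : v.natAbs ≤ G) (hT : 129 ≤ T)
    (hQ : State.Bdd G ⟨Function.update s.reg r v, s.mem⟩ →
      Runs G P ⟨Function.update s.reg r v, s.mem⟩ (T - 129) Q) :
    Runs G (.seq (.assign r e) P) s T Q :=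
  seq (assign hG hs he v hev hv le_rfl (hQ (hs.update_reg hv))) (by omega)

theorem storeThen {a e : Expr} {P : Prog} (hG : 8 ≤ G) (hs : s.Bdd G) (ha : a.Small) (he : e.Small)
    (i v : ℤ) (hai : a.eval s = i) (hev : e.eval s = v) (hv : v.natAbs ≤ G) (hT : 257 ≤ T)
    (hQ : State.Bdd G ⟨s.reg, Function.update s.mem i v⟩ →
      Runs G P ⟨s.reg, Function.update s.mem i v⟩ (T - 257) Q) :
    Runs G (.seq (.store a e) P) s T Q :=
  seq (store hG hs ha he i v hai hev hv le_rfl (hQ (hs.update_mem hv))) (by omega)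

theorem ite {e : Expr} {P P' : Prog} {T' : ℕ} (hG : 8 ≤ G) (hs : s.Bdd G) (he : e.Small)
    (hT : T' + 129 ≤ T) (h1 : e.eval s ≠ 0 → Runs G P s T' Q)
    (h2 : e.eval s = 0 → Runs G P' s T' Q) : Runs G (.ite e P P') s T Q := by
  have hf := e.fits_pow (by omega) hs (he.2.trans hG) he.1
  have hc := he.1
  by_cases h : e.eval s = 0
  · obtain ⟨s', t, e1, e2, e3, e4⟩ := h2 h
    exact ⟨s', _, .ite_false hf h e1, by omega, e3, e4⟩
  · obtain ⟨s', t, e1, e2, e3, e4⟩ := h1 h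
    exact ⟨s', _, .ite_true hf h e1, by omega, e3, e4⟩

/-- A loop whose states are indexed by a set on which a measure decreases. -/
theorem loop {ι : Type*} {e : Expr} {P : Prog} (hG : 8 ≤ G) (he : e.Small)
    (Inv : ι → State → Prop) (μ : ι → ℕ) (T' : ℕ)
    (hstep : ∀ i s, s.Bdd G → Inv i s → e.eval s ≠ 0 →
      Runs G P s T' fun s' => ∃ i', μ i' < μ i ∧ Inv i' s')
    (hdone : ∀ i s, s.Bdd G → Inv i s → e.eval s = 0 → Q s)
    (i : ι) (hs : s.Bdd G) (hi : Inv i s) (hT : (μ i + 1) * (T' + 129) ≤ T) :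
    Runs G (.loop e P) s T Q := by
  obtain ⟨N, hN⟩ : ∃ N, μ i = N := ⟨_, rfl⟩
  induction N using Nat.strong_induction_on generalizing i s T with
  | _ N ih =>
    have hf := e.fits_pow (by omega) hs (he.2.trans hG) he.1
    have hc := he.1
    by_cases h : e.eval s = 0
    · refine ⟨s, _, .loop_done hf h, ?_, hs, hdone i s hs hi h⟩
      nlinarith
    · obtain ⟨s₁, t₁, e1, e2, e3, i', e4, e5⟩ := hstep i s hs hi h
      obtain ⟨s₂, t₂, d1, d2, d3, d4⟩ := ih (μ i') (hN ▸ e4) i' e3 e5 le_rfl rfl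
      refine ⟨s₂, _, .loop_step hf h e1 d1, ?_, d3, d4⟩
      have : (μ i' + 1) * (T' + 129) ≤ μ i * (T' + 129) := Nat.mul_le_mul_right _ e4
      nlinarith

end Runs

/-- `for i < reg b do P`, with the counter in register `i`. -/
def forProg (i b : ℕ) (P : Prog) : Prog :=
  .seq (.assign i (.lit 0)) (.loop (.bin .lt (.reg i) (.reg b))
    (.seq P (.assign i (.bin .add (.reg i) (.lit 1)))))

theorem Runs.forLoop {G T : ℕ} {s : State} {Q : State → Prop} {i b : ℕ} {P : Prog} (hG : 8 ≤ G)
    (Inv : ℕ → State → Prop) (N T' : ℕ) (hN : N ≤ G) (hs : s.Bdd G)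
    (h0 : Inv 0 ⟨Function.update s.reg i 0, s.mem⟩)
    (hb : ∀ m s, Inv m s → s.reg b = N)
    (hstep : ∀ m < N, ∀ s, s.Bdd G → Inv m s → s.reg i = m → Runs G P s T' fun s' =>
      s'.reg i = m ∧ Inv (m + 1) ⟨Function.update s'.reg i ((m + 1 : ℕ) : ℤ), s'.mem⟩)
    (hQ : ∀ s, s.Bdd G → Inv N s → Q s) (hT : (N + 1) * (T' + 258) + 129 ≤ T) :
    Runs G (forProg i b P) s T Q := by
  refine Runs.seq (T₁ := 129) (T₂ := (N + 1) * (T' + 258))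
    (Runs.assign hG hs (by decide) 0 rfl (by simp) le_rfl ?_) (by omega)
  refine Runs.loop (ι := ℕ) hG (by simp [Expr.Small, Expr.cost, Expr.litMax])
    (fun m s => m ≤ N ∧ s.reg i = m ∧ Inv m s) (fun m => N - m) (T' + 129) ?_ ?_ 0
    (hs.update_reg (by simp)) ⟨Nat.zero_le _, by simp, h0⟩ (by simp)
  · rintro m s hs ⟨hm, him, hI⟩ hne
    have hlt : m < N := by
      by_contra hcon
      have : ¬ (m : ℤ) < N := by exact_mod_cast hcon
      simp [Expr.eval, BinOp.apply, him, hb m s hI, this] at hne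
    refine Runs.seq (T₁ := T') (T₂ := 129) ?_ le_rfl
    refine (hstep m hlt s hs hI him).mono le_rfl ?_
    rintro s' hs' ⟨h1, h2⟩
    refine Runs.assign hG hs' (by simp [Expr.Small, Expr.cost, Expr.litMax])
      ((m + 1 : ℕ) : ℤ) (by simp [Expr.eval, BinOp.apply, h1]) ?_ le_rfl ?_
    · rw [Int.natAbs_natCast]; omega
    · exact ⟨m + 1, by omega, by omega, by simp, h2⟩
  · rintro m s hs ⟨hm, him, hI⟩ h0
    have hge : ¬ m < N := by
      intro hcon
      have : (m : ℤ) < N := by exact_mod_cast hcon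
      simp [Expr.eval, BinOp.apply, him, hb m s hI, this] at h0
    obtain rfl : m = N := by omega
    exact hQ s hs hI

end WordRAM

/-! ### The program for one sweep -/

namespace WordRAM

/-- The address of field `f` of progression `j`; the fields `1, 2, 3, 4` hold `act`, `cnt`, `fst`
and `dif`. -/
def adr (f : ℤ) (j : Expr) : Expr :=
  .bin .sub (.lit (-f)) (.bin .mul (.lit 4) j)

/-- Field `f` of progression `j`. -/
def field (f : ℤ) (j : Expr) : Expr := .load (adr f j)

@[simp] theorem eval_adr (s : State) (f : ℤ) (j : Expr) :
    (adr f j).eval s = -f - 4 * j.eval s := rfl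

@[simp] theorem eval_field (s : State) (f : ℤ) (j : Expr) :
    (field f j).eval s = s.mem (-f - 4 * j.eval s) := rfl

/-- The state `s` of the machine represents the state `σ` of a sweep over the elements of `xs`.
The registers `0, …, 7` hold the size of the input, `k`, a lower bound `lo`, the number of bits on
the tape of guesses, the number of digits of a guessed number, `cur`, `tp` and `status`. The
nonnegative part of the memory holds the input, followed by the tape `τ`; the negative part holds
the progressions. The registers from `8` on are temporary. -/
structure Rep (xs : List ℤ) (k : ℕ) (lo : ℤ) (τ : ℕ → Bool) (σ : Sweep) (s : State) : Prop where
  size : s.reg 0 = xs.length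
  num : s.reg 1 = k
  low : s.reg 2 = lo
  bits : s.reg 3 = Sweep.tapeBits k
  digits : s.reg 4 = Sweep.digits k
  cur : s.reg 5 = σ.cur
  tp : s.reg 6 = σ.tp
  status : s.reg 7 = σ.status
  input : ∀ (i : ℕ) (h : i < xs.length), s.mem i = xs[i]
  tape : ∀ i : ℕ, s.mem (xs.length + i) = (τ i).toNat
  act : ∀ j < k, s.mem (-1 - 4 * (j : ℤ)) = (σ.act j).toNat
  cnt : ∀ j < k, s.mem (-2 - 4 * (j : ℤ)) = σ.cnt j
  fst : ∀ j < k, s.mem (-3 - 4 * (j : ℤ)) = σ.fst j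
  dif : ∀ j < k, s.mem (-4 - 4 * (j : ℤ)) = σ.dif j

/-- `G` bounds all numbers that the program writes. -/
structure Big (xs : List ℤ) (k : ℕ) (lo : ℤ) (G : ℕ) : Prop where
  eight : 8 ≤ G
  size : xs.length + 1 ≤ G
  num : k * k + k ≤ G
  elem : ∀ x ∈ xs, 2 * x.natAbs + 2 ≤ G
  low : lo.natAbs ≤ G
  tp : (k * (xs.length + 1) + xs.length + 1) * (2 * k + 2 * Sweep.digits k) ≤ G
  bits : Sweep.tapeBits k ≤ G
  digits : Sweep.digits k ≤ G

section Rep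

variable {xs : List ℤ} {k : ℕ} {lo : ℤ} {τ : ℕ → Bool} {σ : Sweep} {s : State}

theorem Rep.reg (h : Rep xs k lo τ σ s) {r : ℕ} (hr : 8 ≤ r) (v : ℤ) :
    Rep xs k lo τ σ ⟨Function.update s.reg r v, s.mem⟩ := by
  obtain ⟨h1, h2, h3, h4, h5, h6, h7, h8, h9, h10, h11, h12, h13, h14⟩ := h
  constructor <;>
    first | assumption | (dsimp only; rw [Function.update_of_ne (by omega)]; assumption)

theorem Rep.setCur (h : Rep xs k lo τ σ s) (v : ℤ) :
    Rep xs k lo τ { σ with cur := v } ⟨Function.update s.reg 5 v, s.mem⟩ := by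
  obtain ⟨h1, h2, h3, h4, h5, h6, h7, h8, h9, h10, h11, h12, h13, h14⟩ := h
  constructor <;> first | assumption | simp

theorem Rep.setTp (h : Rep xs k lo τ σ s) (v : ℕ) :
    Rep xs k lo τ { σ with tp := v } ⟨Function.update s.reg 6 (v : ℤ), s.mem⟩ := by
  obtain ⟨h1, h2, h3, h4, h5, h6, h7, h8, h9, h10, h11, h12, h13, h14⟩ := h
  constructor <;> first | assumption | simp

theorem Rep.setStatus (h : Rep xs k lo τ σ s) (v : ℕ) :
    Rep xs k lo τ { σ with status := v } ⟨Function.update s.reg 7 (v : ℤ), s.mem⟩ := by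
  obtain ⟨h1, h2, h3, h4, h5, h6, h7, h8, h9, h10, h11, h12, h13, h14⟩ := h
  constructor <;> first | assumption | simp

theorem Rep.setAct (h : Rep xs k lo τ σ s) (j : ℕ) (b : Bool) :
    Rep xs k lo τ { σ with act := Function.update σ.act j b }
      ⟨s.reg, Function.update s.mem (-1 - 4 * (j : ℤ)) (b.toNat : ℤ)⟩ := by
  obtain ⟨h1, h2, h3, h4, h5, h6, h7, h8, h9, h10, h11, h12, h13, h14⟩ := h
  refine ⟨h1, h2, h3, h4, h5, h6, h7, h8, fun i hi => ?_, fun i => ?_, fun i hi => ?_,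
    fun i hi => ?_, fun i hi => ?_, fun i hi => ?_⟩
  · rw [← h9 i hi]; exact Function.update_of_ne (by omega) _ _
  · rw [← h10 i]; exact Function.update_of_ne (by omega) _ _
  · by_cases hij : i = j
    · subst hij; simp
    · dsimp only; rw [Function.update_of_ne (by omega), Function.update_of_ne hij]; exact h11 i hi
  · rw [← h12 i hi]; exact Function.update_of_ne (by omega) _ _
  · rw [← h13 i hi]; exact Function.update_of_ne (by omega) _ _
  · rw [← h14 i hi]; exact Function.update_of_ne (by omega) _ _

theorem Rep.setCnt (h : Rep xs k lo τ σ s) (j v : ℕ) :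
    Rep xs k lo τ { σ with cnt := Function.update σ.cnt j v }
      ⟨s.reg, Function.update s.mem (-2 - 4 * (j : ℤ)) (v : ℤ)⟩ := by
  obtain ⟨h1, h2, h3, h4, h5, h6, h7, h8, h9, h10, h11, h12, h13, h14⟩ := h
  refine ⟨h1, h2, h3, h4, h5, h6, h7, h8, fun i hi => ?_, fun i => ?_, fun i hi => ?_,
    fun i hi => ?_, fun i hi => ?_, fun i hi => ?_⟩
  · rw [← h9 i hi]; exact Function.update_of_ne (by omega) _ _
  · rw [← h10 i]; exact Function.update_of_ne (by omega) _ _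
  · rw [← h11 i hi]; exact Function.update_of_ne (by omega) _ _
  · by_cases hij : i = j
    · subst hij; simp
    · dsimp only; rw [Function.update_of_ne (by omega), Function.update_of_ne hij]; exact h12 i hi
  · rw [← h13 i hi]; exact Function.update_of_ne (by omega) _ _
  · rw [← h14 i hi]; exact Function.update_of_ne (by omega) _ _

theorem Rep.setFst (h : Rep xs k lo τ σ s) (j : ℕ) (v : ℤ) :
    Rep xs k lo τ { σ with fst := Function.update σ.fst j v }
      ⟨s.reg, Function.update s.mem (-3 - 4 * (j : ℤ)) v⟩ := by
  obtain ⟨h1, h2, h3, h4, h5, h6, h7, h8, h9, h10, h11, h12, h13, h14⟩ := h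
  refine ⟨h1, h2, h3, h4, h5, h6, h7, h8, fun i hi => ?_, fun i => ?_, fun i hi => ?_,
    fun i hi => ?_, fun i hi => ?_, fun i hi => ?_⟩
  · rw [← h9 i hi]; exact Function.update_of_ne (by omega) _ _
  · rw [← h10 i]; exact Function.update_of_ne (by omega) _ _
  · rw [← h11 i hi]; exact Function.update_of_ne (by omega) _ _
  · rw [← h12 i hi]; exact Function.update_of_ne (by omega) _ _
  · by_cases hij : i = j
    · subst hij; simp
    · dsimp only; rw [Function.update_of_ne (by omega), Function.update_of_ne hij]; exact h13 i hi
  · rw [← h14 i hi]; exact Function.update_of_ne (by omega) _ _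

theorem Rep.setDif (h : Rep xs k lo τ σ s) (j v : ℕ) :
    Rep xs k lo τ { σ with dif := Function.update σ.dif j v }
      ⟨s.reg, Function.update s.mem (-4 - 4 * (j : ℤ)) (v : ℤ)⟩ := by
  obtain ⟨h1, h2, h3, h4, h5, h6, h7, h8, h9, h10, h11, h12, h13, h14⟩ := h
  refine ⟨h1, h2, h3, h4, h5, h6, h7, h8, fun i hi => ?_, fun i => ?_, fun i hi => ?_,
    fun i hi => ?_, fun i hi => ?_, fun i hi => ?_⟩
  · rw [← h9 i hi]; exact Function.update_of_ne (by omega) _ _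
  · rw [← h10 i]; exact Function.update_of_ne (by omega) _ _
  · rw [← h11 i hi]; exact Function.update_of_ne (by omega) _ _
  · rw [← h12 i hi]; exact Function.update_of_ne (by omega) _ _
  · rw [← h13 i hi]; exact Function.update_of_ne (by omega) _ _
  · by_cases hij : i = j
    · subst hij; simp
    · dsimp only; rw [Function.update_of_ne (by omega), Function.update_of_ne hij]; exact h14 i hi

theorem Rep.setTape (h : Rep xs k lo τ σ s) (j : ℕ) (b : Bool) :
    Rep xs k lo (Function.update τ j b) σ
      ⟨s.reg, Function.update s.mem (xs.length + (j : ℤ)) (b.toNat : ℤ)⟩ := by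
  obtain ⟨h1, h2, h3, h4, h5, h6, h7, h8, h9, h10, h11, h12, h13, h14⟩ := h
  refine ⟨h1, h2, h3, h4, h5, h6, h7, h8, fun i hi => ?_, fun i => ?_, fun i hi => ?_,
    fun i hi => ?_, fun i hi => ?_, fun i hi => ?_⟩
  · rw [← h9 i hi]; exact Function.update_of_ne (by omega) _ _
  · by_cases hij : i = j
    · subst hij; simp
    · dsimp only; rw [Function.update_of_ne (by omega), Function.update_of_ne hij]; exact h10 i
  · rw [← h11 i hi]; exact Function.update_of_ne (by omega) _ _
  · rw [← h12 i hi]; exact Function.update_of_ne (by omega) _ _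
  · rw [← h13 i hi]; exact Function.update_of_ne (by omega) _ _
  · rw [← h14 i hi]; exact Function.update_of_ne (by omega) _ _

/-- Only the entries of the progressions `j < k` are represented. -/
theorem Rep.congr {σ' : Sweep} (h : Rep xs k lo τ σ s) (hcur : σ'.cur = σ.cur) (htp : σ'.tp = σ.tp)
    (hs : σ'.status = σ.status) (hact : ∀ j < k, σ'.act j = σ.act j)
    (hcnt : ∀ j < k, σ'.cnt j = σ.cnt j) (hfst : ∀ j < k, σ'.fst j = σ.fst j)
    (hdif : ∀ j < k, σ'.dif j = σ.dif j) : Rep xs k lo τ σ' s := by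
  obtain ⟨h1, h2, h3, h4, h5, h6, h7, h8, h9, h10, h11, h12, h13, h14⟩ := h
  exact ⟨h1, h2, h3, h4, h5, hcur ▸ h6, htp ▸ h7, hs ▸ h8, h9, h10,
    fun j hj => by rw [hact j hj, h11 j hj], fun j hj => by rw [hcnt j hj, h12 j hj],
    fun j hj => by rw [hfst j hj, h13 j hj], fun j hj => by rw [hdif j hj, h14 j hj]⟩

end Rep

/-- Compute the next element into register `10`; register `9` tells whether there is one. -/
def findNext : Prog :=
  .seq (.assign 9 (.lit 0)) (.seq (.assign 10 (.lit 0)) (forProg 8 0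
    (.ite (.bin .mul (.bin .lt (.reg 5) (.load (.reg 8)))
        (.bin .add (.bin .eq (.reg 9) (.lit 0)) (.bin .lt (.load (.reg 8)) (.reg 10))))
      (.seq (.assign 10 (.load (.reg 8))) (.assign 9 (.lit 1))) .skip)))

/-- `1` if the progression in register `8` claims the element in register `10`, otherwise `0`. -/
def hitExpr : Expr :=
  .bin .mul (field 1 (.reg 8)) (.bin .add (.bin .eq (field 4 (.reg 8)) (.lit 0))
    (.bin .mul (.bin .lt (.lit 0) (field 4 (.reg 8)))
      (.bin .add
        (.bin .mul (.bin .eq (field 2 (.reg 8)) (.lit 0))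
          (.bin .eq (.bin .mod (.bin .sub (.reg 10) (field 3 (.reg 8))) (field 4 (.reg 8)))
            (.lit 0)))
        (.bin .mul (.bin .lt (.lit 0) (field 2 (.reg 8)))
          (.bin .eq (.reg 10) (.bin .add (field 3 (.reg 8))
            (.bin .mul (field 2 (.reg 8)) (field 4 (.reg 8)))))))))

/-- Compute the number of progressions that claim the element in register `10` into register `11`,
and the sum of their indices into register `12`. -/
def countHits : Prog :=
  .seq (.assign 11 (.lit 0)) (.seq (.assign 12 (.lit 0)) (forProg 8 1
    (.seq (.assign 17 hitExpr) (.seq (.assign 11 (.bin .add (.reg 11) (.reg 17)))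
      (.assign 12 (.bin .add (.reg 12) (.bin .mul (.reg 17) (.reg 8))))))))

/-- Guess the set of active progressions. -/
def readAct : Prog :=
  .seq (forProg 8 1 (.store (adr 1 (.reg 8))
      (.load (.bin .add (.reg 0) (.bin .add (.reg 6) (.reg 8))))))
    (.assign 6 (.bin .add (.reg 6) (.reg 1)))

section

variable {xs : List ℤ} {k G : ℕ} {lo : ℤ} {τ : ℕ → Bool} {σ : Sweep} {s : State}

theorem Big.k_le (hB : Big xs k lo G) : k ≤ G := by have := hB.num; omega

theorem Rep.findNext (hB : Big xs k lo G) (hs : s.Bdd G) (h : Rep xs k lo τ σ s) :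
    Runs G findNext s (2000 * (xs.length + 1)) fun s' => Rep xs k lo τ σ s' ∧
      ((s'.reg 9 = 0 ∧ ∀ y ∈ xs, y ≤ σ.cur) ∨ (s'.reg 9 = 1 ∧ s'.reg 10 ∈ xs ∧
        σ.cur < s'.reg 10 ∧ ∀ y ∈ xs, σ.cur < y → s'.reg 10 ≤ y)) := by
  have h8 := hB.eight
  refine Runs.seq (T₁ := 129) (T₂ := 2000 * (xs.length + 1) - 129)
    (Runs.assign h8 hs (by decide) 0 rfl (by simp) le_rfl ?_) (by omega)
  refine Runs.seq (T₁ := 129) (T₂ := 2000 * (xs.length + 1) - 258)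
    (Runs.assign h8 (hs.update_reg (by simp)) (by decide) 0 rfl (by simp) le_rfl ?_) (by omega)
  refine Runs.forLoop h8 (fun m s' => Rep xs k lo τ σ s' ∧
      ((s'.reg 9 = 0 ∧ ∀ (i : ℕ) (hi : i < xs.length), i < m → xs[i] ≤ σ.cur) ∨
        (s'.reg 9 = 1 ∧ s'.reg 10 ∈ xs ∧ σ.cur < s'.reg 10 ∧
          ∀ (i : ℕ) (hi : i < xs.length), i < m → σ.cur < xs[i] → s'.reg 10 ≤ xs[i])))
    xs.length 387 (by have := hB.size; omega)
    ((hs.update_reg (by simp)).update_reg (by simp)) ?_ (fun m s' h' => h'.1.size) ?_ ?_ (by omega)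
  · refine ⟨((h.reg (by norm_num) _).reg (by norm_num) _).reg (by norm_num) _, Or.inl ⟨?_, ?_⟩⟩
    · simp
    · intro i _ hi; omega
  · rintro m hm s₁ hs₁ ⟨hR, hI⟩ h8m
    have hx := hR.input m hm
    have hxle : (s₁.mem m).natAbs ≤ G := hs₁.2 _
    refine Runs.ite h8 hs₁ (by decide) (T' := 258) (by omega) (fun hne => ?_) (fun hz => ?_)
    · have hc : σ.cur < xs[m] ∧ (s₁.reg 9 = 0 ∨ xs[m] < s₁.reg 10) := by
        simp only [Expr.eval, BinOp.apply, hR.cur, h8m, hx] at hne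
        constructor
        · by_contra hcon; simp [hcon] at hne
        · by_contra hcon; push Not at hcon; simp [hcon.1, not_lt.2 hcon.2] at hne
      refine Runs.seq (T₁ := 129) (T₂ := 129) (Runs.assign h8 hs₁ (by decide) xs[m]
        (by simp [Expr.eval, h8m, hx]) (hx ▸ hxle) le_rfl ?_) le_rfl
      refine Runs.assign h8 (hs₁.update_reg (hx ▸ hxle)) (by decide) 1 rfl (by simp; omega)
        le_rfl ?_
      refine ⟨by simpa using h8m,
        ((hR.reg (by norm_num) _).reg (by norm_num) _).reg (by norm_num) _, Or.inr ?_⟩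
      refine ⟨by simp, by simp, by simpa using hc.1, ?_⟩
      intro i hi him hci
      rcases Nat.lt_succ_iff_lt_or_eq.1 him with him | rfl
      · rcases hI with ⟨h1, h2⟩ | ⟨h1, h2, h3, h4⟩
        · exact absurd (h2 i hi him) (not_le.2 hci)
        · rcases hc.2 with h5 | h5
          · omega
          · simpa using h5.le.trans (h4 i hi him hci)
      · simp
    · have hc : σ.cur < xs[m] → s₁.reg 9 ≠ 0 ∧ s₁.reg 10 ≤ xs[m] := by
        intro hlt
        simp only [Expr.eval, BinOp.apply, hR.cur, h8m, hx, hlt, if_true, one_mul] at hz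
        split_ifs at hz with h1 <;> omega
      refine Runs.skip hs₁ (by norm_num) ⟨h8m, hR.reg (by norm_num) _, ?_⟩
      rcases hI with ⟨h1, h2⟩ | ⟨h1, h2, h3, h4⟩
      · refine Or.inl ⟨by simpa using h1, fun i hi him => ?_⟩
        rcases Nat.lt_succ_iff_lt_or_eq.1 him with him | rfl
        · exact h2 i hi him
        · by_contra hcon
          exact (hc (not_le.1 hcon)).1 h1
      · refine Or.inr ⟨by simpa using h1, by simpa using h2, by simpa using h3, ?_⟩
        intro i hi him hci
        rcases Nat.lt_succ_iff_lt_or_eq.1 him with him | rfl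
        · simpa using h4 i hi him hci
        · simpa using (hc hci).2
  · rintro s' hs' ⟨hR, hI⟩
    refine ⟨hR, hI.imp (fun h1 => ⟨h1.1, fun y hy => ?_⟩)
      fun h1 => ⟨h1.1, h1.2.1, h1.2.2.1, fun y hy hc => ?_⟩⟩
    · obtain ⟨i, hi, rfl⟩ := List.mem_iff_getElem.1 hy
      exact h1.2 i hi hi
    · obtain ⟨i, hi, rfl⟩ := List.mem_iff_getElem.1 hy
      exact h1.2.2.2 i hi hi hc

theorem Rep.eval_hitExpr (h : Rep xs k lo τ σ s) {j : ℕ} (hj : j < k) (h8 : s.reg 8 = j) :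
    hitExpr.eval s = if σ.Hits (s.reg 10) j then 1 else 0 := by
  simp only [hitExpr, Expr.eval, BinOp.apply, eval_field, h8, h.act j hj, h.cnt j hj, h.fst j hj,
    h.dif j hj]
  rcases Bool.eq_false_or_eq_true (σ.act j) with hact | hact
  · by_cases hd : σ.dif j = 0
    · simp [Sweep.Hits, hact, hd]
    · have hd' : 0 < σ.dif j := Nat.pos_of_ne_zero hd
      by_cases hc : σ.cnt j = 0
      · simp [Sweep.Hits, hact, hd, hd', hc]
      · have hc' : 0 < σ.cnt j := Nat.pos_of_ne_zero hc
        simp [Sweep.Hits, hact, hd, hd', hc, hc']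
  · simp [Sweep.Hits, hact]

theorem sum_filter_range_le (p : ℕ → Prop) [DecidablePred p] (m : ℕ) :
    ((Finset.range m).filter p).sum id ≤ m * m := by
  refine (Finset.sum_le_card_nsmul _ _ m fun i hi => ?_).trans ?_
  · exact (Finset.mem_range.1 (Finset.mem_filter.1 hi).1).le
  · rw [smul_eq_mul]
    refine Nat.mul_le_mul_right _ ?_
    simpa using Finset.card_filter_le (Finset.range m) p

theorem Rep.countHits (hB : Big xs k lo G) (hs : s.Bdd G) (h : Rep xs k lo τ σ s) :
    Runs G countHits s (2000 * (k + 1)) fun s' => Rep xs k lo τ σ s' ∧ s'.reg 10 = s.reg 10 ∧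
      s'.reg 11 = ((σ.hitSet k (s.reg 10)).card : ℕ) ∧
      s'.reg 12 = ((σ.hitSet k (s.reg 10)).sum id : ℕ) := by
  have h8 := hB.eight
  have hk := hB.num
  refine Runs.seq (T₁ := 129) (T₂ := 2000 * (k + 1) - 129)
    (Runs.assign h8 hs (by decide) 0 rfl (by simp) le_rfl ?_) (by omega)
  refine Runs.seq (T₁ := 129) (T₂ := 2000 * (k + 1) - 258)
    (Runs.assign h8 (hs.update_reg (by simp)) (by decide) 0 rfl (by simp) le_rfl ?_) (by omega)
  refine Runs.forLoop h8 (fun m s' => Rep xs k lo τ σ s' ∧ s'.reg 10 = s.reg 10 ∧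
      s'.reg 11 = (((Finset.range m).filter (σ.Hits (s.reg 10))).card : ℕ) ∧
      s'.reg 12 = (((Finset.range m).filter (σ.Hits (s.reg 10))).sum id : ℕ))
    k 387 hB.k_le
    ((hs.update_reg (by simp)).update_reg (by simp)) ?_ (fun m s' h' => h'.1.num) ?_ ?_ (by omega)
  · exact ⟨((h.reg (by norm_num) _).reg (by norm_num) _).reg (by norm_num) _, by simp, by simp,
      by simp⟩
  · rintro m hm s₁ hs₁ ⟨hR, h10, h11, h12⟩ h8m
    have hev := hR.eval_hitExpr hm h8m
    have hcard : ((Finset.range (m + 1)).filter (σ.Hits (s.reg 10))).card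
        = ((Finset.range m).filter (σ.Hits (s.reg 10))).card
          + if σ.Hits (s.reg 10) m then 1 else 0 := by
      rw [Finset.range_add_one, Finset.filter_insert]
      split_ifs
      · rw [Finset.card_insert_of_notMem (by simp)]
      · rfl
    have hsum : ((Finset.range (m + 1)).filter (σ.Hits (s.reg 10))).sum id
        = ((Finset.range m).filter (σ.Hits (s.reg 10))).sum id
          + if σ.Hits (s.reg 10) m then m else 0 := by
      rw [Finset.range_add_one, Finset.filter_insert]
      split_ifs
      · rw [Finset.sum_insert (by simp), add_comm, id]
      · rfl
    have hc1 := Finset.card_filter_le (Finset.range (m + 1)) (σ.Hits (s.reg 10))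
    rw [Finset.card_range] at hc1
    have hc2 := sum_filter_range_le (σ.Hits (s.reg 10)) (m + 1)
    have hc3 : (m + 1) * (m + 1) ≤ k * k := Nat.mul_le_mul hm hm
    rw [h10] at hev
    refine Runs.seq (T₁ := 129) (T₂ := 258) (Runs.assign h8 hs₁ (by decide) _ hev
      (by split_ifs <;> simp; omega) le_rfl ?_) le_rfl
    refine Runs.seq (T₁ := 129) (T₂ := 129) (Runs.assign h8
      (hs₁.update_reg (by split_ifs <;> simp; omega)) (by decide)
      (((Finset.range (m + 1)).filter (σ.Hits (s.reg 10))).card : ℕ) ?_ (by simp; omega)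
      le_rfl ?_) le_rfl
    · simp only [Expr.eval, BinOp.apply, Function.update_self,
        Function.update_of_ne (show (11 : ℕ) ≠ 17 by norm_num), h11, hcard]
      split_ifs <;> simp
    refine Runs.assign h8 ((hs₁.update_reg (by split_ifs <;> simp; omega)).update_reg
      (by simp; omega)) (by decide)
      (((Finset.range (m + 1)).filter (σ.Hits (s.reg 10))).sum id : ℕ) ?_
      (by rw [Int.natAbs_natCast]; omega) le_rfl ?_
    · simp only [Expr.eval, BinOp.apply, Function.update_self,
        Function.update_of_ne (show (12 : ℕ) ≠ 11 by norm_num),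
        Function.update_of_ne (show (12 : ℕ) ≠ 17 by norm_num),
        Function.update_of_ne (show (17 : ℕ) ≠ 11 by norm_num),
        Function.update_of_ne (show (8 : ℕ) ≠ 11 by norm_num),
        Function.update_of_ne (show (8 : ℕ) ≠ 17 by norm_num), h12, h8m, hsum]
      split_ifs <;> simp
    refine ⟨by simpa using h8m, (((hR.reg (by norm_num) _).reg (by norm_num) _).reg
      (by norm_num) _).reg (by norm_num) _, by simpa using h10, by simp, by simp⟩
  · rintro s' hs' ⟨hR, h10, h11, h12⟩
    exact ⟨hR, h10, h11, h12⟩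

theorem Rep.readAct (hB : Big xs k lo G) (hs : s.Bdd G) (h : Rep xs k lo τ σ s)
    (htp : σ.tp + k ≤ G) :
    Runs G readAct s (2000 * (k + 1)) fun s' => Rep xs k lo τ (σ.readAct k τ) s' ∧
      s'.reg 10 = s.reg 10 := by
  have h8 := hB.eight
  refine Runs.seq (T₁ := 2000 * (k + 1) - 129) (T₂ := 129) ?_ (by omega)
  refine Runs.forLoop h8 (fun m s' => Rep xs k lo τ
      { σ with act := fun j => if j < m then τ (σ.tp + j) else σ.act j } s' ∧
      s'.reg 10 = s.reg 10) k 257 hB.k_le hs ?_ (fun m s' h' => h'.1.num) ?_ ?_ (by omega)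
  · exact ⟨h.reg (by norm_num) _, by simp⟩
  · rintro m hm s₁ hs₁ ⟨hR, h10⟩ h8m
    refine Runs.store h8 hs₁ (by decide) (by decide) (-1 - 4 * (m : ℤ)) ((τ (σ.tp + m)).toNat : ℤ)
      (by simp [Expr.eval, h8m]) ?_ ?_ le_rfl ⟨h8m, ?_, by simpa using h10⟩
    · rw [← hR.tape (σ.tp + m)]
      simp [Expr.eval, BinOp.apply, hR.size, hR.tp, h8m]
    · cases τ (σ.tp + m) <;> simp; omega
    · refine ((hR.setAct m (τ (σ.tp + m))).reg (by norm_num) _).congr rfl rfl rfl ?_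
        (fun _ _ => rfl) (fun _ _ => rfl) (fun _ _ => rfl)
      intro j hj
      by_cases hjm : j = m
      · subst hjm; simp
      · have : j < m + 1 ↔ j < m := by omega
        simp [hjm, this]
  · rintro s₁ hs₁ ⟨hR, h10⟩
    refine Runs.assign h8 hs₁ (by decide) ((σ.tp + k : ℕ) : ℤ)
      (by simp [Expr.eval, BinOp.apply, hR.tp, hR.num]) (by rw [Int.natAbs_natCast]; omega) le_rfl
      ⟨(hR.setTp (σ.tp + k)).congr rfl rfl rfl (fun j hj => ?_) (fun _ _ => rfl)
        (fun _ _ => rfl) (fun _ _ => rfl), by simpa using h10⟩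
    simp [Sweep.readAct, hj]

end

end WordRAM

namespace WordRAM

/-- Compute the difference selected by the guessed bits into register `13`, where the registers
`10` and `12` hold the element `x` and the index of its progression. -/
def chooseDif : Prog :=
  .seq (.assign 13 (.bin .sub (.reg 10) (field 3 (.reg 12)))) (forProg 8 1
    (.ite (.bin .mul (.load (.bin .add (.reg 0) (.bin .add (.reg 6) (.reg 8)))) (field 4 (.reg 8)))
      (.assign 13 (field 4 (.reg 8))) .skip))

/-- Read two numbers from the tape of guesses into the registers `14` and `15`. -/
def readNums : Prog :=
  .seq (.assign 14 (.lit 0)) (.seq (.assign 15 (.lit 0)) (forProg 8 4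
    (.seq (.assign 14 (.bin .mod (.bin .add (.bin .mul (.lit 2) (.reg 14))
        (.load (.bin .add (.reg 0) (.bin .add (.bin .add (.reg 6) (.reg 1)) (.reg 8)))))
        (.bin .add (.reg 0) (.lit 1))))
      (.assign 15 (.bin .mod (.bin .add (.bin .mul (.lit 2) (.reg 15))
        (.load (.bin .add (.reg 0) (.bin .add (.bin .add (.bin .add (.reg 6) (.reg 1)) (.reg 4))
          (.reg 8))))) (.bin .add (.reg 0) (.lit 1)))))))

/-- Empty and deactivate all progressions. -/
def clear : Prog :=
  forProg 8 1 (.seq (.store (adr 1 (.reg 8)) (.lit 0)) (.store (adr 2 (.reg 8)) (.lit 0)))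

/-- Guess the difference of the progression in register `12`, whose second element is in register
`10`, and start the sweep again. -/
def learn : Prog :=
  .seq chooseDif (.seq readNums
    (.seq (.assign 17 (.bin .mod (.bin .div (.bin .mul (.reg 14) (.reg 13)) (.reg 15))
        (.bin .add (.bin .sub (.reg 10) (field 3 (.reg 12))) (.lit 1))))
      (.seq (.store (adr 4 (.reg 12)) (.reg 17))
        (.seq (.assign 7 (.bin .mul (.lit 2) (.bin .eq (.reg 17) (.lit 0))))
          (.seq (.assign 6 (.bin .add (.reg 6) (.bin .add (.reg 1)
              (.bin .mul (.lit 2) (.reg 4)))))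
            (.seq (.assign 5 (.reg 2)) clear))))))

/-- Append the element in register `10` to the progression in register `12`. -/
def take : Prog :=
  .seq (.ite (.bin .eq (field 2 (.reg 12)) (.lit 0)) (.store (adr 3 (.reg 12)) (.reg 10)) .skip)
    (.seq (.store (adr 1 (.reg 12)) (.bin .lt (.lit 0) (field 4 (.reg 12))))
      (.seq (.store (adr 2 (.reg 12)) (.bin .add (field 2 (.reg 12)) (.lit 1)))
        (.assign 5 (.reg 10))))

/-- Give the element in register `10` to the progression in register `12`. -/
def place : Prog :=
  .ite (.bin .mul (.bin .eq (field 4 (.reg 12)) (.lit 0)) (.bin .lt (.lit 0) (field 2 (.reg 12))))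
    learn take

/-- Treat the next element of the input. -/
def step : Prog :=
  .seq findNext (.ite (.reg 9)
    (.seq countHits (.seq (.ite (.bin .eq (.reg 11) (.lit 1)) .skip (.seq readAct countHits))
      (.ite (.bin .eq (.reg 11) (.lit 1)) place (.assign 7 (.lit 2)))))
    (.assign 7 (.lit 1)))

section

variable {xs : List ℤ} {k G : ℕ} {lo : ℤ} {τ : ℕ → Bool} {σ : Sweep} {s : State}

theorem Rep.chooseDif (hB : Big xs k lo G) (hs : s.Bdd G) (h : Rep xs k lo τ σ s) {x : ℤ} {j : ℕ}
    (hj : j < k) (h10 : s.reg 10 = x) (h12 : s.reg 12 = j) (hx : σ.fst j ≤ x)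
    (hxG : (x - σ.fst j).natAbs ≤ G) :
    Runs G chooseDif s (2000 * (k + 1)) fun s' => Rep xs k lo τ σ s' ∧ s'.reg 10 = x ∧
      s'.reg 12 = j ∧ s'.reg 13 = (Sweep.chosenDif τ σ (x - σ.fst j).toNat k : ℕ) := by
  have h8 := hB.eight
  refine Runs.assignThen h8 hs (by decide) ((x - σ.fst j).toNat : ℤ) ?_ (by omega) (by omega)
    fun hs => ?_
  · rw [Int.toNat_of_nonneg (by omega)]
    simp [Expr.eval, BinOp.apply, h10, h12, h.fst j hj]
  refine Runs.forLoop h8 (fun m s' => Rep xs k lo τ σ s' ∧ s'.reg 10 = x ∧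
      s'.reg 12 = j ∧ s'.reg 13 = (Sweep.chosenDif τ σ (x - σ.fst j).toNat m : ℕ))
    k 258 hB.k_le hs ?_ (fun m s' h' => h'.1.num) ?_ (fun s' _ h' => h') (by omega)
  · exact ⟨(h.reg (by norm_num) _).reg (by norm_num) _, by simpa using h10, by simpa using h12,
      by simp [Sweep.chosenDif]⟩
  · rintro m hm s₁ hs₁ ⟨hR, h10, h12, h13⟩ h8m
    have hev : (Expr.bin .mul (.load (.bin .add (.reg 0) (.bin .add (.reg 6) (.reg 8))))
        (field 4 (.reg 8))).eval s₁ = (τ (σ.tp + m)).toNat * (σ.dif m : ℤ) := by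
      rw [← hR.tape (σ.tp + m), ← hR.dif m hm]
      simp [Expr.eval, BinOp.apply, hR.size, hR.tp, h8m]
    refine Runs.ite h8 hs₁ (by decide) (T' := 129) (by omega) (fun hne => ?_) (fun hz => ?_)
    · refine Runs.assign h8 hs₁ (by decide) (σ.dif m) (by simp [Expr.eval, h8m, hR.dif m hm])
        (hR.dif m hm ▸ hs₁.2 _) le_rfl ⟨by simpa using h8m,
          (hR.reg (by norm_num) _).reg (by norm_num) _, by simpa using h10, by simpa using h12, ?_⟩
      rw [hev] at hne
      have : τ (σ.tp + m) = true ∧ σ.dif m ≠ 0 := by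
        cases ht : τ (σ.tp + m) <;> simp_all
      simp [Sweep.chosenDif, this]
    · refine Runs.skip hs₁ (by omega) ⟨h8m, hR.reg (by norm_num) _, by simpa using h10,
        by simpa using h12, ?_⟩
      rw [hev] at hz
      have : ¬ (τ (σ.tp + m) = true ∧ σ.dif m ≠ 0) := by
        rintro ⟨h1, h2⟩
        simp [h1, h2] at hz
      simp [Sweep.chosenDif, this, h13]

theorem Rep.readNums (hB : Big xs k lo G) (hs : s.Bdd G) (h : Rep xs k lo τ σ s) {x v j : ℤ}
    (h10 : s.reg 10 = x) (h12 : s.reg 12 = j) (h13 : s.reg 13 = v) :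
    Runs G readNums s (6000 * (k + 1)) fun s' => Rep xs k lo τ σ s' ∧ s'.reg 10 = x ∧
      s'.reg 12 = j ∧ s'.reg 13 = v ∧
      s'.reg 14 = (Sweep.readNum τ xs.length (σ.tp + k) (Sweep.digits k) : ℕ) ∧
      s'.reg 15 = (Sweep.readNum τ xs.length (σ.tp + k + Sweep.digits k) (Sweep.digits k) : ℕ) := by
  have h8 := hB.eight
  have hn := hB.size
  have hd : Sweep.digits k = 4 * k + 4 := rfl
  refine Runs.assignThen h8 hs (by decide) 0 rfl (by simp) (by omega) fun hs => ?_
  refine Runs.assignThen h8 hs (by decide) 0 rfl (by simp) (by omega) fun hs => ?_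
  refine Runs.forLoop h8 (fun m s' => Rep xs k lo τ σ s' ∧ s'.reg 10 = x ∧
      s'.reg 12 = j ∧ s'.reg 13 = v ∧
      s'.reg 14 = (Sweep.readNum τ xs.length (σ.tp + k) m : ℕ) ∧
      s'.reg 15 = (Sweep.readNum τ xs.length (σ.tp + k + Sweep.digits k) m : ℕ))
    (Sweep.digits k) 258 hB.digits hs ?_ (fun m s' h' => h'.1.digits) ?_ (fun s' _ h' => h')
    (by omega)
  · exact ⟨((h.reg (by norm_num) _).reg (by norm_num) _).reg (by norm_num) _, by simpa using h10,
      by simpa using h12, by simpa using h13, by simp [Sweep.readNum], by simp [Sweep.readNum]⟩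
  · rintro m hm s₁ hs₁ ⟨hR, h10, h12, h13, h14, h15⟩ h8m
    have hread : ∀ p : ℕ, (Sweep.readNum τ xs.length p (m + 1) : ℤ)
        = (2 * Sweep.readNum τ xs.length p m + s₁.mem (xs.length + ((p + m : ℕ) : ℤ)))
          % (xs.length + 1) := by
      intro p
      rw [hR.tape, Sweep.readNum]
      push_cast
      rfl
    have hle : ∀ p, ((Sweep.readNum τ xs.length p (m + 1) : ℕ) : ℤ).natAbs ≤ G := fun p => by
      have := Sweep.readNum_le τ xs.length p (m + 1)
      omega
    refine Runs.assignThen h8 hs₁ (by decide) _ ?_ (hle (σ.tp + k)) (by omega) fun hs₂ => ?_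
    · rw [hread]
      simp [Expr.eval, BinOp.apply, hR.size, hR.tp, hR.num, h8m, h14]
    refine Runs.assign h8 hs₂ (by decide) _ ?_ (hle (σ.tp + k + Sweep.digits k)) (by omega)
      ⟨by simpa using h8m, ((hR.reg (by norm_num) _).reg (by norm_num) _).reg (by norm_num) _,
        by simpa using h10, by simpa using h12, by simpa using h13, by simp, by simp⟩
    rw [hread (σ.tp + k + Sweep.digits k)]
    simp [Expr.eval, BinOp.apply, hR.size, hR.tp, hR.num, hR.digits, h8m, h15]

theorem Rep.clear (hB : Big xs k lo G) (hs : s.Bdd G) (h : Rep xs k lo τ σ s) :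
    Runs G clear s (2000 * (k + 1))
      (Rep xs k lo τ { σ with act := fun _ => false, cnt := fun _ => 0 }) := by
  have h8 := hB.eight
  refine Runs.forLoop h8 (fun m => Rep xs k lo τ
      { σ with
        act := fun j => if j < m then false else σ.act j
        cnt := fun j => if j < m then 0 else σ.cnt j })
    k 514 hB.k_le hs ?_ (fun m s' h' => h'.num) ?_ (fun s' _ h' => ?_) (by omega)
  · simpa using h.reg (le_refl 8) 0
  · rintro m hm s₁ hs₁ hR h8m
    refine Runs.storeThen h8 hs₁ (by decide) (by decide) (-1 - 4 * (m : ℤ)) 0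
      (by simp [Expr.eval, h8m]) rfl (by simp) (by omega) fun hs₂ => ?_
    refine Runs.store h8 hs₂ (by decide) (by decide) (-2 - 4 * (m : ℤ)) 0
      (by simp [Expr.eval, h8m]) rfl (by simp) (by omega) ⟨h8m, ?_⟩
    refine (((hR.setAct m false).setCnt m 0).reg (by norm_num) _).congr rfl rfl rfl
      (fun j _ => ?_) (fun j _ => ?_) (fun _ _ => rfl) (fun _ _ => rfl)
    · by_cases hjm : j = m
      · subst hjm; simp
      · have : j < m + 1 ↔ j < m := by omega
        simp [hjm, this]
    · by_cases hjm : j = m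
      · subst hjm; simp
      · have : j < m + 1 ↔ j < m := by omega
        simp [hjm, this]
  · exact h'.congr rfl rfl rfl (fun j hj => by simp [hj]) (fun j hj => by simp [hj])
      (fun _ _ => rfl) (fun _ _ => rfl)

theorem Rep.learn (hB : Big xs k lo G) (hs : s.Bdd G) (h : Rep xs k lo τ σ s) {x : ℤ} {j : ℕ}
    (hj : j < k) (h10 : s.reg 10 = x) (h12 : s.reg 12 = j) (hx : σ.fst j ≤ x)
    (hxG : (x - σ.fst j).natAbs ≤ G) (htp : σ.tp + k + 2 * Sweep.digits k ≤ G) :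
    Runs G learn s (12000 * (k + 1)) (Rep xs k lo τ (σ.learn xs.length k lo τ x j)) := by
  have h8 := hB.eight
  refine Runs.andThen (h.chooseDif hB hs hj h10 h12 hx hxG) (by omega) ?_
  rintro s₁ hs₁ ⟨hR₁, h10, h12, h13⟩
  refine Runs.andThen (hR₁.readNums hB hs₁ h10 h12 h13) (by omega) ?_
  rintro s₂ hs₂ ⟨hR₂, h10, h12, h13, h14, h15⟩
  set d := Sweep.guessedDif xs.length k τ σ x j with hd
  have hdG : (d : ℤ).natAbs ≤ G := by
    have : d < (x - σ.fst j).toNat + 1 := Nat.mod_lt _ (Nat.succ_pos _)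
    omega
  refine Runs.assignThen h8 hs₂ (by decide) d ?_ hdG (by omega) fun hs₃ => ?_
  · rw [hd, Sweep.guessedDif]
    push_cast
    rw [Int.toNat_of_nonneg (show 0 ≤ x - σ.fst j by omega)]
    simp [Expr.eval, BinOp.apply, h10, h12, h13, h14, h15, hR₂.fst j hj]
  refine Runs.storeThen h8 hs₃ (by decide) (by decide) (-4 - 4 * (j : ℤ)) d
    (by simp [Expr.eval, h12]) (by simp [Expr.eval]) hdG (by omega) fun hs₄ => ?_
  refine Runs.assignThen h8 hs₄ (by decide) ((if d = 0 then 2 else 0 : ℕ) : ℤ) ?_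
    (by split_ifs <;> simp; omega) (by omega) fun hs₅ => ?_
  · simp only [Expr.eval, BinOp.apply, Function.update_self]
    split_ifs <;> simp_all
  refine Runs.assignThen h8 hs₅ (by decide) ((σ.tp + k + 2 * Sweep.digits k : ℕ) : ℤ) ?_
    (by rw [Int.natAbs_natCast]; omega) (by omega) fun hs₆ => ?_
  · simp [Expr.eval, BinOp.apply, hR₂.tp, hR₂.num, hR₂.digits, add_assoc]
  refine Runs.assignThen h8 hs₆ (by decide) lo ?_ hB.low (by omega) fun hs₇ => ?_
  · simp [Expr.eval, hR₂.low]
  refine (Rep.clear hB hs₇ (((((hR₂.reg (by norm_num) _).setDif j d).setStatus _).setTp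
    _).setCur lo)).mono (by omega) fun s' _ hR' => ?_
  exact hR'.congr rfl rfl rfl (fun _ _ => rfl) (fun _ _ => rfl) (fun _ _ => rfl) (fun _ _ => rfl)

theorem Rep.take (hB : Big xs k lo G) (hs : s.Bdd G) (h : Rep xs k lo τ σ s) {x : ℤ} {j : ℕ}
    (hj : j < k) (h10 : s.reg 10 = x) (h12 : s.reg 12 = j) (hc : σ.cnt j + 1 ≤ G) :
    Runs G take s 2000 (Rep xs k lo τ (σ.take x j)) := by
  have h8 := hB.eight
  have hxG : x.natAbs ≤ G := h10 ▸ hs.1 _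
  refine Runs.andThen (T₁ := 500) (R := fun s' => Rep xs k lo τ
    { σ with fst := if σ.cnt j = 0 then Function.update σ.fst j x else σ.fst } s' ∧
      s'.reg 10 = x ∧ s'.reg 12 = j) ?_ (by omega) ?_
  · refine Runs.ite h8 hs (by decide) (T' := 257) (by omega) (fun hne => ?_) (fun hz => ?_)
    · have hc0 : σ.cnt j = 0 := by
        by_contra hcon
        simp [Expr.eval, BinOp.apply, h12, h.cnt j hj, hcon] at hne
      refine Runs.store h8 hs (by decide) (by decide) (-3 - 4 * (j : ℤ)) x
        (by simp [Expr.eval, h12]) (by simp [Expr.eval, h10]) hxG le_rfl ⟨?_, h10, h12⟩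
      simpa [hc0] using h.setFst j x
    · have hc0 : σ.cnt j ≠ 0 := by
        intro hcon
        simp [Expr.eval, BinOp.apply, h12, h.cnt j hj, hcon] at hz
      exact Runs.skip hs (by omega) ⟨by simpa [hc0] using h, h10, h12⟩
  rintro s₁ hs₁ ⟨hR, h10, h12⟩
  refine Runs.storeThen h8 hs₁ (by decide) (by decide) (-1 - 4 * (j : ℤ))
    ((decide (σ.dif j ≠ 0)).toNat : ℤ) (by simp [Expr.eval, h12]) ?_ ?_ (by omega) fun hs₂ => ?_
  · simp only [Expr.eval, eval_field, BinOp.apply, h12, hR.dif j hj]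
    by_cases hd : σ.dif j = 0
    · simp [hd]
    · simp [hd, Nat.pos_of_ne_zero hd]
  · cases decide (σ.dif j ≠ 0) <;> simp; omega
  have hR₂ := hR.setAct j (decide (σ.dif j ≠ 0))
  refine Runs.storeThen h8 hs₂ (by decide) (by decide) (-2 - 4 * (j : ℤ))
    ((σ.cnt j + 1 : ℕ) : ℤ) (by simp [Expr.eval, h12]) ?_ (by rw [Int.natAbs_natCast]; omega)
    (by omega) fun hs₃ => ?_
  · have := hR₂.cnt j hj
    simp only [Expr.eval, eval_field, BinOp.apply, h12] at this ⊢
    rw [this]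
    simp
  refine Runs.assign h8 hs₃ (by decide) x (by simpa [Expr.eval] using h10) hxG (by omega) ?_
  exact ((hR₂.setCnt j (σ.cnt j + 1)).setCur x).congr rfl rfl rfl (fun _ _ => rfl)
    (fun _ _ => rfl) (fun _ _ => rfl) (fun _ _ => rfl)

theorem Rep.place (hB : Big xs k lo G) (hs : s.Bdd G) (h : Rep xs k lo τ σ s) {x : ℤ} {j : ℕ}
    (hj : j < k) (h10 : s.reg 10 = x) (h12 : s.reg 12 = j) (hc : σ.cnt j + 1 ≤ G)
    (hx : σ.cnt j ≠ 0 → σ.fst j ≤ x ∧ (x - σ.fst j).natAbs ≤ G)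
    (htp : σ.tp + k + 2 * Sweep.digits k ≤ G) :
    Runs G place s (13000 * (k + 1)) (Rep xs k lo τ (σ.place xs.length k lo τ x j)) := by
  have h8 := hB.eight
  refine Runs.ite h8 hs (by decide) (T' := 12000 * (k + 1)) (by omega) (fun hne => ?_)
    (fun hz => ?_)
  · have hl : σ.dif j = 0 ∧ σ.cnt j ≠ 0 := by
      simp only [Expr.eval, eval_field, BinOp.apply, h12, h.dif j hj, h.cnt j hj] at hne
      split_ifs at hne <;> omega
    rw [Sweep.place, if_pos hl]
    exact h.learn hB hs hj h10 h12 (hx hl.2).1 (hx hl.2).2 htp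
  · have hl : ¬ (σ.dif j = 0 ∧ σ.cnt j ≠ 0) := by
      simp only [Expr.eval, eval_field, BinOp.apply, h12, h.dif j hj, h.cnt j hj] at hz
      split_ifs at hz <;> omega
    rw [Sweep.place, if_neg hl]
    exact (h.take hB hs hj h10 h12 hc).mono (by omega) fun _ _ h => h

/-- One step of the sweep. The hypotheses on `σ` say that it is reachable. -/
theorem Rep.step (hB : Big xs k lo G) (hxs : xs.Nodup) (hs : s.Bdd G) (h : Rep xs k lo τ σ s)
    (hσ : σ.Valid xs.toFinset k lo) (hst : σ.status = 0)
    (htp : σ.tp + (2 * k + 2 * Sweep.digits k) ≤ G) :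
    Runs G step s (30000 * (xs.length + k + 1))
      (Rep xs k lo τ (σ.step xs.toFinset k lo τ)) := by
  have h8 := hB.eight
  have hcard : xs.toFinset.card = xs.length := List.toFinset_card_of_nodup hxs
  refine Runs.andThen (h.findNext hB hs) (by omega) ?_
  rintro s₁ hs₁ ⟨hR, hI⟩
  refine Runs.ite h8 hs₁ (by decide) (T' := 30000 * (xs.length + k + 1) - 2000 * (xs.length + 1)
    - 129) (by omega) (fun hne => ?_) (fun hz => ?_)
  swap
  · have h9 : s₁.reg 9 = 0 := hz
    have hall : ∀ y ∈ xs.toFinset, y ≤ σ.cur := by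
      rcases hI with hI | hI
      · intro y hy; exact hI.2 y (List.mem_toFinset.1 hy)
      · omega
    rw [Sweep.step_eq_done hst hall]
    exact Runs.assign h8 hs₁ (by decide) (1 : ℕ) rfl (by simp; omega) (by omega) (hR.setStatus 1)
  have h9 : s₁.reg 9 ≠ 0 := hne
  obtain ⟨hx, hcx, hnext⟩ : s₁.reg 10 ∈ xs ∧ σ.cur < s₁.reg 10 ∧
      ∀ y ∈ xs, σ.cur < y → s₁.reg 10 ≤ y := by
    rcases hI with hI | hI
    · exact absurd hI.1 h9
    · exact hI.2
  obtain ⟨x, hx10⟩ : ∃ x, s₁.reg 10 = x := ⟨_, rfl⟩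
  rw [hx10] at hx hcx hnext
  rw [Sweep.step_eq_settle hst (List.mem_toFinset.2 hx) hcx
    fun y hy => hnext y (List.mem_toFinset.1 hy), hcard]
  refine Runs.andThen (hR.countHits hB hs₁) (by omega) ?_
  rintro s₂ hs₂ ⟨hR₂, h10, h11, h12⟩
  rw [hx10] at h10 h11 h12
  refine Runs.andThen (T₁ := 4000 * (k + 1) + 129)
    (R := fun s' => Rep xs k lo τ (σ.refresh k τ x) s' ∧ s'.reg 10 = x ∧
      s'.reg 11 = (((σ.refresh k τ x).hitSet k x).card : ℕ) ∧
      s'.reg 12 = (((σ.refresh k τ x).hitSet k x).sum id : ℕ)) ?_ (by omega) ?_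
  · refine Runs.ite h8 hs₂ (by decide) (T' := 4000 * (k + 1)) (by omega) (fun hne => ?_)
      (fun hz => ?_)
    · have h1 : (σ.hitSet k x).card = 1 := by
        by_contra hcon
        have : ¬ (((σ.hitSet k x).card : ℕ) : ℤ) = 1 := by exact_mod_cast hcon
        simp [Expr.eval, BinOp.apply, h11, this] at hne
      rw [Sweep.refresh, if_pos h1]
      exact Runs.skip hs₂ (by omega) ⟨hR₂, h10, h11, h12⟩
    · have h1 : (σ.hitSet k x).card ≠ 1 := by
        intro hcon
        simp [Expr.eval, BinOp.apply, h11, hcon] at hz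
      rw [Sweep.refresh, if_neg h1]
      refine Runs.andThen (hR₂.readAct hB hs₂ (by omega)) (by omega) ?_
      rintro s₃ hs₃ ⟨hR₃, h10'⟩
      refine (hR₃.countHits hB hs₃).mono (by omega) ?_
      rintro s₄ hs₄ ⟨hR₄, e10, e11, e12⟩
      rw [h10', h10] at e10 e11 e12
      exact ⟨hR₄, e10, e11, e12⟩
  rintro s₃ hs₃ ⟨hR₃, h10, h11, h12⟩
  have hσ' := hσ.refresh τ x
  have htp' := Sweep.refresh_tp_le k τ σ x
  have hcur' := Sweep.refresh_cur k τ σ x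
  generalize σ.refresh k τ x = σ' at *
  refine Runs.ite h8 hs₃ (by decide) (T' := 13000 * (k + 1)) (by omega) (fun hne => ?_)
    (fun hz => ?_)
  · have h1 : (σ'.hitSet k x).card = 1 := by
      by_contra hcon
      have : ¬ (((σ'.hitSet k x).card : ℕ) : ℤ) = 1 := by exact_mod_cast hcon
      simp [Expr.eval, BinOp.apply, h11, this] at hne
    rw [Sweep.settle, if_pos h1]
    have hj := (Sweep.hitSet_card_eq_one h1).1
    refine hR₃.place hB hs₃ hj h10 h12 ?_ (fun hc => ?_) (by omega)
    · have h1 := hσ'.cnt_le hj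
      have h2 := Finset.card_filter_le xs.toFinset (· ≤ σ'.cur)
      have := hB.size
      omega
    · have hf := hσ'.fst_mem hj hc
      have e1 := hB.elem _ hx
      have e2 := hB.elem _ (List.mem_toFinset.1 hf.1)
      exact ⟨by omega, by omega⟩
  · have h1 : (σ'.hitSet k x).card ≠ 1 := by
      intro hcon
      simp [Expr.eval, BinOp.apply, h11, hcon] at hz
    rw [Sweep.settle, if_neg h1]
    exact Runs.assign h8 hs₃ (by decide) (2 : ℕ) rfl (by simp; omega) (by omega) (hR₃.setStatus 2)

/-- Initialize the state of a sweep and sweep until success or failure. -/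
def attempt : Prog :=
  .seq (.assign 6 (.lit 0)) (.seq (.assign 7 (.lit 0)) (.seq (.assign 5 (.reg 2))
    (.seq (forProg 8 1 (.seq (.store (adr 1 (.reg 8)) (.lit 0)) (.seq
        (.store (adr 2 (.reg 8)) (.lit 0)) (.seq (.store (adr 3 (.reg 8)) (.lit 0))
          (.store (adr 4 (.reg 8)) (.lit 0))))))
      (.loop (.bin .eq (.reg 7) (.lit 0)) step))))

/-- The initialization in `attempt`, followed by an arbitrary program. -/
theorem Rep.reset (hB : Big xs k lo G) (hs : s.Bdd G) (h : Rep xs k lo τ σ s) {T : ℕ}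
    {Q : State → Prop} {P : Prog} (hT : 3000 * (k + 1) ≤ T)
    (hP : ∀ s', s'.Bdd G → Rep xs k lo τ (Sweep.init lo) s' →
      Runs G P s' (T - 3000 * (k + 1)) Q) :
    Runs G (.seq (.assign 6 (.lit 0)) (.seq (.assign 7 (.lit 0)) (.seq (.assign 5 (.reg 2))
    (.seq (forProg 8 1 (.seq (.store (adr 1 (.reg 8)) (.lit 0)) (.seq
        (.store (adr 2 (.reg 8)) (.lit 0)) (.seq (.store (adr 3 (.reg 8)) (.lit 0))
          (.store (adr 4 (.reg 8)) (.lit 0)))))) P)))) s T Q := by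
  have h8 := hB.eight
  refine Runs.assignThen h8 hs (by decide) (0 : ℕ) rfl (by simp) (by omega) fun hs₁ => ?_
  refine Runs.assignThen h8 hs₁ (by decide) (0 : ℕ) rfl (by simp) (by omega) fun hs₂ => ?_
  refine Runs.assignThen h8 hs₂ (by decide) lo (by simp [Expr.eval, h.low]) hB.low (by omega)
    fun hs₃ => ?_
  have hR := ((h.setTp 0).setStatus 0).setCur lo
  refine Runs.andThen (T₁ := (k + 1) * 2000 + 129) (Runs.forLoop (Q := Rep xs k lo τ
      (Sweep.init lo)) h8 (fun m => Rep xs k lo τ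
      { Sweep.init lo with
        act := fun j => if j < m then false else σ.act j
        cnt := fun j => if j < m then 0 else σ.cnt j
        fst := fun j => if j < m then 0 else σ.fst j
        dif := fun j => if j < m then 0 else σ.dif j })
    k 1028 hB.k_le hs₃ ?_ (fun m s' h' => h'.num) ?_ (fun s' _ h' => ?_) (by omega)) (by omega) ?_
  · simpa [Sweep.init] using hR.reg (le_refl 8) 0
  · rintro m hm s₁ hs₁ hR h8m
    refine Runs.storeThen h8 hs₁ (by decide) (by decide) (-1 - 4 * (m : ℤ)) 0
      (by simp [Expr.eval, h8m]) rfl (by simp) (by omega) fun hs₂ => ?_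
    refine Runs.storeThen h8 hs₂ (by decide) (by decide) (-2 - 4 * (m : ℤ)) 0
      (by simp [Expr.eval, h8m]) rfl (by simp) (by omega) fun hs₃ => ?_
    refine Runs.storeThen h8 hs₃ (by decide) (by decide) (-3 - 4 * (m : ℤ)) 0
      (by simp [Expr.eval, h8m]) rfl (by simp) (by omega) fun hs₄ => ?_
    refine Runs.store h8 hs₄ (by decide) (by decide) (-4 - 4 * (m : ℤ)) 0
      (by simp [Expr.eval, h8m]) rfl (by simp) (by omega) ⟨h8m, ?_⟩
    refine (((((hR.setAct m false).setCnt m 0).setFst m 0).setDif m 0).reg (by norm_num) _).congr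
      rfl rfl rfl (fun j _ => ?_) (fun j _ => ?_) (fun j _ => ?_) (fun j _ => ?_)
    all_goals
      by_cases hjm : j = m
      · subst hjm; simp
      · have : j < m + 1 ↔ j < m := by omega
        simp [hjm, this]
  · exact h'.congr rfl rfl rfl (fun j hj => by simp [hj, Sweep.init])
      (fun j hj => by simp [hj, Sweep.init]) (fun j hj => by simp [hj, Sweep.init])
      (fun j hj => by simp [hj, Sweep.init])
  · intro s' hs' hR'
    exact (hP s' hs' hR').mono (by omega) fun _ _ h => h

theorem Rep.attempt (hB : Big xs k lo G) (hxs : xs.Nodup) (hlo : ∀ y ∈ xs, lo < y) (hs : s.Bdd G)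
    (h : Rep xs k lo τ σ s) :
    Runs G attempt s (61000 * (xs.length + k + 1) * (k + 1) * (xs.length + 1) + 3000 * (k + 1))
      fun s' => ∃ σ', Rep xs k lo τ σ' s' ∧ σ'.Final xs.toFinset k lo τ := by
  have h8 := hB.eight
  have hlo' : ∀ y ∈ xs.toFinset, lo < y := fun y hy => hlo y (List.mem_toFinset.1 hy)
  have hcard : xs.toFinset.card = xs.length := List.toFinset_card_of_nodup hxs
  refine h.reset hB hs (by omega) fun s₁ hs₁ hR₁ => ?_
  have hrem := Sweep.remaining_le xs.toFinset k (Sweep.init lo)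
  rw [hcard] at hrem
  set R := k * (xs.length + 1) + xs.length with hRdef
  refine Runs.loop (ι := Sweep) h8 (by decide) (fun σ' s' => Rep xs k lo τ σ' s' ∧
      σ'.Valid xs.toFinset k lo ∧ ∃ m, σ' = ((Sweep.step xs.toFinset k lo τ)^[m] (Sweep.init lo)) ∧
        (σ'.status = 0 → Sweep.remaining xs.toFinset k σ' + m ≤ R) ∧
        σ'.tp ≤ m * (2 * k + 2 * Sweep.digits k))
    (fun σ' => if σ'.status = 0 then Sweep.remaining xs.toFinset k σ' + 1 else 0)
    (30000 * (xs.length + k + 1)) ?_ ?_ (Sweep.init lo) hs₁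
    ⟨hR₁, Sweep.Valid.init hlo', 0, rfl, fun _ => by omega, by simp [Sweep.init]⟩ ?_
  · rintro σ' s' hs' ⟨hR', hV, m, hm, hrem', htp⟩ hne
    have hst : σ'.status = 0 := by
      by_contra hcon
      simp [Expr.eval, BinOp.apply, hR'.status, hcon] at hne
    have hrem' := hrem' hst
    refine (hR'.step hB hxs hs' hV hst ?_).mono le_rfl ?_
    · refine le_trans ?_ hB.tp
      have : (m + 1) * (2 * k + 2 * Sweep.digits k) ≤ (R + 1) * (2 * k + 2 * Sweep.digits k) :=
        Nat.mul_le_mul_right _ (by omega)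
      rw [hRdef] at this
      linarith
    · intro s'' _ hR''
      have hlt := Sweep.step_remaining (X := xs.toFinset) (k := k) (lo := lo) τ hst
      refine ⟨_, ?_, hR'', hV.step hlo' τ, m + 1, ?_, ?_, ?_⟩
      · rw [if_pos hst]
        split_ifs with h0
        · have := hlt h0; omega
        · omega
      · rw [Function.iterate_succ_apply', ← hm]
      · intro h0
        have := hlt h0
        omega
      · have := Sweep.step_tp_le xs.toFinset k lo τ σ'
        linarith
  · rintro σ' s' hs' ⟨hR', hV, m, hm, -, -⟩ hz
    refine ⟨σ', hR', fun h0 => ?_, m, hm⟩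
    simp [Expr.eval, BinOp.apply, hR'.status, h0] at hz
  · rw [if_pos (show (Sweep.init lo).status = 0 from rfl)]
    have h1 : (Sweep.remaining xs.toFinset k (Sweep.init lo) + 1 + 1) ≤
        (k + 1) * (xs.length + 1) + 1 := by
      rw [hRdef] at hrem
      nlinarith
    calc _ ≤ ((k + 1) * (xs.length + 1) + 1) * (30000 * (xs.length + k + 1) + 129) :=
          Nat.mul_le_mul_right _ h1
      _ ≤ _ := ?_
    have h2 : 1 ≤ (k + 1) * (xs.length + 1) := Nat.mul_pos (by omega) (by omega)
    have h3 : (k + 1) * (xs.length + 1) + 1 ≤ 2 * ((k + 1) * (xs.length + 1)) := by omega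
    calc _ ≤ 2 * ((k + 1) * (xs.length + 1)) * (30500 * (xs.length + k + 1)) :=
          Nat.mul_le_mul h3 (by omega)
      _ = 61000 * (xs.length + k + 1) * (k + 1) * (xs.length + 1) := by ring
      _ ≤ _ := by omega

end

end WordRAM

/-! ### Running through all tapes -/

namespace Sweep

theorem iterate_step_of_le {X : Finset ℤ} {k : ℕ} {lo : ℤ} {τ : ℕ → Bool} {σ : Sweep} {a b : ℕ}
    (hab : a ≤ b) (h : ((step X k lo τ)^[a] σ).status ≠ 0) :
    (step X k lo τ)^[b] σ = (step X k lo τ)^[a] σ := by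
  induction b, hab using Nat.le_induction with
  | base => rfl
  | succ b _ ih => rw [Function.iterate_succ_apply', ih, step_eq_self h]

theorem Final.unique {X : Finset ℤ} {k : ℕ} {lo : ℤ} {τ : ℕ → Bool} {σ σ' : Sweep}
    (h : σ.Final X k lo τ) (h' : σ'.Final X k lo τ) : σ = σ' := by
  obtain ⟨h1, a, rfl⟩ := h
  obtain ⟨h2, b, rfl⟩ := h'
  rcases le_total a b with hab | hab
  · exact (iterate_step_of_le hab h1).symm
  · exact iterate_step_of_le hab h2

theorem Final.valid {X : Finset ℤ} {k : ℕ} {lo : ℤ} {τ : ℕ → Bool} {σ : Sweep}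
    (h : σ.Final X k lo τ) (hlo : ∀ y ∈ X, lo < y) : σ.Valid X k lo := by
  obtain ⟨-, m, rfl⟩ := h
  induction m with
  | zero => exact Valid.init hlo
  | succ m ih => rw [Function.iterate_succ_apply']; exact ih.step hlo τ

end Sweep

theorem Nat.mod_two_pow_of_testBit {v i : ℕ} (h : ∀ j < i, v.testBit j = true) :
    v % 2 ^ i = 2 ^ i - 1 := by
  refine Nat.eq_of_testBit_eq fun j => ?_
  rw [Nat.testBit_mod_two_pow, Nat.testBit_two_pow_sub_one]
  by_cases hj : j < i
  · simp [hj, h j hj]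
  · simp [hj]

/-- Adding one to a number with a block of `i` ones at the end. -/
theorem Nat.testBit_add_one_of_ones {v i : ℕ} (h : ∀ j < i, v.testBit j = true)
    (hi : v.testBit i = false) (j : ℕ) :
    (v + 1).testBit j = if j < i then false else if j = i then true else v.testBit j := by
  have hmod := Nat.mod_two_pow_of_testBit h
  have hdm := Nat.div_add_mod v (2 ^ i)
  have hpos := Nat.two_pow_pos i
  obtain ⟨b, hb⟩ : ∃ b, v / 2 ^ i = 2 * b := by
    rw [Nat.testBit_eq_decide_div_mod_eq] at hi
    have : v / 2 ^ i % 2 ≠ 1 := of_decide_eq_false hi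
    exact ⟨v / 2 ^ i / 2, by omega⟩
  have hv1 : v + 1 = 2 ^ i * (2 * b + 1) + 0 := by
    rw [← hb, Nat.mul_add]; omega
  by_cases hj : j < i
  · rw [hv1, Nat.testBit_two_pow_mul_add _ hpos]
    simp [hj]
  · rw [if_neg hj]
    obtain ⟨c, rfl⟩ : ∃ c, j = i + c := ⟨j - i, by omega⟩
    rw [hv1, Nat.testBit_two_pow_mul_add _ hpos, if_neg hj, Nat.add_sub_cancel_left]
    rw [← hdm, hb, Nat.testBit_two_pow_mul_add _ (by omega : v % 2 ^ i < 2 ^ i), if_neg hj,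
      Nat.add_sub_cancel_left]
    cases c with
    | zero => simp
    | succ c =>
      rw [if_neg (by omega), Nat.testBit_succ, Nat.testBit_succ]
      congr 1
      omega

namespace WordRAM

/-- Add one to the binary number on the tape; set the status to `0` if it overflows. -/
def increment : Prog :=
  .seq (.assign 8 (.lit 0)) (.seq (.loop
      (.bin .mul (.bin .lt (.reg 8) (.reg 3)) (.load (.bin .add (.reg 0) (.reg 8))))
      (.seq (.store (.bin .add (.reg 0) (.reg 8)) (.lit 0))
        (.assign 8 (.bin .add (.reg 8) (.lit 1)))))
    (.ite (.bin .lt (.reg 8) (.reg 3)) (.store (.bin .add (.reg 0) (.reg 8)) (.lit 1))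
      (.assign 7 (.lit 0))))

/-- Sweep with all tapes until one sweep succeeds; then the status is `1`. If no sweep succeeds, the
status is `0` at the end. -/
def search : Prog :=
  .loop (.bin .lt (.lit 1) (.reg 7)) (.seq attempt (.ite (.bin .eq (.reg 7) (.lit 1)) .skip
    (.seq (.assign 7 (.lit 2)) increment)))

section

variable {xs : List ℤ} {k G : ℕ} {lo : ℤ} {τ : ℕ → Bool} {σ : Sweep} {s : State}

theorem Rep.increment (hB : Big xs k lo G) (hs : s.Bdd G) {v : ℕ} (hv : v < 2 ^ Sweep.tapeBits k)
    (h : Rep xs k lo v.testBit σ s) :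
    Runs G increment s (2000 * (Sweep.tapeBits k + 1)) fun s' =>
      (v + 1 < 2 ^ Sweep.tapeBits k ∧ Rep xs k lo (v + 1).testBit σ s') ∨
      (v + 1 = 2 ^ Sweep.tapeBits k ∧ ∃ τ, Rep xs k lo τ { σ with status := 0 } s') := by
  have h8 := hB.eight
  have hL := hB.bits
  set L := Sweep.tapeBits k
  refine Runs.assignThen h8 hs (by decide) (0 : ℕ) rfl (by simp) (by omega) fun hs₁ => ?_
  refine Runs.andThen (T₁ := (L + 1) * 515) (R := fun s' => ∃ i ≤ L, s'.reg 8 = (i : ℕ) ∧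
      (∀ j < i, v.testBit j = true) ∧ (i < L → v.testBit i = false) ∧
      Rep xs k lo (fun j => if j < i then false else v.testBit j) σ s') ?_ (by omega) ?_
  · refine Runs.loop (ι := ℕ) h8 (by decide) (fun i s' => i ≤ L ∧ s'.reg 8 = (i : ℕ) ∧
      (∀ j < i, v.testBit j = true) ∧
      Rep xs k lo (fun j => if j < i then false else v.testBit j) σ s') (fun i => L - i) 386
      ?_ ?_ 0 hs₁ ⟨Nat.zero_le _, by simp, by simp, by simpa using h.reg (le_refl 8) _⟩ (by simp)
    · rintro i s' hs' ⟨hi, hr, hones, hR⟩ hne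
      have hmem := hR.tape i
      rw [if_neg (lt_irrefl i)] at hmem
      have hlt : i < L ∧ v.testBit i = true := by
        simp only [Expr.eval, BinOp.apply, hr, hR.bits, hR.size, hmem] at hne
        constructor
        · by_contra hcon
          have : ¬ ((i : ℤ) < L) := by exact_mod_cast hcon
          exact hne (by rw [if_neg this, zero_mul])
        · by_contra hcon
          simp [hcon] at hne
      refine Runs.storeThen h8 hs' (by decide) (by decide) (xs.length + (i : ℤ)) 0
        (by simp [Expr.eval, BinOp.apply, hr, hR.size]) rfl (by simp) (by omega) fun hs₂ => ?_
      refine Runs.assign h8 hs₂ (by decide) ((i + 1 : ℕ) : ℤ)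
        (by simp [Expr.eval, BinOp.apply, hr]) (by omega) (by omega)
        ⟨i + 1, by omega, by omega, by simp, ?_, ?_⟩
      · intro j hj
        rcases Nat.lt_succ_iff_lt_or_eq.1 hj with hj | rfl
        · exact hones j hj
        · exact hlt.2
      · have e : (fun j => if j < i + 1 then false else v.testBit j)
            = Function.update (fun j => if j < i then false else v.testBit j) i false := by
          funext j
          by_cases hji : j = i
          · subst hji; simp
          · have : j < i + 1 ↔ j < i := by omega
            simp [hji, this]
        rw [e]
        exact (hR.setTape i false).reg (by norm_num) _
    · rintro i s' hs' ⟨hi, hr, hones, hR⟩ hz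
      refine ⟨i, hi, hr, hones, fun hlt => ?_, hR⟩
      have hmem := hR.tape i
      rw [if_neg (lt_irrefl i)] at hmem
      have hlt' : (i : ℤ) < L := by exact_mod_cast hlt
      simp only [Expr.eval, BinOp.apply, hr, hR.bits, hR.size, hmem] at hz
      rw [if_pos hlt', one_mul] at hz
      cases hb : v.testBit i
      · rfl
      · simp [hb] at hz
  rintro s₂ hs₂ ⟨i, hi, hr, hones, hzero, hR⟩
  refine Runs.ite h8 hs₂ (by decide) (T' := 257) (by omega) (fun hne => ?_) (fun hz => ?_)
  · have hlt : i < L := by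
      by_contra hcon
      have : ¬ ((i : ℤ) < L) := by exact_mod_cast hcon
      simp only [Expr.eval, BinOp.apply, hr, hR.bits] at hne
      exact hne (if_neg this)
    refine Runs.store h8 hs₂ (by decide) (by decide) (xs.length + (i : ℤ)) 1
      (by simp [Expr.eval, BinOp.apply, hr, hR.size]) rfl (by simp; omega) (by omega) (Or.inl ?_)
    have hinc := Nat.testBit_add_one_of_ones hones (hzero hlt)
    constructor
    · refine lt_of_le_of_ne hv fun hcon => ?_
      have := hinc i
      rw [hcon, Nat.testBit_two_pow] at this
      have hLi : L ≠ i := by omega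
      simp [hLi] at this
    · have e : (v + 1).testBit
          = Function.update (fun j => if j < i then false else v.testBit j) i true := by
        funext j
        rw [hinc]
        by_cases hji : j = i
        · subst hji; simp
        · simp [hji]
      rw [e]
      exact hR.setTape i true
  · have hge : i = L := by
      by_contra hcon
      have : ((i : ℤ) < L) := by exact_mod_cast lt_of_le_of_ne hi hcon
      simp only [Expr.eval, BinOp.apply, hr, hR.bits] at hz
      rw [if_pos this] at hz
      omega
    refine Runs.assign h8 hs₂ (by decide) (0 : ℕ) rfl (by simp) (by omega) (Or.inr ⟨?_, _,
      hR.setStatus 0⟩)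
    have hmod := Nat.mod_two_pow_of_testBit hones
    rw [hge, Nat.mod_eq_of_lt hv] at hmod
    have := Nat.two_pow_pos L
    omega

theorem Rep.search (hB : Big xs k lo G) (hxs : xs.Nodup) (hlo : ∀ y ∈ xs, lo < y) (hs : s.Bdd G)
    (h : Rep xs k lo (0 : ℕ).testBit σ s) (hst : σ.status = 2) :
    Runs G search s ((2 ^ Sweep.tapeBits k + 1) * (61000 * (xs.length + k + 1) * (k + 1) *
      (xs.length + 1) + 3000 * (k + 1) + 2000 * (Sweep.tapeBits k + 1) + 1000)) fun s' =>
      ∃ τ σ', Rep xs k lo τ σ' s' ∧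
        ((σ'.status = 1 ∧ σ'.Valid xs.toFinset k lo) ∨
        (σ'.status = 0 ∧ ∀ v < 2 ^ Sweep.tapeBits k, ∀ σ'',
          Sweep.Final xs.toFinset k lo v.testBit σ'' → σ''.status ≠ 1)) := by
  have h8 := hB.eight
  have hlo' : ∀ y ∈ xs.toFinset, lo < y := fun y hy => hlo y (List.mem_toFinset.1 hy)
  set A := 61000 * (xs.length + k + 1) * (k + 1) * (xs.length + 1) + 3000 * (k + 1) with hA
  set L := Sweep.tapeBits k with hL
  refine Runs.loop (ι := ℕ) h8 (by decide) (fun v s' => ∃ τ σ', Rep xs k lo τ σ' s' ∧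
      ((σ'.status = 2 ∧ τ = v.testBit ∧ v < 2 ^ L ∧ ∀ u < v, ∀ σ'',
          Sweep.Final xs.toFinset k lo u.testBit σ'' → σ''.status ≠ 1) ∨
        (σ'.status = 1 ∧ σ'.Valid xs.toFinset k lo) ∨
        (σ'.status = 0 ∧ ∀ v < 2 ^ L, ∀ σ'',
          Sweep.Final xs.toFinset k lo v.testBit σ'' → σ''.status ≠ 1)))
    (fun v => 2 ^ L - v) (A + 2000 * (L + 1) + 300) ?_ ?_ 0 hs ?_ ?_
  · rintro v s₁ hs₁ ⟨τ, σ₁, hR, hI⟩ hne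
    have hst : ¬ σ₁.status ≤ 1 := by
      intro hcon
      have : ¬ ((1 : ℤ) < σ₁.status) := by exact_mod_cast not_lt.2 hcon
      simp only [Expr.eval, BinOp.apply, hR.status] at hne
      exact hne (if_neg this)
    obtain ⟨hst2, rfl, hv, hfail⟩ : σ₁.status = 2 ∧ τ = v.testBit ∧ v < 2 ^ L ∧ ∀ u < v, ∀ σ'',
          Sweep.Final xs.toFinset k lo u.testBit σ'' → σ''.status ≠ 1 := by
      rcases hI with hI | hI | hI
      · exact hI
      · omega
      · omega
    refine Runs.andThen (hR.attempt hB hxs hlo hs₁) (by omega) ?_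
    rintro s₂ hs₂ ⟨σ₂, hR₂, hF⟩
    refine Runs.ite h8 hs₂ (by decide) (T' := 2000 * (L + 1) + 129) (by omega) (fun hne => ?_)
      (fun hz => ?_)
    · have h1 : σ₂.status = 1 := by
        by_contra hcon
        simp [Expr.eval, BinOp.apply, hR₂.status, hcon] at hne
      exact Runs.skip hs₂ (by omega) ⟨v + 1, by omega, _, σ₂, hR₂,
        Or.inr (Or.inl ⟨h1, hF.valid hlo'⟩)⟩
    · have h1 : σ₂.status ≠ 1 := by
        intro hcon
        simp [Expr.eval, BinOp.apply, hR₂.status, hcon] at hz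
      have hfail' : ∀ u < v + 1, ∀ σ'',
          Sweep.Final xs.toFinset k lo u.testBit σ'' → σ''.status ≠ 1 := by
        intro u hu σ'' hF'
        rcases Nat.lt_succ_iff_lt_or_eq.1 hu with hu | rfl
        · exact hfail u hu σ'' hF'
        · rwa [hF'.unique hF]
      refine Runs.assignThen h8 hs₂ (by decide) (2 : ℕ) rfl (by simp; omega) (by omega)
        fun hs₃ => ?_
      refine ((hR₂.setStatus 2).increment hB hs₃ hv).mono (by omega) fun s' _ hs' => ?_
      rcases hs' with ⟨hlt, hR'⟩ | ⟨heq, τ', hR'⟩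
      · exact ⟨v + 1, by omega, _, _, hR', Or.inl ⟨rfl, rfl, hlt, hfail'⟩⟩
      · exact ⟨v + 1, by omega, _, _, hR', Or.inr (Or.inr ⟨rfl, heq ▸ hfail'⟩)⟩
  · rintro v s' hs' ⟨τ, σ', hR, hI⟩ hz
    refine ⟨τ, σ', hR, hI.resolve_left fun h2 => ?_⟩
    simp [Expr.eval, BinOp.apply, hR.status, h2.1] at hz
  · exact ⟨_, σ, h, Or.inl ⟨hst, rfl, Nat.two_pow_pos _, fun u hu => absurd hu (Nat.not_lt_zero u)⟩⟩
  · exact Nat.mul_le_mul le_rfl (by omega)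

end

end WordRAM

/-! ### Filling empty progressions and writing the answer -/

namespace Sweep

/-- Move the first element of progression `r` to the empty progression `i`. -/
def split (σ : Sweep) (i r : ℕ) : Sweep :=
  { σ with
    cnt := Function.update (Function.update σ.cnt i 1) r (σ.cnt r - 1)
    fst := Function.update (Function.update σ.fst i (σ.fst r)) r (σ.fst r + σ.dif r)
    dif := Function.update σ.dif i 0 }

theorem split_elem_same {σ : Sweep} {i r : ℕ} (hir : i ≠ r) (y : ℤ) :
    (σ.split i r).Elem i y ↔ y = σ.fst r := by
  simp [Elem, split, hir]

theorem split_elem_source {σ : Sweep} {i r : ℕ} (hir : i ≠ r) (hr : 1 < σ.cnt r) (y : ℤ) :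
    σ.Elem r y ↔ y = σ.fst r ∨ (σ.split i r).Elem r y := by
  simp only [Elem, split, Function.update_self, Function.update_of_ne hir.symm]
  constructor
  · rintro ⟨m, hm, rfl⟩
    cases m with
    | zero => left; simp
    | succ m => exact Or.inr ⟨m, by omega, by push_cast; ring⟩
  · rintro (rfl | ⟨m, hm, rfl⟩)
    · exact ⟨0, by omega, by simp⟩
    · exact ⟨m + 1, by omega, by push_cast; ring⟩

theorem split_elem_other {σ : Sweep} {i r j : ℕ} (hi : j ≠ i) (hr : j ≠ r) (y : ℤ) :
    (σ.split i r).Elem j y ↔ σ.Elem j y := by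
  simp [Elem, split, hi, hr]

theorem split_not_elem {σ : Sweep} {i r : ℕ} (hir : i ≠ r) (hd : σ.dif r ≠ 0) :
    ¬ (σ.split i r).Elem r (σ.fst r) := by
  simp only [Elem, split, Function.update_self, Function.update_of_ne hir.symm]
  rintro ⟨m, -, h⟩
  have h1 : (0 : ℤ) < σ.dif r := by exact_mod_cast Nat.pos_of_ne_zero hd
  have h2 : 0 ≤ (m : ℤ) * σ.dif r := by positivity
  omega

theorem Valid.split {X : Finset ℤ} {k : ℕ} {lo : ℤ} {σ : Sweep} (h : Valid X k lo σ) {i r : ℕ}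
    (hi : i < k) (hr : r < k) (hci : σ.cnt i = 0) (hcr : 1 < σ.cnt r) :
    Valid X k lo (σ.split i r) := by
  have hir : i ≠ r := by rintro rfl; omega
  have hd : σ.dif r ≠ 0 := fun h0 => by have := h.single r hr h0; omega
  have hno : ∀ y, ¬ σ.Elem i y := fun y ⟨m, hm, _⟩ => by omega
  -- the progression of `σ` from which an element of a progression of the new state stems
  have back : ∀ j y, (σ.split i r).Elem j y → σ.Elem (if j = i then r else j) y := by
    intro j y hj
    split_ifs with hji
    · subst hji
      exact (split_elem_source hir hcr y).2 (Or.inl ((split_elem_same hir y).1 hj))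
    · by_cases hjr : j = r
      · subst hjr; exact (split_elem_source hir hcr y).2 (Or.inr hj)
      · exact (split_elem_other hji hjr y).1 hj
  refine ⟨h.lo_le, fun y => ?_, fun y j j' hj hj' e e' => ?_, fun j hj hd0 => ?_, h.done⟩
  · rw [show (σ.split i r).cur = σ.cur from rfl, ← h.cover y]
    constructor
    · rintro ⟨j, hj, e⟩
      refine ⟨_, ?_, back j y e⟩
      split_ifs <;> assumption
    · rintro ⟨j, hj, e⟩
      by_cases hjr : j = r
      · subst hjr
        rcases (split_elem_source hir hcr y).1 e with e | e
        · exact ⟨i, hi, (split_elem_same hir y).2 e⟩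
        · exact ⟨j, hj, e⟩
      · have hji : j ≠ i := by rintro rfl; exact hno y e
        exact ⟨j, hj, (split_elem_other hji hjr y).2 e⟩
  · have := h.disj y _ _ (by split_ifs <;> assumption) (by split_ifs <;> assumption)
      (back j y e) (back j' y e')
    split_ifs at this with h1 h2 h2
    · rw [h1, h2]
    · subst h1; subst this
      exact absurd ((split_elem_same hir y).1 e ▸ e') (split_not_elem hir hd)
    · subst h2; subst this
      exact absurd ((split_elem_same hir y).1 e' ▸ e) (split_not_elem hir hd)
    · exact this
  · by_cases hji : j = i
    · subst hji; simp [Sweep.split, hir]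
    · have hdj : σ.dif j = 0 := by simpa [Sweep.split, hji] using hd0
      have hjr : j ≠ r := by rintro rfl; exact hd hdj
      simpa [Sweep.split, hji, hjr] using h.single j hj hdj

/-- If `X` has at least `k` elements and one of the progressions is empty, then another one has
two elements. -/
theorem Valid.exists_one_lt_cnt {X : Finset ℤ} {k : ℕ} {lo : ℤ} {σ : Sweep} (h : Valid X k lo σ)
    (hall : ∀ y ∈ X, y ≤ σ.cur) (hk : k ≤ X.card) {i : ℕ} (hi : i < k) (hci : σ.cnt i = 0) :
    ∃ r < k, 1 < σ.cnt r := by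
  by_contra hcon
  push Not at hcon
  have hsub : X ⊆ ((Finset.range k).erase i).image σ.fst := by
    intro y hy
    obtain ⟨j, hj, m, hm, rfl⟩ := (h.cover y).2 ⟨hy, hall y hy⟩
    have := hcon j hj
    obtain rfl : m = 0 := by omega
    have hji : j ≠ i := by rintro rfl; omega
    exact Finset.mem_image.2 ⟨j, by simp [hj, hji], by simp⟩
  have h1 := (Finset.card_le_card hsub).trans Finset.card_image_le
  rw [Finset.card_erase_of_mem (by simpa using hi), Finset.card_range] at h1
  omega

end Sweep

namespace WordRAM

/-- Find a progression with at least two elements. -/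
def findLong : Prog :=
  forProg 18 1 (.ite (.bin .lt (.lit 1) (field 2 (.reg 18))) (.assign 16 (.reg 18)) .skip)

/-- Make all progressions nonempty. -/
def fill : Prog :=
  forProg 8 1 (.ite (field 2 (.reg 8)) .skip (.seq findLong
    (.seq (.store (adr 2 (.reg 8)) (.lit 1)) (.seq (.store (adr 4 (.reg 8)) (.lit 0))
      (.seq (.store (adr 3 (.reg 8)) (field 3 (.reg 16)))
        (.seq (.store (adr 2 (.reg 16)) (.bin .sub (field 2 (.reg 16)) (.lit 1)))
          (.store (adr 3 (.reg 16)) (.bin .add (field 3 (.reg 16)) (field 4 (.reg 16))))))))))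

/-- Write the progressions in the form required of the answer. -/
def output : Prog :=
  forProg 8 1 (.seq (.store (.bin .mul (.lit 3) (.reg 8)) (field 3 (.reg 8)))
    (.seq (.store (.bin .add (.bin .mul (.lit 3) (.reg 8)) (.lit 1)) (field 4 (.reg 8)))
      (.store (.bin .add (.bin .mul (.lit 3) (.reg 8)) (.lit 2))
        (.bin .sub (field 2 (.reg 8)) (.lit 1)))))

section

variable {xs : List ℤ} {k G : ℕ} {lo : ℤ} {τ : ℕ → Bool} {σ : Sweep} {s : State}

theorem Rep.findLong (hB : Big xs k lo G) (hs : s.Bdd G) (h : Rep xs k lo τ σ s) {r : ℕ}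
    (hr : r < k) (hcr : 1 < σ.cnt r) :
    Runs G findLong s (1000 * (k + 1)) fun s' => Rep xs k lo τ σ s' ∧ s'.reg 8 = s.reg 8 ∧
      ∃ r < k, s'.reg 16 = (r : ℕ) ∧ 1 < σ.cnt r := by
  have h8 := hB.eight
  refine Runs.forLoop h8 (fun m s' => Rep xs k lo τ σ s' ∧ s'.reg 8 = s.reg 8 ∧
      ((∃ r < k, s'.reg 16 = (r : ℕ) ∧ 1 < σ.cnt r) ∨ ∀ j < m, σ.cnt j ≤ 1))
    k 258 hB.k_le hs ⟨h.reg (by norm_num) _, by simp, Or.inr (by simp)⟩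
    (fun m s' h' => h'.1.num) ?_ ?_ (by omega)
  · rintro m hm s₁ hs₁ ⟨hR, hr8, hI⟩ h18
    have hev : (Expr.bin .lt (.lit 1) (field 2 (.reg 18))).eval s₁
        = if 1 < σ.cnt m then 1 else 0 := by
      simp [Expr.eval, BinOp.apply, h18, hR.cnt m hm]
    refine Runs.ite h8 hs₁ (by decide) (T' := 129) (by omega) (fun hne => ?_) (fun hz => ?_)
    · have h1 : 1 < σ.cnt m := by
        by_contra hcon
        rw [hev, if_neg hcon] at hne
        exact hne rfl
      have := hB.k_le
      refine Runs.assign h8 hs₁ (by decide) (m : ℕ) h18 (by rw [Int.natAbs_natCast]; omega)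
        (by omega) ⟨by simpa using h18, (hR.reg (by norm_num) _).reg (by norm_num) _,
          by simpa using hr8, Or.inl ⟨m, hm, by simp, h1⟩⟩
    · have h1 : ¬ 1 < σ.cnt m := by
        intro hcon
        rw [hev, if_pos hcon] at hz
        omega
      refine Runs.skip hs₁ (by omega) ⟨h18, hR.reg (by norm_num) _, by simpa using hr8, ?_⟩
      refine hI.imp (fun ⟨r, h1, h2, h3⟩ => ⟨r, h1, by simpa using h2, h3⟩) fun hI j hj => ?_
      rcases Nat.lt_succ_iff_lt_or_eq.1 hj with hj | rfl
      · exact hI j hj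
      · omega
  · rintro s' hs' ⟨hR, hr8, hI⟩
    refine ⟨hR, hr8, hI.resolve_right fun hI => ?_⟩
    have := hI r hr
    omega

theorem Rep.fill (hB : Big xs k lo G) (hxs : xs.Nodup) (hk : k ≤ xs.length) (hs : s.Bdd G)
    (h : Rep xs k lo τ σ s) (hσ : σ.Valid xs.toFinset k lo) (hst : σ.status = 1) :
    Runs G fill s (4000 * (k + 1) * (k + 1)) fun s' => ∃ σ', Rep xs k lo τ σ' s' ∧
      σ'.Valid xs.toFinset k lo ∧ σ'.status = 1 ∧ ∀ j < k, σ'.cnt j ≠ 0 := by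
  have h8 := hB.eight
  have hcard : xs.toFinset.card = xs.length := List.toFinset_card_of_nodup hxs
  refine Runs.forLoop h8 (fun m s' => ∃ σ', Rep xs k lo τ σ' s' ∧
      σ'.Valid xs.toFinset k lo ∧ σ'.status = 1 ∧ ∀ j < m, σ'.cnt j ≠ 0)
    k (1000 * (k + 1) + 1500) hB.k_le hs ⟨σ, h.reg (by norm_num) _, hσ, hst, by simp⟩
    (fun m s' ⟨σ', h', _⟩ => h'.num) ?_ (fun s' _ h' => h') ?_
  · rintro m hm s₁ hs₁ ⟨σ₁, hR, hV, hst, hpos⟩ h8m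
    have hev : (field 2 (.reg 8)).eval s₁ = (σ₁.cnt m : ℤ) := by
      rw [eval_field, ← hR.cnt m hm, ← h8m]; rfl
    refine Runs.ite h8 hs₁ (by decide) (T' := 1000 * (k + 1) + 1285) (by omega) (fun hne => ?_)
      (fun hz => ?_)
    · have hm0 : σ₁.cnt m ≠ 0 := by rw [hev] at hne; exact_mod_cast hne
      refine Runs.skip hs₁ (by omega) ⟨h8m, σ₁, hR.reg (by norm_num) _, hV, hst, fun j hj => ?_⟩
      rcases Nat.lt_succ_iff_lt_or_eq.1 hj with hj | rfl
      · exact hpos j hj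
      · exact hm0
    · have hm0 : σ₁.cnt m = 0 := by rw [hev] at hz; exact_mod_cast hz
      obtain ⟨r, hr, hcr⟩ := hV.exists_one_lt_cnt (hV.done hst) (hcard ▸ hk) hm hm0
      refine Runs.andThen (hR.findLong hB hs₁ hr hcr) (by omega) ?_
      rintro s₂ hs₂ ⟨hR₂, hr8, r, hr, h16, hcr⟩
      rw [h8m] at hr8
      have hmr : m ≠ r := by rintro rfl; omega
      refine Runs.storeThen h8 hs₂ (by decide) (by decide) (-2 - 4 * (m : ℤ)) (1 : ℕ)
        (by simp [Expr.eval, hr8]) rfl (by simp; omega) (by omega) fun hs₃ => ?_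
      have hR₃ := hR₂.setCnt m 1
      refine Runs.storeThen h8 hs₃ (by decide) (by decide) (-4 - 4 * (m : ℤ)) (0 : ℕ)
        (by simp [Expr.eval, hr8]) rfl (by simp) (by omega) fun hs₄ => ?_
      have hR₄ := hR₃.setDif m 0
      refine Runs.storeThen h8 hs₄ (by decide) (by decide) (-3 - 4 * (m : ℤ)) (σ₁.fst r)
        (by simp [Expr.eval, hr8]) ?_ (hR₄.fst r hr ▸ hs₄.2 _) (by omega) fun hs₅ => ?_
      · rw [← hR₄.fst r hr, ← h16]; rfl
      have hR₅ := hR₄.setFst m (σ₁.fst r)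
      have hcnt := (hR₅.cnt r hr).trans
        (congrArg Nat.cast (Function.update_of_ne hmr.symm 1 σ₁.cnt))
      have hcG : (σ₁.cnt r : ℤ).natAbs ≤ G := hcnt ▸ hs₅.2 _
      refine Runs.storeThen h8 hs₅ (by decide) (by decide) (-2 - 4 * (r : ℤ))
        ((σ₁.cnt r - 1 : ℕ) : ℤ) (by simp [Expr.eval, h16]) ?_ (by omega) (by omega)
        fun hs₆ => ?_
      · rw [Nat.cast_sub (by omega), ← hcnt, ← h16]; rfl
      have hR₆ := hR₅.setCnt r (σ₁.cnt r - 1)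
      have hfst := (hR₆.fst r hr).trans (Function.update_of_ne hmr.symm (σ₁.fst r) σ₁.fst)
      have hdif := (hR₆.dif r hr).trans
        (congrArg Nat.cast (Function.update_of_ne hmr.symm 0 σ₁.dif))
      refine Runs.store h8 hs₆ (by decide) (by decide) (-3 - 4 * (r : ℤ))
        (σ₁.fst r + σ₁.dif r) (by simp [Expr.eval, h16]) ?_ ?_ (by omega)
        ⟨hr8, σ₁.split m r, ?_, hV.split hm hr hm0 hcr, hst, fun j hj => ?_⟩
      · have key : ∀ s : State, s.reg 16 = (r : ℕ) → s.mem (-3 - 4 * (r : ℤ)) = σ₁.fst r →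
            s.mem (-4 - 4 * (r : ℤ)) = σ₁.dif r →
            (Expr.bin .add (field 3 (.reg 16)) (field 4 (.reg 16))).eval s
              = σ₁.fst r + σ₁.dif r := by
          intro s h1 h2 h3
          simp [Expr.eval, BinOp.apply, h1, h2, h3]
        exact key _ h16 hfst hdif
      · have hmem := (hV.cover (σ₁.fst r + σ₁.dif r)).1 ⟨r, hr, 1, hcr, by simp⟩
        have := hB.elem _ (List.mem_toFinset.1 hmem.1)
        omega
      · exact ((hR₆.setFst r _).reg (by norm_num) _).congr rfl rfl rfl (fun _ _ => rfl)
          (fun _ _ => rfl) (fun _ _ => rfl) (fun _ _ => rfl)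
      · by_cases hjr : j = r
        · subst hjr; simp [Sweep.split]; omega
        · by_cases hjm : j = m
          · subst hjm; simp [Sweep.split, hjr]
          · simpa [Sweep.split, hjr, hjm] using hpos j (by omega)
  · nlinarith

theorem Rep.output (hB : Big xs k lo G) (hs : s.Bdd G) (h : Rep xs k lo τ σ s)
    (hpos : ∀ j < k, σ.cnt j ≠ 0) :
    Runs G output s (2000 * (k + 1)) fun s' => ∀ j : ℕ, j < k → s'.mem (3 * (j : ℤ)) = σ.fst j ∧
      s'.mem (3 * (j : ℤ) + 1) = σ.dif j ∧ s'.mem (3 * (j : ℤ) + 2) = (σ.cnt j - 1 : ℕ) := by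
  have h8 := hB.eight
  refine Runs.forLoop h8 (fun m s' => s'.reg 1 = k ∧ (∀ a < 0, s'.mem a = s.mem a) ∧
      ∀ j < m, s'.mem (3 * (j : ℤ)) = σ.fst j ∧
      s'.mem (3 * (j : ℤ) + 1) = σ.dif j ∧ s'.mem (3 * (j : ℤ) + 2) = (σ.cnt j - 1 : ℕ))
    k 1000 hB.k_le hs ⟨by simpa using h.num, by simp, by simp⟩
    (fun m s' h' => h'.1) ?_ (fun s' _ h' => h'.2.2) (by omega)
  rintro m hm s₁ hs₁ ⟨h1, hmem, hI⟩ h8m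
  have hfst : s₁.mem (-3 - 4 * (m : ℤ)) = σ.fst m := by rw [hmem _ (by omega), h.fst m hm]
  have hdif : s₁.mem (-4 - 4 * (m : ℤ)) = σ.dif m := by rw [hmem _ (by omega), h.dif m hm]
  have hcnt : s₁.mem (-2 - 4 * (m : ℤ)) = σ.cnt m := by rw [hmem _ (by omega), h.cnt m hm]
  have hfG : (σ.fst m).natAbs ≤ G := hfst ▸ hs₁.2 _
  have hdG : (σ.dif m : ℤ).natAbs ≤ G := hdif ▸ hs₁.2 _
  have hcG : (σ.cnt m : ℤ).natAbs ≤ G := hcnt ▸ hs₁.2 _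
  have hp := hpos m hm
  refine Runs.storeThen h8 hs₁ (by decide) (by decide) (3 * (m : ℤ)) (σ.fst m)
    (by simp [Expr.eval, BinOp.apply, h8m]) (by simp [Expr.eval, h8m, hfst]) hfG (by omega)
    fun hs₂ => ?_
  refine Runs.storeThen h8 hs₂ (by decide) (by decide) (3 * (m : ℤ) + 1) (σ.dif m)
    (by simp [Expr.eval, BinOp.apply, h8m]) ?_ hdG (by omega) fun hs₃ => ?_
  · simp only [eval_field, Expr.eval, h8m]
    rw [Function.update_of_ne (by omega), hdif]
  refine Runs.store h8 hs₃ (by decide) (by decide) (3 * (m : ℤ) + 2) ((σ.cnt m - 1 : ℕ) : ℤ)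
    (by simp [Expr.eval, BinOp.apply, h8m]) ?_ (by omega) (by omega)
    ⟨h8m, by simpa using h1, fun a ha => ?_, fun j hj => ?_⟩
  · simp only [eval_field, Expr.eval, h8m, BinOp.apply]
    rw [Function.update_of_ne (by omega), Function.update_of_ne (by omega), hcnt]
    omega
  · dsimp only
    rw [Function.update_of_ne (by omega), Function.update_of_ne (by omega),
      Function.update_of_ne (by omega), hmem a ha]
  · dsimp only
    rcases Nat.lt_succ_iff_lt_or_eq.1 hj with hj | rfl
    · refine ⟨?_, ?_, ?_⟩ <;> rw [Function.update_of_ne (by omega),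
        Function.update_of_ne (by omega), Function.update_of_ne (by omega)]
      · exact (hI j hj).1
      · exact (hI j hj).2.1
      · exact (hI j hj).2.2
    · refine ⟨?_, ?_, ?_⟩
      · rw [Function.update_of_ne (by omega), Function.update_of_ne (by omega),
          Function.update_self]
      · rw [Function.update_of_ne (by omega), Function.update_self]
      · rw [Function.update_self]

end

end WordRAM

/-! ### From solutions to exact covers and back -/

theorem apSet_reverse (a d : ℤ) (x : ℕ) : apSet a d x = apSet (a + x * d) (-d) x := by
  ext z
  constructor
  · rintro ⟨i, hi, rfl⟩
    exact ⟨x - i, Nat.sub_le _ _, by rw [Nat.cast_sub hi]; ring⟩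
  · rintro ⟨i, hi, rfl⟩
    exact ⟨x - i, Nat.sub_le _ _, by rw [Nat.cast_sub hi]; ring⟩

/-- An arithmetic progression is the set of elements of a residue class in an interval that starts
with such an element. -/
theorem IsAP.exists_interval {S : Set ℤ} (h : IsAP S) : ∃ (a e : ℤ) (δ : ℕ), 0 < δ ∧ a ≤ e ∧
    ∀ y, y ∈ S ↔ a ≤ y ∧ y ≤ e ∧ (δ : ℤ) ∣ y - a := by
  have key : ∀ (a : ℤ) (δ x : ℕ), 0 < δ → ∃ (a' e : ℤ) (δ' : ℕ), 0 < δ' ∧ a' ≤ e ∧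
      ∀ y, y ∈ apSet a δ x ↔ a' ≤ y ∧ y ≤ e ∧ (δ' : ℤ) ∣ y - a' := by
    intro a δ x hδ
    have hδ' : (0 : ℤ) < δ := by exact_mod_cast hδ
    have h0 : ∀ i : ℕ, 0 ≤ (i : ℤ) * δ := fun i => by positivity
    refine ⟨a, a + x * δ, δ, hδ, by linarith [h0 x], fun y => ?_⟩
    constructor
    · rintro ⟨i, hi, rfl⟩
      have : (i : ℤ) * δ ≤ x * δ :=
        mul_le_mul_of_nonneg_right (by exact_mod_cast hi) hδ'.le
      exact ⟨by linarith [h0 i], by linarith, ⟨i, by ring⟩⟩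
    · rintro ⟨h1, h2, c, hc⟩
      have hc0 : 0 ≤ c := by
        by_contra hcon
        have := mul_neg_of_pos_of_neg hδ' (not_le.1 hcon)
        linarith
      obtain ⟨i, rfl⟩ := Int.eq_ofNat_of_zero_le hc0
      refine ⟨i, ?_, by rw [mul_comm]; linarith⟩
      have : (δ : ℤ) * i ≤ δ * x := by linarith [mul_comm (x : ℤ) δ]
      exact_mod_cast le_of_mul_le_mul_left this hδ'
  obtain ⟨a, d, x, rfl⟩ := h
  rcases lt_trichotomy d 0 with hd | rfl | hd
  · rw [apSet_reverse]
    obtain ⟨δ, hδ⟩ := Int.eq_ofNat_of_zero_le (show 0 ≤ -d by omega)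
    rw [hδ]
    exact key _ δ x (by omega)
  · refine ⟨a, a, 1, one_pos, le_rfl, fun y => ?_⟩
    have : y ∈ apSet a 0 x ↔ y = a :=
      ⟨fun ⟨i, _, h⟩ => by simpa using h, fun h => ⟨0, Nat.zero_le _, by simp [h]⟩⟩
    rw [this]
    simp only [Nat.cast_one, one_dvd, and_true]
    omega
  · obtain ⟨δ, rfl⟩ := Int.eq_ofNat_of_zero_le hd.le
    exact key _ δ x (by omega)

theorem IsXCAPSolution.nonempty_exactCover {X : Finset ℤ} {k : ℕ} {S : Fin k → Set ℤ}
    (h : IsXCAPSolution X k S) : Nonempty (ExactCover X k) := by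
  obtain ⟨hAP, hdisj, hunion⟩ := h
  choose a e δ hδ hle hmem using fun j => (hAP j).exists_interval
  have hS : ∀ (j : ℕ) (hj : j < k) (y : ℤ), y ∈ S ⟨j, hj⟩ ↔
      (if hj : j < k then a ⟨j, hj⟩ else 0) ≤ y ∧ y ≤ (if hj : j < k then e ⟨j, hj⟩ else 0) ∧
      ((if hj : j < k then δ ⟨j, hj⟩ else 1 : ℕ) : ℤ) ∣
        y - (if hj : j < k then a ⟨j, hj⟩ else 0) := by
    intro j hj y
    simpa [hj] using hmem ⟨j, hj⟩ y
  refine ⟨⟨fun j => if hj : j < k then a ⟨j, hj⟩ else 0,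
    fun j => if hj : j < k then e ⟨j, hj⟩ else 0, fun j => if hj : j < k then δ ⟨j, hj⟩ else 1,
    fun j => ?_, fun j => ?_, fun y => ?_, fun y j j' hj hj' h1 h2 => ?_⟩⟩
  · split_ifs
    · exact hδ _
    · exact one_pos
  · split_ifs
    · exact hle _
    · exact le_rfl
  · rw [← Finset.mem_coe, ← hunion, Set.mem_iUnion]
    constructor
    · rintro ⟨⟨j, hj⟩, hy⟩
      exact ⟨j, hj, (hS j hj y).1 hy⟩
    · rintro ⟨j, hj, hy⟩
      exact ⟨⟨j, hj⟩, (hS j hj y).2 hy⟩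
  · by_contra hne
    exact Set.disjoint_left.1 (hdisj ⟨j, hj⟩ ⟨j', hj'⟩ (by simpa using hne))
      ((hS j hj y).2 h1) ((hS j' hj' y).2 h2)

theorem ExactCover.le_card {X : Finset ℤ} {k : ℕ} (C : ExactCover X k) : k ≤ X.card := by
  rw [← Finset.card_range k]
  refine Finset.card_le_card_of_injOn C.a (fun j hj => C.a_mem (by simpa using hj)) ?_
  intro j hj j' hj' hjj
  refine C.disj (C.a j) j j' (by simpa using hj) (by simpa using hj') ⟨le_rfl, C.le j, by simp⟩ ?_
  rw [hjj]
  exact ⟨le_rfl, C.le j', by simp⟩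

theorem Sweep.Valid.isXCAPSolution {X : Finset ℤ} {k : ℕ} {lo : ℤ} {σ : Sweep}
    (h : σ.Valid X k lo) (hall : ∀ y ∈ X, y ≤ σ.cur) (hpos : ∀ j < k, σ.cnt j ≠ 0) :
    IsXCAPSolution X k fun j : Fin k => apSet (σ.fst j) (σ.dif j) (σ.cnt j - 1) := by
  have hmem : ∀ (j : Fin k) (y : ℤ),
      y ∈ apSet (σ.fst j) (σ.dif j) (σ.cnt j - 1) ↔ σ.Elem j y := by
    intro j y
    have := hpos j j.2
    constructor
    · rintro ⟨i, hi, hy⟩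
      exact ⟨i, by omega, hy⟩
    · rintro ⟨i, hi, hy⟩
      exact ⟨i, by omega, hy⟩
  refine ⟨fun j => ⟨_, _, _, rfl⟩, fun i j hij => Set.disjoint_left.2 fun y hi hj => hij ?_, ?_⟩
  · exact Fin.ext (h.disj y i j i.2 j.2 ((hmem i y).1 hi) ((hmem j y).1 hj))
  · ext y
    rw [Set.mem_iUnion, Finset.mem_coe]
    simp only [hmem]
    constructor
    · rintro ⟨j, hj⟩
      exact ((h.cover y).1 ⟨j, j.2, hj⟩).1
    · intro hy
      obtain ⟨j, hj, e⟩ := (h.cover y).2 ⟨hy, hall y hy⟩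
      exact ⟨⟨j, hj⟩, e⟩

/-- If there is an exact cover, some number has the binary digits that lead to success. -/
theorem ExactCover.exists_success_tape {X : Finset ℤ} {k : ℕ} (C : ExactCover X k) {lo : ℤ}
    (hlo : ∀ y ∈ X, lo < y) : ∃ v < 2 ^ Sweep.tapeBits k, ∃ σ : Sweep,
      σ.Final X k lo v.testBit ∧ σ.status = 1 := by
  obtain ⟨τ₀, h⟩ := Sweep.exists_success C hlo
  obtain ⟨m, hm⟩ := h (Nat.ofBits fun i : Fin (Sweep.tapeBits k) => τ₀ i).testBit fun i hi => by
    rw [Nat.testBit_ofBits_lt _ _ hi]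
  exact ⟨_, Nat.ofBits_lt_two_pow _, _, ⟨by rw [hm]; exact one_ne_zero, m, rfl⟩, hm⟩

/-! ### The algorithm -/

namespace WordRAM

/-- Compute the constants, with a lower bound for all elements in register `2`, and set the status
to `2`. -/
def setup : Prog :=
  .seq (.assign 3 (.bin .mul (.bin .add (.reg 1) (.lit 1)) (.bin .add (.bin .add
      (.bin .mul (.reg 1) (.bin .add (.bin .mul (.lit 2) (.reg 1)) (.lit 1))) (.reg 1))
      (.bin .mul (.lit 2) (.bin .add (.bin .mul (.lit 4) (.reg 1)) (.lit 4))))))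
    (.seq (.assign 4 (.bin .add (.bin .mul (.lit 4) (.reg 1)) (.lit 4)))
      (.seq (.assign 7 (.lit 2))
        (.seq (forProg 8 0 (.ite (.bin .lt (.load (.reg 8)) (.reg 2))
            (.assign 2 (.load (.reg 8))) .skip))
          (.assign 2 (.bin .sub (.reg 2) (.lit 1))))))

/-- The algorithm for Exact Cover by Arithmetic Progressions. -/
def solve : Prog :=
  .ite (.bin .lt (.reg 0) (.reg 1)) (.assign 0 (.lit 0)) (.seq setup (.seq search
    (.ite (.reg 7) (.seq fill (.seq output (.assign 0 (.lit 1)))) (.assign 0 (.lit 0)))))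

theorem natAbs_le_maxAbs {xs : List ℤ} {x : ℤ} (hx : x ∈ xs) : x.natAbs ≤ maxAbs xs :=
  Finset.le_sup (f := Int.natAbs) (List.mem_toFinset.2 hx)

theorem bdd_xcapInput {xs : List ℤ} {k G : ℕ} (hn : xs.length ≤ G) (hk : k ≤ G)
    (hM : maxAbs xs ≤ G) : (xcapInput xs k).Bdd G := by
  constructor
  · intro r
    simp only [xcapInput]
    split_ifs <;> simp <;> assumption
  · intro a
    simp only [xcapInput]
    split_ifs
    · by_cases h : a.toNat < xs.length
      · rw [List.getD_eq_getElem _ _ h]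
        exact (natAbs_le_maxAbs (List.getElem_mem h)).trans hM
      · rw [List.getD_eq_default _ _ (not_lt.1 h)]
        exact Nat.zero_le _
    · exact Nat.zero_le _

theorem Rep.setLow {xs : List ℤ} {k : ℕ} {lo : ℤ} {τ : ℕ → Bool} {σ : Sweep} {s : State}
    (h : Rep xs k lo τ σ s) (v : ℤ) :
    Rep xs k v τ σ ⟨Function.update s.reg 2 v, s.mem⟩ := by
  obtain ⟨h1, h2, h3, h4, h5, h6, h7, h8, h9, h10, h11, h12, h13, h14⟩ := h
  constructor <;> first | assumption | simp

section

variable {xs : List ℤ} {k G : ℕ}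

theorem runs_setup (hM : maxAbs xs + 1 ≤ G) (hB : ∀ lo : ℤ, lo.natAbs ≤ G → Big xs k lo G) :
    Runs G setup (xcapInput xs k) (1000 * (xs.length + 2)) fun s' =>
      ∃ lo σ, Big xs k lo G ∧ (∀ y ∈ xs, lo < y) ∧ Rep xs k lo (0 : ℕ).testBit σ s' ∧
        σ.status = 2 := by
  have hB₀ := hB 0 (by simp)
  have h8 := hB₀.eight
  have hn := hB₀.size
  have hk := hB₀.k_le
  have hL := hB₀.bits
  have hd := hB₀.digits
  have hs : (xcapInput xs k).Bdd G := bdd_xcapInput (by omega) hk (by omega)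
  refine Runs.assignThen h8 hs (by decide) (Sweep.tapeBits k : ℕ) ?_
    (by rw [Int.natAbs_natCast]; exact hL) (by omega) fun hs₁ => ?_
  · simp [Expr.eval, BinOp.apply, xcapInput, Sweep.tapeBits, Sweep.phaseBits, Sweep.digits]
  refine Runs.assignThen h8 hs₁ (by decide) (Sweep.digits k : ℕ) ?_
    (by rw [Int.natAbs_natCast]; exact hd) (by omega) fun hs₂ => ?_
  · simp [Expr.eval, BinOp.apply, xcapInput, Sweep.digits]
  refine Runs.assignThen h8 hs₂ (by decide) (2 : ℕ) rfl (by simp; omega) (by omega) fun hs₃ => ?_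
  have hR : Rep xs k 0 (0 : ℕ).testBit { Sweep.init 0 with status := 2 }
      ⟨Function.update (Function.update (Function.update (xcapInput xs k).reg 3
        (Sweep.tapeBits k : ℕ)) 4 (Sweep.digits k : ℕ)) 7 (2 : ℕ), (xcapInput xs k).mem⟩ := by
    constructor
    case input => intro i hi; simp [xcapInput, hi]
    case tape =>
      intro i
      have : (0 : ℤ) ≤ xs.length + (i : ℤ) := by positivity
      have h2 : ((xs.length : ℤ) + (i : ℤ)).toNat = xs.length + i := by omega
      simp [xcapInput, this, h2]
    case act =>
      intro j _
      have : ¬ (0 : ℤ) ≤ -1 - 4 * (j : ℤ) := by omega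
      simp only [xcapInput, if_neg this]; rfl
    case cnt =>
      intro j _
      have : ¬ (0 : ℤ) ≤ -2 - 4 * (j : ℤ) := by omega
      simp only [xcapInput, if_neg this]; rfl
    case fst =>
      intro j _
      have : ¬ (0 : ℤ) ≤ -3 - 4 * (j : ℤ) := by omega
      simp only [xcapInput, if_neg this]; rfl
    case dif =>
      intro j _
      have : ¬ (0 : ℤ) ≤ -4 - 4 * (j : ℤ) := by omega
      simp only [xcapInput, if_neg this]; rfl
    all_goals simp [xcapInput, Sweep.init]
  refine Runs.andThen (T₁ := (xs.length + 1) * 516 + 129) (Runs.forLoop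
    (Q := fun s' => ∃ l : ℤ, l.natAbs ≤ maxAbs xs ∧ (∀ y ∈ xs, l ≤ y) ∧
      Rep xs k l (0 : ℕ).testBit { Sweep.init 0 with status := 2 } s') h8
    (fun m s' => ∃ l : ℤ, l.natAbs ≤ maxAbs xs ∧
      (∀ (i : ℕ) (hi : i < xs.length), i < m → l ≤ xs[i]) ∧
      Rep xs k l (0 : ℕ).testBit { Sweep.init 0 with status := 2 } s')
    xs.length 258 (by omega) hs₃ ⟨0, by simp, by simp, hR.reg (by norm_num) _⟩
    (fun m s' ⟨l, h'⟩ => h'.2.2.size) ?_ ?_ (by omega)) (by omega) ?_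
  · rintro m hm s₁ hs₁ ⟨l, hl, hle, hR⟩ h8m
    have hx := hR.input m hm
    have hxM := natAbs_le_maxAbs (List.getElem_mem hm)
    have hev : (Expr.bin .lt (.load (.reg 8)) (.reg 2)).eval s₁ = if xs[m] < l then 1 else 0 := by
      simp [Expr.eval, BinOp.apply, h8m, hx, hR.low]
    refine Runs.ite h8 hs₁ (by decide) (T' := 129) (by omega) (fun hne => ?_) (fun hz => ?_)
    · have hlt : xs[m] < l := by
        by_contra hcon
        rw [hev, if_neg hcon] at hne
        exact hne rfl
      refine Runs.assign h8 hs₁ (by decide) xs[m] (by simp [Expr.eval, h8m, hx]) (by omega)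
        (by omega) ⟨by simpa using h8m, xs[m], hxM, fun i hi him => ?_,
          (hR.setLow _).reg (by norm_num) _⟩
      rcases Nat.lt_succ_iff_lt_or_eq.1 him with him | rfl
      · exact hlt.le.trans (hle i hi him)
      · exact le_rfl
    · have hge : ¬ xs[m] < l := by
        intro hcon
        rw [hev, if_pos hcon] at hz
        omega
      refine Runs.skip hs₁ (by omega) ⟨h8m, l, hl, fun i hi him => ?_, hR.reg (by norm_num) _⟩
      rcases Nat.lt_succ_iff_lt_or_eq.1 him with him | rfl
      · exact hle i hi him
      · exact not_lt.1 hge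
  · rintro s' _ ⟨l, hl, hle, hR⟩
    refine ⟨l, hl, fun y hy => ?_, hR⟩
    obtain ⟨i, hi, rfl⟩ := List.mem_iff_getElem.1 hy
    exact hle i hi hi
  · rintro s' hs' ⟨l, hl, hle, hR⟩
    have hlG : (l - 1).natAbs ≤ G := by omega
    refine Runs.assign h8 hs' (by decide) (l - 1) (by simp [Expr.eval, BinOp.apply, hR.low]) hlG
      (by omega) ⟨l - 1, _, hB _ hlG, fun y hy => ?_, hR.setLow _, rfl⟩
    have := hle y hy
    omega

/-- Bounds for the running times of the search, of setup and output, and of `fill`. -/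
theorem exists_time_bounds {n k L : ℕ} (hk : k ≤ n) (hL : L = 2 * ((k + 1) * (k + 1) * (k + 4))) :
    ∃ U V F : ℕ, (2 ^ L + 1) * (61000 * (n + k + 1) * (k + 1) * (n + 1) + 3000 * (k + 1)
        + 2000 * (L + 1) + 1000) ≤ U ∧ 1000 * (n + 2) ≤ V ∧ 2000 * (k + 1) ≤ V ∧
      4000 * (k + 1) * (k + 1) ≤ F ∧
      U + 2 * V + F + 1000 ≤ 2 ^ (L + 1) * (200000 * (n + 1) ^ 3) := by
  obtain ⟨N, hN⟩ : ∃ N, N = n + 1 := ⟨_, rfl⟩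
  obtain ⟨K, hK⟩ : ∃ K, K = k + 1 := ⟨_, rfl⟩
  have hKN : K ≤ N := by omega
  have hN1 : 1 ≤ N := by omega
  have hN₃ : N ≤ N ^ 3 := Nat.le_self_pow (by norm_num) N
  have hA : 61000 * (n + k + 1) * K * N ≤ 122000 * N ^ 3 := by
    calc _ ≤ 61000 * (2 * N) * N * N := by gcongr; omega
      _ = _ := by ring
  have hL' : L ≤ 8 * N ^ 3 := by
    rw [hL, ← hK]
    calc _ ≤ 2 * (N * N * (4 * N)) := by gcongr; omega
      _ = _ := by ring
  have hF : 4000 * K * K ≤ 4000 * N ^ 3 := by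
    calc _ ≤ 4000 * N * (N * N) := by gcongr; exact hKN.trans (Nat.le_mul_self N)
      _ = _ := by ring
  have hp : 2 ^ L + 1 ≤ 2 ^ (L + 1) := by
    have := Nat.two_pow_pos L
    rw [pow_succ]; omega
  rw [← hN, ← hK]
  clear hL
  generalize N ^ 3 = N₃ at *
  refine ⟨2 ^ (L + 1) * (150000 * N₃), 3000 * N₃, 4000 * N₃, Nat.mul_le_mul hp
    ((Nat.add_le_add_right (Nat.add_le_add_right (Nat.add_le_add_right hA _) _) _).trans ?_), ?_,
    ?_, hF, ?_⟩
  · clear hA hF; omega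
  · clear hA hF; omega
  · clear hA hF; omega
  · have h2 : 2 ≤ 2 ^ (L + 1) := by have := Nat.two_pow_pos L; omega
    have := Nat.mul_le_mul_right (50000 * N₃) h2
    rw [show 2 ^ (L + 1) * (200000 * N₃)
      = 2 ^ (L + 1) * (150000 * N₃) + 2 ^ (L + 1) * (50000 * N₃) by ring]
    clear hA hF
    omega

theorem runs_solve (hxs : xs.Nodup) (hM : maxAbs xs + 1 ≤ G)
    (hB : ∀ lo : ℤ, lo.natAbs ≤ G → Big xs k lo G) :
    Runs G solve (xcapInput xs k) (2 ^ (Sweep.tapeBits k + 1) * (200000 * (xs.length + 1) ^ 3))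
      (XCAPAnswer xs.toFinset k) := by
  have hB₀ := hB 0 (by simp)
  have h8 := hB₀.eight
  have hs : (xcapInput xs k).Bdd G :=
    bdd_xcapInput (by have := hB₀.size; omega) hB₀.k_le (by omega)
  have hcard : xs.toFinset.card = xs.length := List.toFinset_card_of_nodup hxs
  have hno : ∀ S : Fin k → Set ℤ, IsXCAPSolution xs.toFinset k S → k ≤ xs.length := by
    intro S hS
    obtain ⟨C⟩ := hS.nonempty_exactCover
    exact hcard ▸ C.le_card
  have hev : (Expr.bin .lt (.reg 0) (.reg 1)).eval (xcapInput xs k)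
      = if xs.length < k then 1 else 0 := by
    simp [Expr.eval, BinOp.apply, xcapInput]
  have hp : 2 ≤ 2 ^ (Sweep.tapeBits k + 1) := by
    rw [pow_succ]
    have := Nat.two_pow_pos (Sweep.tapeBits k)
    omega
  have hN3 : 1 ≤ (xs.length + 1) ^ 3 := Nat.one_le_pow _ _ (by omega)
  set T := 2 ^ (Sweep.tapeBits k + 1) * (200000 * (xs.length + 1) ^ 3) with hT
  have hT1 : 400000 ≤ T := by
    have := Nat.mul_le_mul hp (Nat.mul_le_mul_left 200000 hN3)
    omega
  refine Runs.ite h8 hs (by decide) (T' := T - 129) (by omega) (fun hne => ?_) (fun hz => ?_)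
  · refine Runs.assign h8 hs (by decide) 0 rfl (by simp) (by omega) (Or.inr ⟨by simp, ?_⟩)
    rintro ⟨S, hS⟩
    rw [hev, if_neg (not_lt.2 (hno S hS))] at hne
    exact hne rfl
  have hk : k ≤ xs.length := by
    by_contra hcon
    rw [hev, if_pos (not_le.1 hcon)] at hz
    omega
  obtain ⟨U, V, F, hU, hV₁, hV₂, hF, hsum⟩ := exists_time_bounds hk (Sweep.tapeBits_eq k)
  rw [← hT] at hsum
  clear_value T
  refine Runs.andThen ((runs_setup hM hB).mono hV₁ fun _ _ h => h) (by omega) ?_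
  rintro s₁ hs₁ ⟨lo, σ, hB, hlo, hR, hst⟩
  have hlo' : ∀ y ∈ xs.toFinset, lo < y := fun y hy => hlo y (List.mem_toFinset.1 hy)
  refine Runs.andThen ((hR.search hB hxs hlo hs₁ hst).mono hU fun _ _ h => h) (by omega) ?_
  rintro s₂ hs₂ ⟨τ, σ', hR, hI⟩
  have h7 : (Expr.reg 7).eval s₂ = (σ'.status : ℤ) := hR.status
  refine Runs.ite h8 hs₂ (by decide) (T' := V + F + 129) (by clear hU hF; omega)
    (fun hne => ?_) (fun hz => ?_)
  · obtain ⟨hst, hV⟩ : σ'.status = 1 ∧ σ'.Valid xs.toFinset k lo := by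
      refine hI.resolve_right fun h0 => ?_
      rw [h7, h0.1] at hne
      exact hne rfl
    refine Runs.andThen ((hR.fill hB hxs hk hs₂ hV hst).mono hF fun _ _ h => h) (by omega) ?_
    rintro s₃ hs₃ ⟨σ'', hR, hV, hst, hpos⟩
    refine Runs.andThen ((hR.output hB hs₃ hpos).mono hV₂ fun _ _ h => h) (by omega) ?_
    intro s₄ hs₄ hout
    refine Runs.assign h8 hs₄ (by decide) 1 rfl (by simp; omega) (by omega) (Or.inl ⟨by simp, ?_⟩)
    exact ⟨_, _, _, fun j => hout j j.2, hV.isXCAPSolution (hV.done hst) hpos⟩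
  · have hfail := (hI.resolve_left fun h1 => by
      rw [h7, h1.1] at hz; exact absurd hz (by norm_num)).2
    refine Runs.assign h8 hs₂ (by decide) 0 rfl (by simp) (by omega) (Or.inr ⟨by simp, ?_⟩)
    rintro ⟨S, hS⟩
    obtain ⟨C⟩ := hS.nonempty_exactCover
    obtain ⟨v, hv, σ'', hF, h1⟩ := C.exists_success_tape hlo'
    exact hfail v hv σ'' hF h1

end

theorem big_of_pow {xs : List ℤ} {k : ℕ} {lo : ℤ}
    (hlo : lo.natAbs ≤ (xs.length + k + maxAbs xs + 2) ^ 7) :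
    Big xs k lo ((xs.length + k + maxAbs xs + 2) ^ 7) := by
  set b := xs.length + k + maxAbs xs + 2 with hb
  have hb2 : 2 ≤ b := by omega
  have hpow : ∀ {i : ℕ}, i ≤ 7 → b ^ i ≤ b ^ 7 := fun h => Nat.pow_le_pow_right (by omega) h
  have h1 : b ≤ b ^ 7 := Nat.le_self_pow (by norm_num) b
  have h2 : 2 * b ≤ b ^ 7 := by
    calc 2 * b ≤ b * b := by gcongr
      _ = b ^ 2 := (sq b).symm
      _ ≤ b ^ 7 := hpow (by norm_num)
  have h3 : 4 * b ≤ b ^ 7 := by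
    calc 4 * b = 2 * 2 * b := by ring
      _ ≤ b * b * b := by gcongr
      _ = b ^ 3 := by ring
      _ ≤ b ^ 7 := hpow (by norm_num)
  constructor
  case eight =>
    calc 8 = 2 ^ 3 := by norm_num
      _ ≤ b ^ 3 := by gcongr
      _ ≤ b ^ 7 := hpow (by norm_num)
  case size => omega
  case num =>
    calc k * k + k = k * (k + 1) := by ring
      _ ≤ b * b := by gcongr <;> omega
      _ = b ^ 2 := (sq b).symm
      _ ≤ b ^ 7 := hpow (by norm_num)
  case elem =>
    intro x hx
    have := natAbs_le_maxAbs hx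
    omega
  case low => exact hlo
  case tp =>
    calc _ = (k + 1) * (xs.length + 1) * (2 * k + 2 * Sweep.digits k) := by ring
      _ ≤ b * b * (2 * 2 * 2 * 2 * b) := by
        gcongr
        · omega
        · omega
        · simp only [Sweep.digits]; omega
      _ ≤ b * b * (b * b * b * b * b) := by gcongr
      _ = b ^ 7 := by ring
  case bits =>
    rw [Sweep.tapeBits_eq]
    calc _ ≤ 2 * (b * b * (2 * b)) := by gcongr <;> omega
      _ ≤ b * (b * b * (b * b)) := by gcongr
      _ = b ^ 5 := by ring
      _ ≤ b ^ 7 := hpow (by norm_num)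
  case digits =>
    simp only [Sweep.digits]; omega

end WordRAM

theorem Sweep.tapeBits_succ_le (k : ℕ) : Sweep.tapeBits k + 1 ≤ 41 * k ^ 3 + 9 := by
  rw [Sweep.tapeBits_eq]
  rcases Nat.eq_zero_or_pos k with rfl | hk
  · norm_num
  · have h : 2 * ((k + 1) * (k + 1) * (k + 4)) ≤ 2 * ((2 * k) * (2 * k) * (5 * k)) := by
      gcongr <;> omega
    have e : 2 * ((2 * k) * (2 * k) * (5 * k)) = 40 * k ^ 3 := by ring
    omega

theorem theorem2 :
    ∃ (P : WordRAM.Prog) (C w : ℕ) (p : Polynomial ℕ),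
      ∀ (xs : List ℤ) (k : ℕ), xs.Nodup →
        ∃ (s : WordRAM.State) (t : ℕ),
          WordRAM.Exec ((xs.length + k + maxAbs xs + 2) ^ w) P (xcapInput xs k) s t ∧
          t ≤ 2 ^ (C * k ^ 3) * p.eval xs.length ∧
          XCAPAnswer xs.toFinset k s := by
  refine ⟨WordRAM.solve, 41, 7 * 128,
    Polynomial.C (2 ^ 9 * 200000) * (Polynomial.X + 1) ^ 3, fun xs k hxs => ?_⟩
  have hM : maxAbs xs + 1 ≤ (xs.length + k + maxAbs xs + 2) ^ 7 :=
    le_trans (by omega) (Nat.le_self_pow (by norm_num) _)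
  obtain ⟨s, t, hrun, ht, -, hans⟩ := WordRAM.runs_solve hxs hM fun lo => WordRAM.big_of_pow
  refine ⟨s, t, by rwa [pow_mul], ht.trans ?_, hans⟩
  have hpow := Nat.pow_le_pow_right (Nat.two_pos) (Sweep.tapeBits_succ_le k)
  calc 2 ^ (Sweep.tapeBits k + 1) * (200000 * (xs.length + 1) ^ 3)
      ≤ 2 ^ (41 * k ^ 3 + 9) * (200000 * (xs.length + 1) ^ 3) := Nat.mul_le_mul_right _ hpow
    _ = 2 ^ (41 * k ^ 3) * (2 ^ 9 * 200000 * (xs.length + 1) ^ 3) := by rw [pow_add]; ring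
    _ = _ := by simp
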